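/- Let $d,N\ge 1$, $1\le p<\infty$. Let $A,B\in\mathbb C^{N,N}$ be simultaneously diagonalizable, i.e. $Y^{-1}AY$ and $Y^{-1}BY$ are diagonal for an invertible $Y\in\mathbb C^{N,N}$, let $\operatorname{Re}\mu>0$ for all $\mu\in\sigma(A)$, and let $S\in\mathbb R^{d,d}$ be skew-symmetric. With the spectral radius $\rho$ and the spectral abscissa $s(M)=\max\{\operatorname{Re}\mu:\mu\in\sigma(M)\}$ put $$a_{\min}=\rho(A^{-1})^{-1},\quad a_{\max}=\rho(A),\quad a_0=-s(-A),\quad b_0=-s(-B),\quad a_1=\frac{a_{\max}^2}{a_{\min}a_0},\quad \kappa=|Y||Y^{-1}|,$$ where $|\cdot|$ is the spectral norm. Let $$H(x,\xi,t)=(4\pi tA)^{-\frac d2}\exp\Big(-Bt-(4tA)^{-1}\big|e^{tS}x-\xi\big|^2\Big),\qquad [T(t)v](x)=\int_{\mathbb R^d}H(x,\xi,t)v(\xi)\,d\xi\ (t>0),\quad T(0)v=v,$$ with the principal matrix power. A radial weight function of exponential growth rate $\eta\ge 0$ is a continuous function $\theta:\mathbb R^d\to\,]0,\infty[$ that depends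 on $|x|$ only and satisfies $\theta(x+y)\le C_\theta\,\theta(x)e^{\eta|y|}$ for all $x,y\in\mathbb R^d$, with a constant $C_\theta>0$. Let $L^p_\theta$ be the space of all locally integrable $v:\mathbb R^d\to\mathbb C^N$ with $\|v\|_{L^p_\theta}=\|\theta v\|_{L^p}<\infty$, and let $W^{1,p}_\theta$ be the space of all $v\in L^p_\theta$ whose weak derivatives $D_iv$, $i=1,\dots,d$, lie in $L^p_\theta$. Let $A_{p,\theta}v=\lim_{t\downarrow0}\frac{T(t)v-v}{t}$, where $\mathcal D(A_{p,\theta})$ consists of all $v\in L^p_\theta$ for which this limit exists in $L^p_\theta$. Let $\theta_1$ be a radial weight function of exponential growth rate $\eta_1\ge0$ such that $$\lim_{|\psi|\to0}\ \sup_{x\in\mathbb R^d}\left|\frac{\theta_1(x+\psi)-\theta_1(x)}{\theta_1(x)}\right|=0 .$$ (i) Let $0<\vartheta<1$, $\varepsilon>0$, $$\omega=\omega_{p,\theta_1}=-b_0+(1+\varepsilon)\frac{a_{\max}^2\eta_1^2p}{a_0},$$ let $\lambda\in\mathbb C$ with $\operatorname{Re}\lambda>\omega$, and let $\theta_2$ be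 a radial weight function of exponential growth rate $\eta_2\ge0$, with constant $C_{\theta_2}$, such that $$\eta_2^2\le\vartheta\,\frac{a_0(\operatorname{Re}\lambda-\omega)}{a_{\max}^2p^2}\qquad\text{and}\qquad \exists\,C>0:\ \theta_1(x)\le C\theta_2(x)\ \ \forall x\in\mathbb R^d .$$ Let $g\in L^p_{\theta_1}\cap L^p_{\theta_2}$. Then the equation $(\lambda I-A_{p,\theta_1})v=g$ in $L^p_{\theta_1}$ has a unique solution $v_\star\in\mathcal D(A_{p,\theta_1})$; moreover $v_\star\in W^{1,p}_{\theta_2}$ and $$\|v_\star\|_{L^p_{\theta_2}}\le\frac{C_7}{\operatorname{Re}\lambda-\omega}\,\|g\|_{L^p_{\theta_2}},\qquad \|D_iv_\star\|_{L^p_{\theta_2}}\le\frac{C_8}{(\operatorname{Re}\lambda-\omega)^{1/2}}\,\|g\|_{L^p_{\theta_2}},\quad i=1,\dots,d,$$ where, with $r=\frac{\vartheta}{1-\vartheta}$ and with ${}_2F_1$ analytically continued to $]-\infty,1[$, $$C_7=C_{\theta_2}\kappa a_1^{\frac d2}\Big(\tfrac1{1-\vartheta}\Big)^{\frac1p}\bigg({}_2F_1\big(-\tfrac{d-1}2,1;\tfrac12;-r\big)+\pi^{\frac12}\frac{\Gamma(\frac{d+1}2)}{\Gamma(\frac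 d2)}\,r^{\frac12}\,{}_2F_1\big(-\tfrac{d-2}2,\tfrac32;\tfrac32;-r\big)\bigg)^{\frac1p},$$ $$C_8=C_{\theta_2}\kappa a_1^{\frac{d+1}2}\frac{\Gamma(\frac12)}{a_{\min}^{1/2}}\Big(\tfrac1{1-\vartheta}\Big)^{\frac1{2p}}\bigg(\frac{\Gamma(\frac{d+1}2)}{\Gamma(\frac d2)}\,{}_2F_1\big(-\tfrac d2,\tfrac12;\tfrac12;-r\big)+2\frac{\Gamma(\frac{d+2}2)}{\Gamma(\frac12)\Gamma(\frac d2)}\,r^{\frac12}\,{}_2F_1\big(-\tfrac{d-1}2,1;\tfrac32;-r\big)\bigg)^{\frac1p}.$$ (ii) $\mathcal D(A_{p,\theta_1})\subseteq W^{1,p}_{\theta_1}$. -/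

import Mathlib

open MeasureTheory Filter Topology Set
open scoped ENNReal ContDiff

noncomputable section

namespace OrnsteinUhlenbeck

/-! ### The Gauss hypergeometric function on the ray `z < 1` -/

/-- `F` is a real analytic function on `]-∞, 1[` which near `0` is the sum of the hypergeometric
series with parameters `a, b; c`. -/
def IsHypergeometricContinuation (a b c : ℝ) (F : ℝ → ℝ) : Prop :=
  AnalyticOnNhd ℝ F (Iio 1) ∧ F =ᶠ[𝓝 0] ordinaryHypergeometric a b c

open Classical in
/-- The Gauss hypergeometric function `₂F₁(a, b; c; z)` for real parameters and real `z < 1`.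
Mathlib's `ordinaryHypergeometric` is the sum of the power series, hence meaningful for `|z| < 1`
only; here `₂F₁` is its analytic continuation to the whole ray `]-∞, 1[`. -/
def hyp2F1 (a b c z : ℝ) : ℝ :=
  if h : ∃ F, IsHypergeometricContinuation a b c F then h.choose z else 0

/-- The analytic continuation is unique, so `hyp2F1` is independent of the choice in it. -/
theorem hyp2F1_eq {a b c : ℝ} {F : ℝ → ℝ} (hF : IsHypergeometricContinuation a b c F)
    {z : ℝ} (hz : z < 1) : hyp2F1 a b c z = F z := by
  have h : ∃ F, IsHypergeometricContinuation a b c F := ⟨F, hF⟩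
  have hc := h.choose_spec
  rw [hyp2F1, dif_pos h]
  exact hc.1.eqOn_of_preconnected_of_eventuallyEq hF.1 isPreconnected_Iio
    (z₀ := 0) (by simp) (hc.2.trans hF.2.symm) hz

/-! ### Matrices -/

/-- `Y` is invertible and `Y⁻¹ A Y`, `Y⁻¹ B Y` are both diagonal. -/
def SimultaneouslyDiagonalizes {N : ℕ} (Y A B : Matrix (Fin N) (Fin N) ℂ) : Prop :=
  IsUnit Y ∧ (Y⁻¹ * A * Y).IsDiag ∧ (Y⁻¹ * B * Y).IsDiag

/-- The spectral norm (operator norm for the Euclidean norm) of a complex matrix. -/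
def matSpectralNorm {N : ℕ} (M : Matrix (Fin N) (Fin N) ℂ) : ℝ :=
  ‖Matrix.toEuclideanCLM (n := Fin N) (𝕜 := ℂ) M‖

/-- The condition number `|Y| |Y⁻¹|`. -/
def condNumber {N : ℕ} (Y : Matrix (Fin N) (Fin N) ℂ) : ℝ := matSpectralNorm Y * matSpectralNorm Y⁻¹

/-- The spectral radius `ρ(M)` as a real number. -/
def specRadius {N : ℕ} (M : Matrix (Fin N) (Fin N) ℂ) : ℝ := (spectralRadius ℂ M).toReal

/-- The spectral abscissa `s(M) = max {Re μ : μ ∈ σ(M)}`. -/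
def specAbscissa {N : ℕ} (M : Matrix (Fin N) (Fin N) ℂ) : ℝ :=
  sSup (Complex.re '' spectrum ℂ M)

/-- `a_min = ρ(A⁻¹)⁻¹`. -/
def aMin {N : ℕ} (A : Matrix (Fin N) (Fin N) ℂ) : ℝ := (specRadius A⁻¹)⁻¹

/-- `a_max = ρ(A)`. -/
def aMax {N : ℕ} (A : Matrix (Fin N) (Fin N) ℂ) : ℝ := specRadius A

/-- `-s(-M)`; this is `a₀` for `M = A` and `b₀` for `M = B`. -/
def lowerAbscissa {N : ℕ} (M : Matrix (Fin N) (Fin N) ℂ) : ℝ := -specAbscissa (-M)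

/-- `a₁ = a_max² / (a_min a₀)`. -/
def a1 {N : ℕ} (A : Matrix (Fin N) (Fin N) ℂ) : ℝ :=
  aMax A ^ 2 / (aMin A * lowerAbscissa A)

/-- The function `f(M) = Y diag(f(μ₁), …, f(μ_N)) Y⁻¹` of a matrix `M = Y diag(μ₁, …, μ_N) Y⁻¹`
that is diagonalized by `Y`. -/
def matFun {N : ℕ} (Y M : Matrix (Fin N) (Fin N) ℂ) (f : ℂ → ℂ) : Matrix (Fin N) (Fin N) ℂ :=
  Y * Matrix.diagonal (fun k => f ((Y⁻¹ * M * Y) k k)) * Y⁻¹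

/-- `f(M)` does not depend on the diagonalizing matrix. -/
theorem matFun_eq {N : ℕ} {Y Z M : Matrix (Fin N) (Fin N) ℂ} (hY : IsUnit Y) (hZ : IsUnit Z)
    (hYM : (Y⁻¹ * M * Y).IsDiag) (hZM : (Z⁻¹ * M * Z).IsDiag) (f : ℂ → ℂ) :
    matFun Y M f = matFun Z M f := by
  have hY1 : Y * Y⁻¹ = 1 := Matrix.mul_nonsing_inv _ ((Matrix.isUnit_iff_isUnit_det _).1 hY)
  have hZ1 : Z * Z⁻¹ = 1 := Matrix.mul_nonsing_inv _ ((Matrix.isUnit_iff_isUnit_det _).1 hZ)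
  have hY2 : Y⁻¹ * Y = 1 := Matrix.nonsing_inv_mul _ ((Matrix.isUnit_iff_isUnit_det _).1 hY)
  obtain ⟨u, hu⟩ : ∃ u, Y⁻¹ * M * Y = Matrix.diagonal u := ⟨_, hYM.diagonal_diag.symm⟩
  obtain ⟨w, hw⟩ : ∃ w, Z⁻¹ * M * Z = Matrix.diagonal w := ⟨_, hZM.diagonal_diag.symm⟩
  have hc : Matrix.diagonal u * (Y⁻¹ * Z) = (Y⁻¹ * Z) * Matrix.diagonal w := by
    rw [← hu, ← hw]
    calc Y⁻¹ * M * Y * (Y⁻¹ * Z) = Y⁻¹ * M * (Y * Y⁻¹) * Z := by simp only [Matrix.mul_assoc]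
      _ = Y⁻¹ * (Z * Z⁻¹) * M * Z := by rw [hY1, hZ1]; simp
      _ = _ := by simp only [Matrix.mul_assoc]
  have hf : Matrix.diagonal (fun k => f (u k)) * (Y⁻¹ * Z)
      = (Y⁻¹ * Z) * Matrix.diagonal (fun k => f (w k)) := by
    ext i j
    have h := congrFun (congrFun hc i) j
    rw [Matrix.diagonal_mul, Matrix.mul_diagonal] at h ⊢
    by_cases h0 : (Y⁻¹ * Z) i j = 0
    · simp [h0]
    · have : u i = w j := mul_right_cancel₀ h0 (h.trans (mul_comm _ _))
      rw [this, mul_comm]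
  simp only [matFun, hu, hw, Matrix.diagonal_apply_eq]
  calc Y * Matrix.diagonal (fun k => f (u k)) * Y⁻¹
      = Y * (Matrix.diagonal (fun k => f (u k)) * (Y⁻¹ * Z)) * Z⁻¹ := by
        simp only [Matrix.mul_assoc, hZ1, Matrix.mul_one]
    _ = (Y * Y⁻¹) * Z * Matrix.diagonal (fun k => f (w k)) * Z⁻¹ := by
        rw [hf]; simp only [Matrix.mul_assoc]
    _ = _ := by rw [hY1, Matrix.one_mul]

/-! ### Heat kernel matrix and semigroup -/

/-- The rotation `x ↦ e^{tS} x`. -/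
def expRotation {d : ℕ} (S : Matrix (Fin d) (Fin d) ℝ) (t : ℝ) (x : EuclideanSpace ℝ (Fin d)) :
    EuclideanSpace ℝ (Fin d) :=
  Matrix.toEuclideanCLM (n := Fin d) (𝕜 := ℝ) (NormedSpace.exp (t • S)) x

/-- The kernel `H(x, ξ, t) = (4πtA)^{-d/2} exp(-Bt - (4tA)⁻¹ |e^{tS}x - ξ|²)`. The first factor is
the principal power of the matrix `4πtA`, which is diagonalized by `Y`. -/
def heatKernel {d N : ℕ} (Y A B : Matrix (Fin N) (Fin N) ℂ) (S : Matrix (Fin d) (Fin d) ℝ)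
    (x ξ : EuclideanSpace ℝ (Fin d)) (t : ℝ) : Matrix (Fin N) (Fin N) ℂ :=
  matFun Y (((4 * Real.pi * t : ℝ) : ℂ) • A) (fun z => z ^ (-(d : ℂ) / 2)) *
    NormedSpace.exp (-((t : ℂ) • B)
      - ((‖expRotation S t x - ξ‖ ^ 2 : ℝ) : ℂ) • (((4 * t : ℝ) : ℂ) • A)⁻¹)

/-- `[T(t)v](x) = ∫ H(x, ξ, t) v(ξ) dξ` for `t > 0`, and `T(0)v = v`. -/
def ouSemigroup {d N : ℕ} (Y A B : Matrix (Fin N) (Fin N) ℂ) (S : Matrix (Fin d) (Fin d) ℝ)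
    (t : ℝ) (v : EuclideanSpace ℝ (Fin d) → EuclideanSpace ℂ (Fin N))
    (x : EuclideanSpace ℝ (Fin d)) : EuclideanSpace ℂ (Fin N) :=
  if 0 < t then
    ∫ ξ, Matrix.toEuclideanCLM (n := Fin N) (𝕜 := ℂ) (heatKernel Y A B S x ξ t) (v ξ)
  else v x

/-! ### Weight functions and weighted spaces -/

/-- `θ` is a radial weight function of exponential growth rate `η ≥ 0`, with constant `Cθ` in the
growth condition. -/
structure IsRadialWeight {d : ℕ} (θ : EuclideanSpace ℝ (Fin d) → ℝ) (η Cθ : ℝ) : Prop where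
  continuous : Continuous θ
  rate_nonneg : 0 ≤ η
  const_pos : 0 < Cθ
  pos : ∀ x, 0 < θ x
  growth : ∀ x y, θ (x + y) ≤ Cθ * θ x * Real.exp (η * ‖y‖)
  radial : ∃ φ : ℝ → ℝ, ∀ x, θ x = φ ‖x‖

/-- `sup_x |(θ(x + ψ) - θ(x)) / θ(x)| → 0` as `|ψ| → 0`. -/
def WeightTranslationContinuous {d : ℕ} (θ : EuclideanSpace ℝ (Fin d) → ℝ) : Prop :=
  ∀ ε > 0, ∃ δ > 0, ∀ ψ, ‖ψ‖ ≤ δ → ∀ x, |(θ (x + ψ) - θ x) / θ x| ≤ ε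

/-- The norm `‖v‖_{L^p_θ} = ‖θ v‖_{L^p}`, with values in `[0, ∞]`. -/
def wNorm {d N : ℕ} (θ : EuclideanSpace ℝ (Fin d) → ℝ) (p : ℝ)
    (v : EuclideanSpace ℝ (Fin d) → EuclideanSpace ℂ (Fin N)) : ℝ≥0∞ :=
  eLpNorm (fun x => θ x • v x) (ENNReal.ofReal p) volume

/-- `v ∈ L^p_θ(ℝ^d, ℂ^N)`: `v` is locally integrable and `‖θ v‖_{L^p} < ∞`. -/
def MemWLp {d N : ℕ} (θ : EuclideanSpace ℝ (Fin d) → ℝ) (p : ℝ)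
    (v : EuclideanSpace ℝ (Fin d) → EuclideanSpace ℂ (Fin N)) : Prop :=
  LocallyIntegrable v volume ∧ wNorm θ p v < ⊤

/-- `w` is the weak partial derivative `D_i v` on `ℝ^d`. -/
def HasWeakPartialDeriv {d N : ℕ} (i : Fin d)
    (v w : EuclideanSpace ℝ (Fin d) → EuclideanSpace ℂ (Fin N)) : Prop :=
  LocallyIntegrable v volume ∧ LocallyIntegrable w volume ∧
    ∀ φ : EuclideanSpace ℝ (Fin d) → ℝ, ContDiff ℝ ∞ φ → HasCompactSupport φ →
      ∫ x, (fderiv ℝ φ x (EuclideanSpace.single i 1)) • v x = -∫ x, φ x • w x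

/-- `v ∈ W^{1,p}_θ(ℝ^d, ℂ^N)`. -/
def MemWSobolev {d N : ℕ} (θ : EuclideanSpace ℝ (Fin d) → ℝ) (p : ℝ)
    (v : EuclideanSpace ℝ (Fin d) → EuclideanSpace ℂ (Fin N)) : Prop :=
  MemWLp θ p v ∧ ∀ i, ∃ w, HasWeakPartialDeriv i v w ∧ MemWLp θ p w

/-! ### Infinitesimal generator and resolvent equation -/

/-- `v ∈ D(A_{p,θ})` and `A_{p,θ} v = w`, that is, `v, w ∈ L^p_θ` and `(T(t)v - v)/t → w` in
`L^p_θ` as `t ↓ 0`. -/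
def IsGeneratorAt {d N : ℕ} (Y A B : Matrix (Fin N) (Fin N) ℂ) (S : Matrix (Fin d) (Fin d) ℝ)
    (p : ℝ) (θ : EuclideanSpace ℝ (Fin d) → ℝ)
    (v w : EuclideanSpace ℝ (Fin d) → EuclideanSpace ℂ (Fin N)) : Prop :=
  MemWLp θ p v ∧ MemWLp θ p w ∧
    Tendsto (fun t : ℝ => wNorm θ p (fun x => t⁻¹ • (ouSemigroup Y A B S t v x - v x) - w x))
      (𝓝[>] 0) (𝓝 0)

/-- `v ∈ D(A_{p,θ})`. -/
def MemGeneratorDomain {d N : ℕ} (Y A B : Matrix (Fin N) (Fin N) ℂ)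
    (S : Matrix (Fin d) (Fin d) ℝ) (p : ℝ) (θ : EuclideanSpace ℝ (Fin d) → ℝ)
    (v : EuclideanSpace ℝ (Fin d) → EuclideanSpace ℂ (Fin N)) : Prop :=
  ∃ w, IsGeneratorAt Y A B S p θ v w

/-- `v ∈ D(A_{p,θ})` and `(λ I - A_{p,θ}) v = g` in `L^p_θ`. -/
def SolvesResolventEq {d N : ℕ} (Y A B : Matrix (Fin N) (Fin N) ℂ)
    (S : Matrix (Fin d) (Fin d) ℝ) (p : ℝ) (θ : EuclideanSpace ℝ (Fin d) → ℝ) (lam : ℂ)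
    (g v : EuclideanSpace ℝ (Fin d) → EuclideanSpace ℂ (Fin N)) : Prop :=
  ∃ w, IsGeneratorAt Y A B S p θ v w ∧ (fun x => lam • v x - w x) =ᵐ[volume] g

/-! ### Constants -/

/-- `ω = -b₀ + (1 + ε) a_max² η² p / a₀`. -/
def growthBound {N : ℕ} (A B : Matrix (Fin N) (Fin N) ℂ) (p η ε : ℝ) : ℝ :=
  -lowerAbscissa B + (1 + ε) * (aMax A ^ 2 * η ^ 2 * p / lowerAbscissa A)

/-- The constant `C₇`, where `τ` stands for `ϑ`. -/
def C7 {N : ℕ} (d : ℕ) (Y A : Matrix (Fin N) (Fin N) ℂ) (p Cθ τ : ℝ) : ℝ :=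
  Cθ * condNumber Y * a1 A ^ ((d : ℝ) / 2) * (1 / (1 - τ)) ^ (1 / p) *
    (hyp2F1 (-((d : ℝ) - 1) / 2) 1 (1 / 2) (-(τ / (1 - τ)))
      + Real.pi ^ (1 / 2 : ℝ) * (Real.Gamma (((d : ℝ) + 1) / 2) / Real.Gamma ((d : ℝ) / 2))
        * (τ / (1 - τ)) ^ (1 / 2 : ℝ)
        * hyp2F1 (-((d : ℝ) - 2) / 2) (3 / 2) (3 / 2) (-(τ / (1 - τ)))) ^ (1 / p)

/-- The constant `C₈`, where `τ` stands for `ϑ`. -/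
def C8 {N : ℕ} (d : ℕ) (Y A : Matrix (Fin N) (Fin N) ℂ) (p Cθ τ : ℝ) : ℝ :=
  Cθ * condNumber Y * a1 A ^ (((d : ℝ) + 1) / 2) * (Real.Gamma (1 / 2) / aMin A ^ (1 / 2 : ℝ))
    * (1 / (1 - τ)) ^ (1 / (2 * p)) *
    (Real.Gamma (((d : ℝ) + 1) / 2) / Real.Gamma ((d : ℝ) / 2)
        * hyp2F1 (-(d : ℝ) / 2) (1 / 2) (1 / 2) (-(τ / (1 - τ)))
      + 2 * (Real.Gamma (((d : ℝ) + 2) / 2) / (Real.Gamma (1 / 2) * Real.Gamma ((d : ℝ) / 2)))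
        * (τ / (1 - τ)) ^ (1 / 2 : ℝ)
        * hyp2F1 (-((d : ℝ) - 1) / 2) 1 (3 / 2) (-(τ / (1 - τ)))) ^ (1 / p)

end OrnsteinUhlenbeck

end

open OrnsteinUhlenbeck

/-! The solution is the Laplace transform of the semigroup, `resolventOp`: v = ∫₀^∞ e^{-λt} T(t)g
dt. The usual argument of semigroup theory shows that it solves the equation and that nothing else
does. Its inputs are the semigroup law `heatOp_heatOp`, strong continuity at 0
(`tendsto_wNorm_heatOp_sub`) and boundedness of the Laplace transform on L^p_{θ₁}; the outcome is
`solvesResolventEq_iff`. The formula for v does not mention a weight, so the same function can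
afterwards be estimated in L^p_{θ₂}.

Estimates. Diagonalizing A and B by Y reduces the kernel to scalar complex Gaussians. Each is
dominated by a real Gaussian of scale s₀t with s₀ = 4a_max²/a₀, which costs the factor κ a₁^{d/2}
e^{-b₀t}. Substituting ξ = e^{tS}x - √(s₀t) y turns every majorant into an average of |g|(e^{tS}x -
√(s₀t) y) over a fixed Gaussian in y and an exponential density in t. For fixed (t, y) the map in x
is a measure preserving isometry. Because θ is radial, θ(x) = θ(e^{tS}x), so changing to the weight
at the new point costs only C_θ e^{η√(s₀t)|y|}. Jensen's inequality in (t, y) then gives the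
Schur-type bounds `wInt_schur` and `wInt_timeAvg_le`.

Constants. The bounds contain the integrals ∫ e^{-δt} E[e^{2√(τδt)|y|}] dt and ∫ e^{-δt} t^{-1/2}
E[|y| e^{2√(τδt)|y|}] dt with δ = Re λ - ω. Expanding the exponential yields quotients of Gamma
values; the terms of one parity form a binomial series, those of the other a ₂F₁ series at τ.
Pfaff's transformation moves the argument to -τ/(1-τ) and produces C₇ and C₈ (`laplace_gauss_value`,
`laplace_gauss_norm_value`).

Derivatives. Differentiating the kernel brings down a factor at most |⟨ψ, e^{tS}e_i⟩|/(2t a_min),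
which after scaling is t^{-1/2}|⟨y, e^{tS}e_i⟩| up to a constant. This is integrable at t = 0, so
Fubini and integration by parts for each fixed kernel identify the weak derivative
(`hasWeakPartialDeriv_resolventOp`).

Domain. If A_{p,θ₁}v = w, then v is the resolvent applied to λv - w, for any λ with large real part;
the estimates with θ₂ = θ₁ give v ∈ W^{1,p}_{θ₁}. -/

/-! ### Hypergeometric functions with c = 1/2, c = 3/2 and b = c -/

theorem _root_.HasSum.congr_terms {f g : ℕ → ℝ} {x : ℝ} (h : HasSum f x) (hfg : ∀ n, g n = f n) :
    HasSum g x := (funext hfg : g = f) ▸ h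

/-- Binomial series for `(1 - z)^(-a)`. -/
theorem hasSum_one_sub_rpow_neg (a : ℝ) {z : ℝ} (hz : |z| < 1) :
    HasSum (fun n : ℕ => (ascPochhammer ℝ n).eval a / n.factorial * z ^ n) ((1 - z) ^ (-a)) := by
  have h := (Real.one_div_one_sub_rpow_hasFPowerSeriesOnBall_zero a).hasSum (y := z)
    (by simpa [enorm_eq_nnnorm, ← NNReal.coe_lt_coe] using hz)
  have hz1 : 0 < 1 - z := by linarith [(abs_lt.1 hz).2]
  rw [zero_add, one_div, ← Real.rpow_neg hz1.le] at h
  refine h.congr_terms fun n => ?_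
  rw [FormalMultilinearSeries.ofScalars_apply_eq, smul_eq_mul]
  congr 1
  have e := Ring.factorial_nsmul_multichoose_eq_ascPochhammer a n
  rw [Ring.choose, show a + n - 1 - n + 1 = a by ring, div_eq_iff (by positivity), mul_comm,
    ← nsmul_eq_mul, e, Polynomial.ascPochhammer_smeval_eq_eval]

/-- Euler's integral for `₂F₁(a, 1; 3/2; z)`. -/
noncomputable def eulerIntegral (a z : ℝ) : ℝ := ∫ u in (0 : ℝ)..1, (1 - z * (1 - u ^ 2)) ^ (-a)

/-- Termwise integration of a binomial series. -/
theorem hasSum_integral_binomial (a : ℝ) {g w : ℝ → ℝ} (hg : Continuous g) (hw : Continuous w)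
    {C h : ℝ} (hwC : ∀ u ∈ Icc (0 : ℝ) 1, |w u| ≤ C) (hh : |h| * C < 1) :
    HasSum (fun n : ℕ => (ascPochhammer ℝ n).eval a / n.factorial * h ^ n *
        ∫ u in (0 : ℝ)..1, g u * w u ^ n)
      (∫ u in (0 : ℝ)..1, g u * (1 - h * w u) ^ (-a)) := by
  have hC : 0 ≤ C := (abs_nonneg _).trans (hwC 0 (by simp))
  obtain ⟨M, hM⟩ := isCompact_Icc.exists_bound_of_continuousOn (s := Icc (0 : ℝ) 1) hg.continuousOn
  have key := intervalIntegral.hasSum_integral_of_dominated_convergence (μ := volume) (a := 0)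
    (b := 1) (F := fun n u => (ascPochhammer ℝ n).eval a / n.factorial * h ^ n * (g u * w u ^ n))
    (f := fun u => g u * (1 - h * w u) ^ (-a))
    (bound := fun n _ => M * |(ascPochhammer ℝ n).eval a / n.factorial * (|h| * C) ^ n|)
    (fun n => by fun_prop) ?_ ?_ ?_ ?_
  · simpa only [intervalIntegral.integral_const_mul] using key
  · intro n
    refine Eventually.of_forall fun u hu => ?_
    rw [uIoc_of_le zero_le_one] at hu
    have hu' := Ioc_subset_Icc_self hu
    have h1 := hwC u hu'
    have h2 := hM u hu'
    rw [Real.norm_eq_abs] at h2 ⊢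
    rw [abs_mul, abs_mul, abs_mul, abs_mul, abs_pow, abs_pow, abs_pow, abs_mul, abs_abs, abs_of_nonneg hC,
      mul_pow]
    have hM0 : 0 ≤ M := (abs_nonneg _).trans h2
    calc _ ≤ |(ascPochhammer ℝ n).eval a / n.factorial| * |h| ^ n * (M * C ^ n) := by gcongr
      _ = _ := by ring
  · refine Eventually.of_forall fun u _ => ?_
    refine Summable.mul_left _ ?_
    have := (hasSum_one_sub_rpow_neg a (z := |h| * C) (by rwa [abs_of_nonneg (by positivity)])).summable
    exact this.abs
  · exact intervalIntegrable_const
  · refine Eventually.of_forall fun u hu => ?_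
    rw [uIoc_of_le zero_le_one] at hu
    have h1 := hwC u (Ioc_subset_Icc_self hu)
    have := (hasSum_one_sub_rpow_neg a (z := h * w u) (by
      rw [abs_mul]; exact (mul_le_mul_of_nonneg_left h1 (abs_nonneg _)).trans_lt hh)).mul_left (g u)
    refine this.congr_terms fun n => ?_
    rw [mul_pow]
    ring

theorem ascPochhammer_eval_pos {b : ℝ} (hb : 0 < b) (n : ℕ) : 0 < (ascPochhammer ℝ n).eval b :=
  ascPochhammer_pos n b hb

theorem ascPochhammer_eval_succ' (b : ℝ) (n : ℕ) :
    (ascPochhammer ℝ (n + 1)).eval b = (ascPochhammer ℝ n).eval b * (b + n) :=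
  ascPochhammer_succ_eval n b

theorem ascPochhammer_eval_succ_left (b : ℝ) (n : ℕ) :
    (ascPochhammer ℝ (n + 1)).eval b = b * (ascPochhammer ℝ n).eval (b + 1) := by
  rw [ascPochhammer_succ_left]
  simp

/-- The function u(1 - u²)^{n+1} vanishes at 0 and 1; integrating its derivative gives (2n+3)
I_{n+1} = 2(n+1) I_n. -/
theorem integral_one_sub_sq_pow (n : ℕ) :
    ∫ u in (0 : ℝ)..1, (1 - u ^ 2) ^ n = n.factorial / (ascPochhammer ℝ n).eval (3 / 2) := by
  induction n with
  | zero => simp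
  | succ n ih =>
    have h : ∫ u in (0 : ℝ)..1, ((2 * n + 3) * (1 - u ^ 2) ^ (n + 1)
        - 2 * (n + 1) * (1 - u ^ 2) ^ n) = 0 := by
      rw [intervalIntegral.integral_eq_sub_of_hasDerivAt (f := fun u : ℝ => u * (1 - u ^ 2) ^ (n + 1))]
      · simp
      · intro u _
        have h1 : HasDerivAt (fun u : ℝ => 1 - u ^ 2) (-(2 * u)) u := by
          simpa using ((hasDerivAt_id u).pow 2).const_sub 1
        refine ((hasDerivAt_id u).mul (h1.pow (n + 1))).congr_deriv ?_
        simp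
        ring
      · exact Continuous.intervalIntegrable (by fun_prop) _ _
    rw [intervalIntegral.integral_sub (Continuous.intervalIntegrable (by fun_prop) _ _)
      (Continuous.intervalIntegrable (by fun_prop) _ _), intervalIntegral.integral_const_mul,
      intervalIntegral.integral_const_mul, ih] at h
    rw [ascPochhammer_eval_succ', Nat.factorial_succ]
    have h3 := ascPochhammer_eval_pos (b := 3 / 2) (by norm_num) n
    have h4 : (0 : ℝ) < 3 / 2 + n := by positivity
    rw [eq_div_iff (by positivity)]
    field_simp at h
    push_cast
    linarith

/-- Integrating the binomial series in z(1 - u²) termwise cancels n! against the integral of (1 -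
u²)^n. What remains are the coefficients of ₂F₁(a, 1; 3/2; z), because (1)_n = n!. -/
theorem hasSum_eulerIntegral (a : ℝ) {z : ℝ} (hz : |z| < 1) :
    HasSum (fun n : ℕ => (ascPochhammer ℝ n).eval a / (ascPochhammer ℝ n).eval (3 / 2) * z ^ n)
      (eulerIntegral a z) := by
  have h := hasSum_integral_binomial a (g := fun _ => 1) (w := fun u => 1 - u ^ 2) (C := 1) (h := z)
    (by fun_prop) (by fun_prop) (fun u hu => by
      rw [abs_le]; constructor <;> nlinarith [hu.1, hu.2]) (by simpa using hz)
  simp only [one_mul] at h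
  refine h.congr_terms fun n => ?_
  rw [integral_one_sub_sq_pow]
  have := Nat.factorial_pos n
  field_simp

/-- Write m(u) = 1 - z(1 - u²). The base at z + h is m(u)(1 - h(1 - u²)/m(u)), and m is bounded
below on [0, 1], so the binomial series in h can be integrated termwise for small h. This covers
every z < 1, beyond the disc of convergence at 0. -/
theorem analyticAt_eulerIntegral (a : ℝ) {z : ℝ} (hz : z < 1) : AnalyticAt ℝ (eulerIntegral a) z := by
  set c := min 1 (1 - z)
  have hc : 0 < c := lt_min one_pos (by linarith)
  have hpos : ∀ u ∈ Icc (0 : ℝ) 1, c ≤ 1 - z * (1 - u ^ 2) := fun u hu => by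
    have h1 : 0 ≤ 1 - u ^ 2 := by nlinarith [hu.1, hu.2]
    have h2 : 1 - u ^ 2 ≤ 1 := by nlinarith [hu.1]
    rcases le_total z 0 with h | h
    · exact (min_le_left _ _).trans (by nlinarith)
    · exact (min_le_right _ _).trans (by nlinarith)
  -- The truncation at c changes nothing on [0, 1] but makes the function positive on all of ℝ, so
  -- the integrands are globally continuous.
  let m : ℝ → ℝ := fun u => max c (1 - z * (1 - u ^ 2))
  have hm : Continuous m := by fun_prop
  have hm0 : ∀ u, 0 < m u := fun u => lt_max_of_lt_left hc
  let p : FormalMultilinearSeries ℝ ℝ ℝ := FormalMultilinearSeries.ofScalars ℝ fun n : ℕ =>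
    (ascPochhammer ℝ n).eval a / n.factorial *
      ∫ u in (0 : ℝ)..1, m u ^ (-a) * ((1 - u ^ 2) / m u) ^ n
  refine ⟨p, hasFPowerSeriesAt_iff.2 ?_⟩
  have : ∀ᶠ h in 𝓝 (0 : ℝ), |h| * (1 / c) < 1 := by
    have : Tendsto (fun h : ℝ => |h| * (1 / c)) (𝓝 0) (𝓝 (|0| * (1 / c))) :=
      Continuous.tendsto (by fun_prop) 0
    exact this.eventually (gt_mem_nhds (by simp))
  filter_upwards [this] with h hh
  have hw : ∀ u ∈ Icc (0 : ℝ) 1, |(1 - u ^ 2) / m u| ≤ 1 / c := fun u hu => by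
    rw [abs_div, abs_of_pos (hm0 u)]
    have h1 : |1 - u ^ 2| ≤ 1 := by rw [abs_le]; constructor <;> nlinarith [hu.1, hu.2]
    gcongr
    exact le_max_left _ _
  have key := hasSum_integral_binomial a (g := fun u => m u ^ (-a))
    (w := fun u => (1 - u ^ 2) / m u) (hm.rpow_const fun u => Or.inl (hm0 u).ne')
    (by fun_prop (disch := exact fun u => (hm0 u).ne')) hw hh
  have e : eulerIntegral a (z + h)
      = ∫ u in (0 : ℝ)..1, m u ^ (-a) * (1 - h * ((1 - u ^ 2) / m u)) ^ (-a) := by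
    refine intervalIntegral.integral_congr fun u hu => ?_
    rw [uIcc_of_le zero_le_one] at hu
    have h1 : |h * ((1 - u ^ 2) / m u)| < 1 := by
      rw [abs_mul]; exact (mul_le_mul_of_nonneg_left (hw u hu) (abs_nonneg _)).trans_lt hh
    have h2 : m u = 1 - z * (1 - u ^ 2) := max_eq_right (hpos u hu)
    rw [← Real.mul_rpow (hm0 u).le (by linarith [(abs_lt.1 h1).2])]
    congr 1
    have := (hm0 u).ne'
    field_simp
    rw [h2]
    ring
  rw [e]
  refine key.congr_terms fun n => ?_
  simp only [p, FormalMultilinearSeries.coeff_ofScalars, smul_eq_mul]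
  ring

theorem isHypergeometricContinuation_eulerIntegral (a : ℝ) :
    IsHypergeometricContinuation a 1 (3 / 2) (eulerIntegral a) := by
  refine ⟨fun z hz => analyticAt_eulerIntegral a hz, ?_⟩
  have : ∀ᶠ z in 𝓝 (0 : ℝ), |z| < 1 := by
    have : Tendsto (fun h : ℝ => |h|) (𝓝 0) (𝓝 (|0|)) := Continuous.tendsto (by fun_prop) 0
    exact this.eventually (gt_mem_nhds (by simp))
  filter_upwards [this] with z hz
  rw [ordinaryHypergeometric_eq_tsum, ← (hasSum_eulerIntegral a hz).tsum_eq]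
  refine tsum_congr fun n => ?_
  have := Nat.factorial_pos n
  simp only [ascPochhammer_eval_one, smul_eq_mul]
  field_simp

/-- For c = 1/2, b = 1 Euler's integral diverges. Splitting off the constant term and using
(a)_{n+1}/(1/2)_{n+1} = 2a (a+1)_n/(3/2)_n reduces to the convergent case c = 3/2. -/
theorem hasSum_contiguous (a : ℝ) {z : ℝ} (hz : |z| < 1) :
    HasSum (fun n : ℕ => (ascPochhammer ℝ n).eval a / (ascPochhammer ℝ n).eval (1 / 2) * z ^ n)
      (1 + 2 * a * z * eulerIntegral (a + 1) z) := by
  rw [← hasSum_nat_add_iff' 1]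
  have h := (hasSum_eulerIntegral (a + 1) hz).mul_left (2 * a * z)
  have e : 1 + 2 * a * z * eulerIntegral (a + 1) z - ∑ i ∈ Finset.range 1,
      (ascPochhammer ℝ i).eval a / (ascPochhammer ℝ i).eval (1 / 2) * z ^ i
      = 2 * a * z * eulerIntegral (a + 1) z := by simp
  rw [e]
  refine h.congr_terms fun n => ?_
  · have h1 := ascPochhammer_eval_pos (b := 3 / 2) (by norm_num) n
    rw [ascPochhammer_eval_succ_left, ascPochhammer_eval_succ_left,
      show (1 / 2 + 1 : ℝ) = 3 / 2 by norm_num]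
    field_simp
    ring

theorem isHypergeometricContinuation_contiguous (a : ℝ) :
    IsHypergeometricContinuation a 1 (1 / 2) fun z => 1 + 2 * a * z * eulerIntegral (a + 1) z := by
  refine ⟨fun z hz => ?_, ?_⟩
  · have := analyticAt_eulerIntegral (a + 1) hz
    fun_prop
  have : ∀ᶠ z in 𝓝 (0 : ℝ), |z| < 1 := by
    have : Tendsto (fun h : ℝ => |h|) (𝓝 0) (𝓝 (|0|)) := Continuous.tendsto (by fun_prop) 0
    exact this.eventually (gt_mem_nhds (by simp))
  filter_upwards [this] with z hz
  rw [ordinaryHypergeometric_eq_tsum, ← (hasSum_contiguous a hz).tsum_eq]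
  refine tsum_congr fun n => ?_
  have := Nat.factorial_pos n
  simp only [ascPochhammer_eval_one, smul_eq_mul]
  field_simp

/-- The factors (b)_n cancel and leave the binomial series; its sum is analytic on the whole ray as
the exponential of a multiple of log(1 - z). -/
theorem isHypergeometricContinuation_binomial (a : ℝ) {b : ℝ} (hb : 0 < b) :
    IsHypergeometricContinuation a b b fun z => (1 - z) ^ (-a) := by
  refine ⟨fun z hz => ?_, ?_⟩
  · have h : 0 < 1 - z := sub_pos.2 hz
    have e : (fun z : ℝ => (1 - z) ^ (-a)) =ᶠ[𝓝 z] fun z => Real.exp (Real.log (1 - z) * -a) := by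
      filter_upwards [Iio_mem_nhds hz] with y hy
      exact Real.rpow_def_of_pos (sub_pos.2 hy) _
    refine AnalyticAt.congr ?_ e.symm
    have := (analyticAt_log h).comp_of_eq (f := fun z : ℝ => 1 - z) (x := z) (by fun_prop) rfl
    exact AnalyticAt.rexp (this.mul analyticAt_const)
  have : ∀ᶠ z in 𝓝 (0 : ℝ), |z| < 1 := by
    have : Tendsto (fun h : ℝ => |h|) (𝓝 0) (𝓝 (|0|)) := Continuous.tendsto (by fun_prop) 0
    exact this.eventually (gt_mem_nhds (by simp))
  filter_upwards [this] with z hz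
  rw [ordinaryHypergeometric_eq_tsum, ← (hasSum_one_sub_rpow_neg a hz).tsum_eq]
  refine tsum_congr fun n => ?_
  have := Nat.factorial_pos n
  have := ascPochhammer_eval_pos hb n
  simp only [smul_eq_mul]
  field_simp

/-! ### Pfaff's transformation from τ to -τ/(1-τ) -/

/-- The integral `∫₀¹ (1 - τ u²)^b du`. -/
noncomputable def binomialIntegral (b τ : ℝ) : ℝ := ∫ u in (0 : ℝ)..1, (1 - τ * u ^ 2) ^ b

section Pfaff
variable {τ : ℝ} (h0 : 0 < τ) (h1 : τ < 1)
include h0 h1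

theorem one_sub_mul_sq_pos {u : ℝ} (hu : u ∈ Icc (0 : ℝ) 1) : 0 < 1 - τ * u ^ 2 := by
  have : u ^ 2 ≤ 1 := by nlinarith [hu.1, hu.2]
  nlinarith

/-- The base 1 + (τ/(1-τ))(1 - u²) equals (1 - τu²)/(1 - τ). -/
theorem eulerIntegral_neg (a : ℝ) :
    eulerIntegral a (-(τ / (1 - τ))) = (1 - τ) ^ a * binomialIntegral (-a) τ := by
  rw [eulerIntegral, binomialIntegral, ← intervalIntegral.integral_const_mul]
  refine intervalIntegral.integral_congr fun u hu => ?_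
  rw [uIcc_of_le zero_le_one] at hu
  have h3 : 0 < 1 - τ := by linarith
  have h2 := one_sub_mul_sq_pos h0 h1 hu
  rw [show 1 - -(τ / (1 - τ)) * (1 - u ^ 2) = (1 - τ)⁻¹ * (1 - τ * u ^ 2) by field_simp; ring,
    Real.mul_rpow (by positivity) h2.le, Real.inv_rpow h3.le, Real.rpow_neg h3.le, inv_inv]

/-- The substitution u = √(1-τ) v/√(1-τv²) fixes 0 and 1 and turns 1 - τ(1 - u²) into (1-τ)/(1-τv²),
with du = √(1-τ)(1-τv²)^{-3/2} dv. Together with `eulerIntegral_neg` it expresses both sides of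
Pfaff's identity by the same integral. -/
theorem eulerIntegral_pos (a : ℝ) :
    eulerIntegral a τ = (1 - τ) ^ (1 / 2 - a) * binomialIntegral (a - 3 / 2) τ := by
  have h3 : 0 < 1 - τ := by linarith
  let f : ℝ → ℝ := fun v => √(1 - τ) * v / √(1 - τ * v ^ 2)
  let f' : ℝ → ℝ := fun v => √(1 - τ) * (1 - τ * v ^ 2) ^ (-(3 / 2) : ℝ)
  have hf : ∀ v ∈ uIcc (0 : ℝ) 1, HasDerivAt f (f' v) v := fun v hv => by
    rw [uIcc_of_le zero_le_one] at hv
    have h2 := one_sub_mul_sq_pos h0 h1 hv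
    have hd : HasDerivAt (fun v : ℝ => 1 - τ * v ^ 2) (-(2 * τ * v)) v := by
      refine (((hasDerivAt_id v).pow 2).const_mul τ).const_sub 1 |>.congr_deriv ?_
      simp
      ring
    refine (((hasDerivAt_id v).const_mul (√(1 - τ))).div (hd.sqrt h2.ne')
      (Real.sqrt_ne_zero'.2 h2)).congr_deriv ?_
    have hs := Real.sq_sqrt h2.le
    have hs0 := Real.sqrt_pos.2 h2
    simp only [f']
    rw [show (-(3 / 2) : ℝ) = -(1 + 1 / 2) by norm_num, Real.rpow_neg h2.le, Real.rpow_add h2,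
      Real.rpow_one, ← Real.sqrt_eq_rpow]
    simp only [id, mul_one]
    field_simp
    rw [hs]
    ring
  have hf' : ContinuousOn f' (uIcc 0 1) := by
    rw [uIcc_of_le zero_le_one]
    refine ContinuousOn.mul continuousOn_const (ContinuousOn.rpow_const (by fun_prop) fun v hv => ?_)
    exact Or.inl (one_sub_mul_sq_pos h0 h1 hv).ne'
  have hfi : ∀ v ∈ Icc (0 : ℝ) 1, 1 - τ * (1 - f v ^ 2) = (1 - τ) / (1 - τ * v ^ 2) := fun v hv => by
    have h2 := one_sub_mul_sq_pos h0 h1 hv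
    simp only [f]
    rw [div_pow, mul_pow, Real.sq_sqrt h2.le, Real.sq_sqrt h3.le]
    field_simp
    ring
  have key := intervalIntegral.integral_comp_mul_deriv'' (f := f) (f' := f')
    (g := fun u => (1 - τ * (1 - u ^ 2)) ^ (-a)) (a := 0) (b := 1)
    (fun v hv => (hf v hv).continuousAt.continuousWithinAt)
    (fun v hv => (hf v (Ioo_subset_Icc_self hv)).hasDerivWithinAt) hf' ?_
  · have e0 : f 0 = 0 := by simp [f]
    have e1 : f 1 = 1 := by
      have := (Real.sqrt_pos.2 h3).ne'
      simp only [f]; rw [one_pow, mul_one, mul_one, div_self this]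
    rw [e0, e1] at key
    rw [eulerIntegral, ← key, binomialIntegral, ← intervalIntegral.integral_const_mul]
    refine intervalIntegral.integral_congr fun v hv => ?_
    rw [uIcc_of_le zero_le_one] at hv
    have h2 := one_sub_mul_sq_pos h0 h1 hv
    simp only [Function.comp]
    rw [hfi v hv, Real.div_rpow h3.le h2.le]
    simp only [f']
    rw [Real.sqrt_eq_rpow, show 1 / 2 - a = 1 / 2 + -a by ring, Real.rpow_add h3,
      show a - 3 / 2 = a + (-(3 / 2)) by ring, Real.rpow_add h2, Real.rpow_neg h2.le a]
    field_simp
  · rintro _ ⟨v, hv, rfl⟩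
    rw [uIcc_of_le zero_le_one] at hv
    have h2 := one_sub_mul_sq_pos h0 h1 hv
    refine ContinuousAt.continuousWithinAt (ContinuousAt.rpow_const (by fun_prop) (Or.inl ?_))
    rw [hfi v hv]
    positivity

/-- Integrate the derivative of u(1 - τu²)^b over [0, 1]. -/
theorem binomialIntegral_rec (b : ℝ) :
    (2 * b + 1) * binomialIntegral b τ - 2 * b * binomialIntegral (b - 1) τ = (1 - τ) ^ b := by
  have hc : ∀ b : ℝ, IntervalIntegrable (fun u : ℝ => (1 - τ * u ^ 2) ^ b) volume 0 1 := fun b => by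
    refine ContinuousOn.intervalIntegrable ?_
    rw [uIcc_of_le zero_le_one]
    exact ContinuousOn.rpow_const (by fun_prop) fun v hv => Or.inl (one_sub_mul_sq_pos h0 h1 hv).ne'
  rw [binomialIntegral, binomialIntegral, ← intervalIntegral.integral_const_mul,
    ← intervalIntegral.integral_const_mul,
    ← intervalIntegral.integral_sub ((hc b).const_mul _) ((hc _).const_mul _),
    intervalIntegral.integral_eq_sub_of_hasDerivAt (f := fun u : ℝ => u * (1 - τ * u ^ 2) ^ b)]
  · simp
  · intro u hu
    rw [uIcc_of_le zero_le_one] at hu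
    have h2 := one_sub_mul_sq_pos h0 h1 hu
    have hd : HasDerivAt (fun v : ℝ => 1 - τ * v ^ 2) (-(2 * τ * u)) u := by
      refine (((hasDerivAt_id u).pow 2).const_mul τ).const_sub 1 |>.congr_deriv ?_
      simp
      ring
    refine ((hasDerivAt_id u).mul (hd.rpow_const (p := b) (Or.inl h2.ne'))).congr_deriv ?_
    have e : (1 - τ * u ^ 2) ^ b = (1 - τ * u ^ 2) ^ (b - 1) * (1 - τ * u ^ 2) := by
      rw [← Real.rpow_add_one h2.ne', sub_add_cancel]
    simp only [e, id]
    ring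
  · exact ((hc b).const_mul _).sub ((hc _).const_mul _)

theorem neg_div_one_sub_lt_one : -(τ / (1 - τ)) < 1 := by
  have : 0 < τ / (1 - τ) := div_pos h0 (by linarith)
  linarith

/-- Pfaff's transformation: the Euler integrals at τ and at -τ/(1-τ) are both multiples of the
binomial integral with exponent (D-1)/2, and the powers of 1 - τ differ by exactly one. -/
theorem hasSum_hyp2F1_three_halves (D : ℝ) :
    HasSum (fun n : ℕ => (ascPochhammer ℝ n).eval ((D + 2) / 2) / (ascPochhammer ℝ n).eval (3 / 2)
      * τ ^ n) (hyp2F1 (-(D - 1) / 2) 1 (3 / 2) (-(τ / (1 - τ))) / (1 - τ)) := by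
  have h3 : 0 < 1 - τ := by linarith
  rw [hyp2F1_eq (isHypergeometricContinuation_eulerIntegral _) (neg_div_one_sub_lt_one h0 h1)]
  convert hasSum_eulerIntegral ((D + 2) / 2) (z := τ) (by rwa [abs_of_pos h0]) using 1
  rw [eulerIntegral_neg h0 h1, eulerIntegral_pos h0 h1, mul_div_right_comm]
  congr 2
  · rw [← Real.rpow_sub_one h3.ne']
    congr 1
    ring
  · ring

/-- Pfaff's transformation for c = 1/2. After the contiguous relation the two sides contain binomial
integrals with the neighbouring exponents (D-1)/2 - 1 and (D-1)/2; `binomialIntegral_rec` connects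
them. -/
theorem hasSum_hyp2F1_one_half (D : ℝ) :
    HasSum (fun n : ℕ => (ascPochhammer ℝ n).eval (D / 2) / (ascPochhammer ℝ n).eval (1 / 2)
      * τ ^ n) (hyp2F1 (-(D - 1) / 2) 1 (1 / 2) (-(τ / (1 - τ))) / (1 - τ)) := by
  have h3 : 0 < 1 - τ := by linarith
  rw [hyp2F1_eq (isHypergeometricContinuation_contiguous _) (neg_div_one_sub_lt_one h0 h1)]
  convert hasSum_contiguous (D / 2) (z := τ) (by rwa [abs_of_pos h0]) using 1
  rw [eulerIntegral_neg h0 h1, eulerIntegral_pos h0 h1]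
  have := binomialIntegral_rec h0 h1 ((D - 1) / 2)
  rw [show -(-(D - 1) / 2 + 1) = (D - 1) / 2 - 1 by ring,
    show D / 2 + 1 - 3 / 2 = (D - 1) / 2 by ring,
    show (-(D - 1) / 2 + 1) = -((D - 1) / 2) + 1 by ring, Real.rpow_add_one h3.ne',
    show 1 / 2 - (D / 2 + 1) = -((D - 1) / 2) + -1 by ring, Real.rpow_add h3, Real.rpow_neg h3.le,
    Real.rpow_neg_one, ← this]
  have h4 : 0 < (1 - τ) ^ ((D - 1) / 2) := by positivity
  rw [this]
  rw [← sub_eq_zero]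
  field_simp
  rw [show (D - 1) / 2 - 1 = (D - 1 - 2) / 2 by ring] at this
  linear_combination (-τ) * this

theorem hyp2F1_self (a : ℝ) {b : ℝ} (hb : 0 < b) :
    hyp2F1 a b b (-(τ / (1 - τ))) = (1 - τ) ^ a := by
  have h3 : 0 < 1 - τ := by linarith
  rw [hyp2F1_eq (isHypergeometricContinuation_binomial _ hb) (neg_div_one_sub_lt_one h0 h1),
    show 1 - -(τ / (1 - τ)) = (1 - τ)⁻¹ by field_simp; ring, Real.inv_rpow h3.le,
    Real.rpow_neg h3.le, inv_inv]

end Pfaff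

/-! ### Gaussian moments and their Laplace transforms -/

/-- The centred Gaussian density `(πs)^(-d/2) exp(-|y|²/s)`, with values in `[0, ∞]`. -/
noncomputable def gaussDensity {d : ℕ} (s : ℝ) (y : EuclideanSpace ℝ (Fin d)) : ℝ≥0∞ :=
  ENNReal.ofReal ((Real.pi * s) ^ (-(d : ℝ) / 2) * Real.exp (-‖y‖ ^ 2 / s))

section Gaussian
variable {d : ℕ}

theorem measurable_gaussDensity : Measurable fun q : ℝ × EuclideanSpace ℝ (Fin d) =>
    gaussDensity q.1 q.2 := by
  unfold gaussDensity
  fun_prop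

theorem lintegral_comp_smul_euclidean {r : ℝ} (hr : 0 < r) (F : EuclideanSpace ℝ (Fin d) → ℝ≥0∞) :
    ∫⁻ y, F y = ENNReal.ofReal (r ^ d) * ∫⁻ y, F (r • y) := by
  have h := (Homeomorph.smulOfNeZero r hr.ne').toMeasurableEquiv.measurableEmbedding.lintegral_map
    (μ := (volume : Measure (EuclideanSpace ℝ (Fin d)))) F
  have e : ((Homeomorph.smulOfNeZero r hr.ne').toMeasurableEquiv :
      EuclideanSpace ℝ (Fin d) → EuclideanSpace ℝ (Fin d)) = fun y => r • y := rfl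
  rw [e, Measure.map_addHaar_smul _ hr.ne', lintegral_smul_measure] at h
  rw [← h, finrank_euclideanSpace_fin, abs_of_pos (by positivity), smul_eq_mul, ← mul_assoc,
    ← ENNReal.ofReal_mul (by positivity), mul_inv_cancel₀ (by positivity)]
  simp

/-- Rescaling by √s moves the time dependence from the density into the argument of F, so that
averages at different times run over one fixed probability measure. -/
theorem lintegral_gaussDensity_mul {s : ℝ} (hs : 0 < s) (F : EuclideanSpace ℝ (Fin d) → ℝ≥0∞) :
    ∫⁻ y, gaussDensity s y * F y = ∫⁻ y, gaussDensity 1 y * F (√s • y) := by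
  have hs' := Real.sqrt_pos.2 hs
  rw [lintegral_comp_smul_euclidean hs', ← lintegral_const_mul' _ _ ENNReal.ofReal_ne_top]
  refine lintegral_congr fun y => ?_
  rw [← mul_assoc, gaussDensity, gaussDensity, ← ENNReal.ofReal_mul (by positivity)]
  congr 2
  rw [norm_smul, mul_pow, Real.norm_of_nonneg hs'.le, Real.sq_sqrt hs.le, mul_one,
    Real.mul_rpow Real.pi_pos.le hs.le, ← mul_assoc, ← Real.rpow_natCast (√s), Real.sqrt_eq_rpow,
    ← Real.rpow_mul hs.le]
  have : s ^ (1 / 2 * (d : ℝ)) * s ^ (-(d : ℝ) / 2) = 1 := by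
    rw [← Real.rpow_add hs]; ring_nf; simp
  rw [show s ^ (1 / 2 * (d : ℝ)) * (Real.pi ^ (-(d : ℝ) / 2) * s ^ (-(d : ℝ) / 2))
    = (s ^ (1 / 2 * (d : ℝ)) * s ^ (-(d : ℝ) / 2)) * Real.pi ^ (-(d : ℝ) / 2) by ring, this, one_mul]
  congr 2
  field_simp

/-- Polar coordinates reduce the moment to a Gamma integral times d·vol(B). This factor need not be
computed: the known total Gaussian mass, which is the case n = 0, determines it. -/
theorem lintegral_gaussDensity_mul_norm_pow (hd : 1 ≤ d) (n : ℕ) :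
    ∫⁻ y : EuclideanSpace ℝ (Fin d), gaussDensity 1 y * ENNReal.ofReal (‖y‖ ^ n)
      = ENNReal.ofReal (Real.Gamma (((d : ℝ) + n) / 2) / Real.Gamma ((d : ℝ) / 2)) := by
  have : Nontrivial (EuclideanSpace ℝ (Fin d)) := by
    have : Nonempty (Fin d) := ⟨⟨0, hd⟩⟩
    infer_instance
  have hd' : (0 : ℝ) < d := by exact_mod_cast hd
  set ν : Measure (EuclideanSpace ℝ (Fin d)) := volume
  have hrad : ∀ n : ℕ, Integrable (fun y : EuclideanSpace ℝ (Fin d) =>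
        ‖y‖ ^ n * Real.exp (-‖y‖ ^ 2)) ∧
      ∫ y : EuclideanSpace ℝ (Fin d), ‖y‖ ^ n * Real.exp (-‖y‖ ^ 2)
        = d * ν.real (Metric.ball 0 1) * (1 / 2 * Real.Gamma (((d : ℝ) + n) / 2)) := fun n => by
    have h1 := integral_rpow_mul_exp_neg_rpow (p := 2) (q := (d : ℝ) - 1 + n) (by norm_num)
      (by have : (0 : ℝ) ≤ n := by positivity
          linarith)
    have e : ∀ y ∈ Ioi (0 : ℝ), y ^ ((d : ℝ) - 1 + n) * Real.exp (-y ^ (2 : ℝ))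
        = y ^ (d - 1) • (y ^ n * Real.exp (-y ^ 2)) := fun y hy => by
      rw [Real.rpow_add hy, Real.rpow_natCast, smul_eq_mul, ← mul_assoc]
      congr 2
      · rw [← Real.rpow_natCast, Nat.cast_sub hd, Nat.cast_one]
      · norm_cast
    rw [setIntegral_congr_fun measurableSet_Ioi e] at h1
    have hpos : 0 < Real.Gamma (((d : ℝ) - 1 + n + 1) / 2) := Real.Gamma_pos_of_pos (by
      have : (0 : ℝ) ≤ n := by positivity
      linarith)
    refine ⟨?_, ?_⟩
    · rw [integrable_fun_norm_addHaar ν (f := fun r => r ^ n * Real.exp (-r ^ 2)),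
        finrank_euclideanSpace_fin]
      -- The Bochner integral of a non-integrable function is 0, whereas the value found is
      -- positive.
      refine by_contra fun hc => ?_
      rw [integral_undef hc] at h1
      have : (0 : ℝ) < 1 / 2 * Real.Gamma (((d : ℝ) - 1 + n + 1) / 2) := by positivity
      exact this.ne h1
    · rw [integral_fun_norm_addHaar ν (fun r => r ^ n * Real.exp (-r ^ 2)),
        finrank_euclideanSpace_fin, h1, nsmul_eq_mul, smul_eq_mul, mul_assoc]
      congr 5
      ring
  have h0 : d * ν.real (Metric.ball 0 1) * (1 / 2 * Real.Gamma ((d : ℝ) / 2))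
      = Real.pi ^ ((d : ℝ) / 2) := by
    have h1 := (hrad 0).2
    have h2 := GaussianFourier.integral_rexp_neg_mul_sq_norm (V := EuclideanSpace ℝ (Fin d)) one_pos
    simp only [pow_zero, one_mul, Nat.cast_zero, add_zero] at h1
    simp only [neg_mul, one_mul, div_one, finrank_euclideanSpace_fin] at h2
    rw [← h1, h2]
  have hG := Real.Gamma_pos_of_pos (half_pos hd')
  have hpi : 0 < Real.pi ^ ((d : ℝ) / 2) := by positivity
  calc _ = ∫⁻ y : EuclideanSpace ℝ (Fin d), ENNReal.ofReal
        (Real.pi ^ (-(d : ℝ) / 2) * (‖y‖ ^ n * Real.exp (-‖y‖ ^ 2))) := by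
        refine lintegral_congr fun y => ?_
        rw [gaussDensity, ← ENNReal.ofReal_mul (by positivity), mul_one, div_one]
        ring_nf
    _ = ENNReal.ofReal (∫ y : EuclideanSpace ℝ (Fin d),
        (Real.pi ^ (-(d : ℝ) / 2) * (‖y‖ ^ n * Real.exp (-‖y‖ ^ 2)))) := by
        rw [ofReal_integral_eq_lintegral_ofReal ((hrad n).1.const_mul _)]
        exact Eventually.of_forall fun y => by positivity
    _ = _ := by
        rw [integral_const_mul, (hrad n).2, neg_div, Real.rpow_neg Real.pi_pos.le, ← h0]
        congr 1
        rw [← h0] at hpi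
        have : ν.real (Metric.ball 0 1) ≠ 0 := fun h => by simp [h] at hpi
        field_simp

theorem lintegral_gaussDensity_one (hd : 1 ≤ d) :
    ∫⁻ y : EuclideanSpace ℝ (Fin d), gaussDensity 1 y = 1 := by
  have := lintegral_gaussDensity_mul_norm_pow hd 0
  have hd' : (0 : ℝ) < d := by exact_mod_cast hd
  simpa [div_self (Real.Gamma_pos_of_pos (half_pos hd')).ne'] using this

/-- Bounding |x| by a multiple of cosh x reduces the first moment to the Gaussian Laplace transform,
with result (√2/2) e^{1/4} ≤ 1. The bound 1 is what makes the Jensen factor in the derivative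
estimate free of dimensional constants: in C₈ the bracket has only the power 1/p. -/
theorem lintegral_gaussDensity_mul_abs_inner_le {u : EuclideanSpace ℝ (Fin d)} (hu : ‖u‖ ≤ 1) :
    ∫⁻ y : EuclideanSpace ℝ (Fin d), gaussDensity 1 y * ENNReal.ofReal |inner ℝ y u| ≤ 1 := by
  have hexp : ∀ c : ℝ, Integrable (fun y : EuclideanSpace ℝ (Fin d) =>
        Real.exp (-‖y‖ ^ 2 + c * inner ℝ u y)) ∧
      ∫ y : EuclideanSpace ℝ (Fin d), Real.exp (-‖y‖ ^ 2 + c * inner ℝ u y)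
        = Real.pi ^ ((d : ℝ) / 2) * Real.exp (c ^ 2 * ‖u‖ ^ 2 / 4) := fun c => by
    have hi := GaussianFourier.integrable_cexp_neg_mul_sq_norm_add (b := 1) (by simp) (c : ℂ) u
    have hv := GaussianFourier.integral_cexp_neg_mul_sq_norm_add (b := 1) (by simp) (c : ℂ) u
    have e : ∀ v : EuclideanSpace ℝ (Fin d), Complex.exp (-1 * ‖v‖ ^ 2 + c * (inner ℝ u v : ℝ))
        = ((Real.exp (-‖v‖ ^ 2 + c * inner ℝ u v) : ℝ) : ℂ) := fun v => by push_cast; ring_nf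
    simp only [e] at hi hv
    refine ⟨by simpa only [RCLike.re_eq_complex_re, Complex.ofReal_re] using hi.re, ?_⟩
    rw [integral_complex_ofReal, finrank_euclideanSpace_fin] at hv
    have : ((Real.pi ^ ((d : ℝ) / 2) * Real.exp (c ^ 2 * ‖u‖ ^ 2 / 4) : ℝ) : ℂ)
        = (Real.pi / 1) ^ ((d : ℂ) / 2) * Complex.exp (c ^ 2 * ‖u‖ ^ 2 / (4 * 1)) := by
      rw [Complex.ofReal_mul, Complex.ofReal_cpow Real.pi_pos.le]
      push_cast
      simp
    rw [← this] at hv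
    exact_mod_cast hv
  -- The constant comes from cosh x ≥ 1 + x²/2 ≥ √2 |x|.
  have hpt : ∀ x : ℝ, |x| ≤ (Real.exp x + Real.exp (-x)) * (√2 / 4) := fun x => by
    have h1 : 1 + x ^ 2 / 2 ≤ Real.cosh x := by
      have := sum_le_hasSum (Finset.range 2)
        (fun n _ => div_nonneg (Even.pow_nonneg (even_two_mul n) x) (Nat.cast_nonneg _))
        (Real.hasSum_cosh x)
      simpa [Finset.sum_range_succ] using this
    rw [Real.cosh_eq] at h1
    have h2 : √2 ^ 2 = 2 := Real.sq_sqrt (by norm_num)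
    have h3 : 0 < √2 := by positivity
    have h4 := sq_nonneg (√2 - |x|)
    have h5 := sq_abs x
    have h6 : √2 * |x| ≤ (Real.exp x + Real.exp (-x)) / 2 := by nlinarith
    nlinarith [mul_le_mul_of_nonneg_left h6 h3.le]
  have hint : Integrable (fun y : EuclideanSpace ℝ (Fin d) => Real.pi ^ (-(d : ℝ) / 2) * (√2 / 4) *
      (Real.exp (-‖y‖ ^ 2 + 1 * inner ℝ u y) + Real.exp (-‖y‖ ^ 2 + (-1) * inner ℝ u y))) :=
    ((hexp 1).1.add (hexp (-1)).1).const_mul _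
  calc _ ≤ ∫⁻ y : EuclideanSpace ℝ (Fin d), ENNReal.ofReal (Real.pi ^ (-(d : ℝ) / 2) * (√2 / 4) *
      (Real.exp (-‖y‖ ^ 2 + 1 * inner ℝ u y) + Real.exp (-‖y‖ ^ 2 + (-1) * inner ℝ u y))) := by
        refine lintegral_mono fun y => ?_
        rw [gaussDensity, ← ENNReal.ofReal_mul (by positivity), mul_one, div_one, Real.exp_add,
          Real.exp_add, real_inner_comm]
        refine ENNReal.ofReal_le_ofReal ?_
        have := hpt (inner ℝ u y)
        calc _ ≤ Real.pi ^ (-(d : ℝ) / 2) * Real.exp (-‖y‖ ^ 2) *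
              ((Real.exp (inner ℝ u y) + Real.exp (-inner ℝ u y)) * (√2 / 4)) := by
              gcongr
          _ = _ := by ring_nf
    _ = ENNReal.ofReal ((√2 / 2) * Real.exp (‖u‖ ^ 2 / 4)) := by
        rw [← ofReal_integral_eq_lintegral_ofReal hint (Eventually.of_forall fun y => by positivity),
          integral_const_mul, integral_add (hexp 1).1 (hexp (-1)).1, (hexp 1).2, (hexp (-1)).2,
          neg_div, Real.rpow_neg Real.pi_pos.le]
        have hpi : 0 < Real.pi ^ ((d : ℝ) / 2) := by positivity
        congr 1
        field_simp
        norm_num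
    _ ≤ 1 := by
        rw [ENNReal.ofReal_le_one]
        have h1 : Real.exp (‖u‖ ^ 2 / 4) ≤ √2 := by
          refine Real.le_sqrt_of_sq_le ?_
          rw [← Real.exp_nat_mul]
          have : ‖u‖ ^ 2 ≤ 1 := by nlinarith [norm_nonneg u]
          calc Real.exp ((2 : ℕ) * (‖u‖ ^ 2 / 4)) ≤ Real.exp (1 / 2) := by
                gcongr; push_cast; linarith
            _ ≤ 2 := by
                have h := Real.exp_one_lt_d9
                have h2 : Real.exp (1 / 2) ^ 2 = Real.exp 1 := by
                  rw [← Real.exp_nat_mul]; norm_num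
                nlinarith [Real.exp_pos (1 / 2)]
        have h2 : √2 ^ 2 = 2 := Real.sq_sqrt (by norm_num)
        have h3 : 0 < √2 := by positivity
        nlinarith

theorem Gamma_add_nat {x : ℝ} (hx : 0 < x) (m : ℕ) :
    Real.Gamma (x + m) = (ascPochhammer ℝ m).eval x * Real.Gamma x := by
  induction m with
  | zero => simp
  | succ m ih =>
    rw [Nat.cast_succ, ← add_assoc, Real.Gamma_add_one (by positivity), ih, ascPochhammer_eval_succ']
    ring

/-- Legendre's duplication formula at (n+1)/2. In the moment series it cancels the Gamma factor
produced by the time integral. -/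
theorem factorial_eq_Gamma_mul (n : ℕ) :
    (n.factorial : ℝ) * √Real.pi = 2 ^ n * (Real.Gamma (((n : ℝ) + 1) / 2) * Real.Gamma ((n : ℝ) / 2 + 1)) := by
  have h := Real.Gamma_mul_Gamma_add_half (((n : ℝ) + 1) / 2)
  rw [show ((n : ℝ) + 1) / 2 + 1 / 2 = n / 2 + 1 by ring, show 2 * (((n : ℝ) + 1) / 2) = n + 1 by ring,
    Real.Gamma_nat_eq_factorial, show 1 - ((n : ℝ) + 1) = -n by ring, Real.rpow_neg (by norm_num),
    Real.rpow_natCast] at h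
  rw [h]
  field_simp

/-- The Laplace transform of an exponential moment of the Gaussian, as a series. -/
theorem lintegral_laplace_gaussDensity (hd : 1 ≤ d) (j : ℕ) (hj : j ≤ 1) {δ τ : ℝ} (hδ : 0 < δ)
    (hτ : 0 < τ) :
    ∫⁻ t in Ioi (0 : ℝ), ENNReal.ofReal (Real.exp (-(δ * t)) * t ^ (-(j : ℝ) / 2)) *
        ∫⁻ y : EuclideanSpace ℝ (Fin d), gaussDensity 1 y *
          ENNReal.ofReal (‖y‖ ^ j * Real.exp (2 * √(τ * δ * t) * ‖y‖))
      = ∑' n : ℕ, ENNReal.ofReal ((2 * √(τ * δ)) ^ n / n.factorial *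
          ((1 / δ) ^ (((n : ℝ) - j) / 2 + 1) * Real.Gamma (((n : ℝ) - j) / 2 + 1)) *
          (Real.Gamma (((d : ℝ) + (n + j : ℕ)) / 2) / Real.Gamma ((d : ℝ) / 2))) := by
  have hj' : (j : ℝ) ≤ 1 := by exact_mod_cast hj
  have hd' : (0 : ℝ) < d := by exact_mod_cast hd
  have inner : ∀ t ∈ Ioi (0 : ℝ), ENNReal.ofReal (Real.exp (-(δ * t)) * t ^ (-(j : ℝ) / 2)) *
        ∫⁻ y : EuclideanSpace ℝ (Fin d), gaussDensity 1 y *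
          ENNReal.ofReal (‖y‖ ^ j * Real.exp (2 * √(τ * δ * t) * ‖y‖))
      = ∑' n : ℕ, ENNReal.ofReal ((2 * √(τ * δ)) ^ n / n.factorial *
          (Real.Gamma (((d : ℝ) + (n + j : ℕ)) / 2) / Real.Gamma ((d : ℝ) / 2))) *
          ENNReal.ofReal (t ^ (((n : ℝ) - j) / 2 + 1 - 1) * Real.exp (-(δ * t))) := fun t ht => by
    have ht' : 0 < t := ht
    -- The exponential is expanded in powers of |y|, all terms being nonnegative: the y-integral of
    -- each term is a Gaussian moment, its t-integral a Gamma integral.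
    have e : ∀ y : EuclideanSpace ℝ (Fin d), gaussDensity 1 y *
          ENNReal.ofReal (‖y‖ ^ j * Real.exp (2 * √(τ * δ * t) * ‖y‖))
        = ∑' n : ℕ, ENNReal.ofReal ((2 * √(τ * δ * t)) ^ n / n.factorial) *
          (gaussDensity 1 y * ENNReal.ofReal (‖y‖ ^ (n + j))) := fun y => by
      have h1 : Real.exp (2 * √(τ * δ * t) * ‖y‖)
          = ∑' n : ℕ, (2 * √(τ * δ * t) * ‖y‖) ^ n / n.factorial := by
        rw [Real.exp_eq_exp_ℝ, NormedSpace.exp_eq_tsum_div]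
      rw [h1, ← tsum_mul_left, ENNReal.ofReal_tsum_of_nonneg (fun n => by positivity)
        ((Real.summable_pow_div_factorial _).mul_left _), ← ENNReal.tsum_mul_left]
      refine tsum_congr fun n => ?_
      rw [mul_left_comm, ← ENNReal.ofReal_mul (by positivity)]
      congr 2
      rw [mul_pow, pow_add]
      ring
    simp_rw [e]
    rw [lintegral_tsum (fun n => by
      refine AEMeasurable.const_mul (Measurable.aemeasurable ?_) _
      exact (measurable_gaussDensity.comp measurable_prodMk_left).mul (by fun_prop)),
      ← ENNReal.tsum_mul_left]
    refine tsum_congr fun n => ?_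
    rw [lintegral_const_mul' _ _ ENNReal.ofReal_ne_top, lintegral_gaussDensity_mul_norm_pow hd]
    have hG := Real.Gamma_pos_of_pos (half_pos hd')
    have hG2 : 0 < Real.Gamma (((d : ℝ) + (n + j : ℕ)) / 2) := Real.Gamma_pos_of_pos (by positivity)
    rw [← ENNReal.ofReal_mul (by positivity), ← ENNReal.ofReal_mul (by positivity),
      ← ENNReal.ofReal_mul (by positivity)]
    congr 1
    rw [Real.sqrt_mul (by positivity), ← mul_assoc 2, mul_pow _ (√t), add_sub_cancel_right, sub_div,
      Real.rpow_sub ht', neg_div, Real.rpow_neg ht'.le, div_eq_mul_inv (n : ℝ), mul_comm (n : ℝ),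
      Real.rpow_mul ht'.le, Real.rpow_natCast, show t ^ (2⁻¹ : ℝ) = √t by rw [Real.sqrt_eq_rpow, one_div]]
    ring
  rw [setLIntegral_congr_fun measurableSet_Ioi inner, lintegral_tsum (fun n => by fun_prop)]
  refine tsum_congr fun n => ?_
  rw [lintegral_const_mul' _ _ ENNReal.ofReal_ne_top]
  have ha : 0 < ((n : ℝ) - j) / 2 + 1 := by
    have : (0 : ℝ) ≤ n := by positivity
    linarith
  have hI := Real.integral_rpow_mul_exp_neg_mul_Ioi ha hδ
  have hG1 := Real.Gamma_pos_of_pos ha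
  have hint : IntegrableOn (fun t : ℝ => t ^ (((n : ℝ) - j) / 2 + 1 - 1) * Real.exp (-(δ * t)))
      (Ioi 0) := by
    refine by_contra fun hc => ?_
    rw [integral_undef hc] at hI
    have : 0 < (1 / δ) ^ (((n : ℝ) - j) / 2 + 1) * Real.Gamma (((n : ℝ) - j) / 2 + 1) := by positivity
    exact this.ne hI
  rw [← ofReal_integral_eq_lintegral_ofReal hint ((ae_restrict_iff' measurableSet_Ioi).2
    (Eventually.of_forall fun t (ht : 0 < t) => by positivity)), hI, ← ENNReal.ofReal_mul]
  · congr 1; ring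
  · have hG := Real.Gamma_pos_of_pos (half_pos hd')
    have hG2 : 0 < Real.Gamma (((d : ℝ) + (n + j : ℕ)) / 2) := Real.Gamma_pos_of_pos (by positivity)
    positivity

-- The series is split by parity. The even terms have coefficients (d/2)_m/(1/2)_m and sum by
-- `hasSum_hyp2F1_one_half`; the odd ones have coefficients ((d+1)/2)_m/m! and form a binomial
-- series, which is the ₂F₁ with b = c.
set_option maxHeartbeats 400000 in
theorem laplace_gauss_value (hd : 1 ≤ d) {δ τ : ℝ} (hδ : 0 < δ) (hτ : 0 < τ) (hτ1 : τ < 1) :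
    ∫⁻ t in Ioi (0 : ℝ), ENNReal.ofReal (Real.exp (-(δ * t))) *
        ∫⁻ y : EuclideanSpace ℝ (Fin d), gaussDensity 1 y *
          ENNReal.ofReal (Real.exp (2 * √(τ * δ * t) * ‖y‖))
      = ENNReal.ofReal (δ⁻¹ * (1 / (1 - τ) *
      (hyp2F1 (-((d : ℝ) - 1) / 2) 1 (1 / 2) (-(τ / (1 - τ)))
      + Real.pi ^ (1 / 2 : ℝ) * (Real.Gamma (((d : ℝ) + 1) / 2) / Real.Gamma ((d : ℝ) / 2))
        * (τ / (1 - τ)) ^ (1 / 2 : ℝ)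
        * hyp2F1 (-((d : ℝ) - 2) / 2) (3 / 2) (3 / 2) (-(τ / (1 - τ)))))) := by
  have hd' : (0 : ℝ) < d := by exact_mod_cast hd
  have h3 : 0 < 1 - τ := by linarith
  have hG := Real.Gamma_pos_of_pos (half_pos hd')
  have h := lintegral_laplace_gaussDensity hd 0 (by norm_num) hδ hτ
  simp only [Nat.cast_zero, neg_zero, zero_div, Real.rpow_zero, mul_one, pow_zero, one_mul, add_zero,
    sub_zero] at h
  have hpos : ∀ n : ℕ, 0 ≤ (2 * √(τ * δ)) ^ n / n.factorial *
          ((1 / δ) ^ ((n : ℝ) / 2 + 1) * Real.Gamma ((n : ℝ) / 2 + 1)) *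
          (Real.Gamma (((d : ℝ) + n) / 2) / Real.Gamma ((d : ℝ) / 2)) := fun n => by
    have := Real.Gamma_pos_of_pos (s := (n : ℝ) / 2 + 1) (by positivity)
    have := Real.Gamma_pos_of_pos (s := ((d : ℝ) + n) / 2) (by positivity)
    positivity
  have hterm : ∀ n : ℕ, (2 * √(τ * δ)) ^ n / n.factorial *
          ((1 / δ) ^ ((n : ℝ) / 2 + 1) * Real.Gamma ((n : ℝ) / 2 + 1)) *
          (Real.Gamma (((d : ℝ) + n) / 2) / Real.Gamma ((d : ℝ) / 2))
      = δ⁻¹ * (√τ ^ n * √Real.pi * (Real.Gamma (((d : ℝ) + n) / 2) /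
        (Real.Gamma (((n : ℝ) + 1) / 2) * Real.Gamma ((d : ℝ) / 2)))) := fun n => by
    have e := factorial_eq_Gamma_mul n
    have hf := Nat.factorial_pos n
    have h1 := Real.Gamma_pos_of_pos (s := ((n : ℝ) + 1) / 2) (by positivity)
    have h2 : (1 / δ) ^ ((n : ℝ) / 2 + 1) = δ⁻¹ * (√δ ^ n)⁻¹ := by
      rw [one_div, Real.inv_rpow hδ.le, Real.rpow_add_one hδ.ne', mul_inv, mul_comm,
        div_eq_mul_one_div, mul_comm (n : ℝ), Real.rpow_mul hδ.le, Real.rpow_natCast, Real.sqrt_eq_rpow]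
    have hsδ := Real.sqrt_pos.2 hδ
    rw [h2, Real.sqrt_mul hτ.le, mul_pow, mul_pow]
    generalize Real.Gamma (((n : ℝ) + 1) / 2) = G1 at *
    generalize Real.Gamma ((n : ℝ) / 2 + 1) = G2 at *
    field_simp
    linear_combination -e
  have heven : HasSum (fun m : ℕ => √τ ^ (2 * m) * √Real.pi * (Real.Gamma (((d : ℝ) + (2 * m : ℕ)) / 2) /
        (Real.Gamma ((((2 * m : ℕ) : ℝ) + 1) / 2) * Real.Gamma ((d : ℝ) / 2)))) _ :=
    (hasSum_hyp2F1_one_half hτ hτ1 d).congr_terms fun m => by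
      have h1 := ascPochhammer_eval_pos (b := 1 / 2) (by norm_num) m
      rw [pow_mul, Real.sq_sqrt hτ.le, show ((d : ℝ) + (2 * m : ℕ)) / 2 = d / 2 + m by push_cast; ring,
        show (((2 * m : ℕ) : ℝ) + 1) / 2 = 1 / 2 + m by push_cast; ring, Gamma_add_nat (by positivity),
        Gamma_add_nat (by norm_num), Real.Gamma_one_half_eq]
      field_simp
  have hodd : HasSum (fun m : ℕ => √τ ^ (2 * m + 1) * √Real.pi *
        (Real.Gamma (((d : ℝ) + (2 * m + 1 : ℕ)) / 2) /
        (Real.Gamma ((((2 * m + 1 : ℕ) : ℝ) + 1) / 2) * Real.Gamma ((d : ℝ) / 2)))) _ :=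
    ((hasSum_one_sub_rpow_neg (((d : ℝ) + 1) / 2) (z := τ) (by rwa [abs_of_pos hτ])).mul_left
      (√τ * √Real.pi * (Real.Gamma (((d : ℝ) + 1) / 2) / Real.Gamma ((d : ℝ) / 2)))).congr_terms
      fun m => by
      rw [pow_succ, pow_mul, Real.sq_sqrt hτ.le,
        show ((d : ℝ) + (2 * m + 1 : ℕ)) / 2 = (d + 1) / 2 + m by push_cast; ring,
        show (((2 * m + 1 : ℕ) : ℝ) + 1) / 2 = m + 1 by push_cast; ring, Gamma_add_nat (by positivity),
        Real.Gamma_nat_eq_factorial]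
      have hf := Nat.factorial_pos m
      field_simp
  have key := (HasSum.even_add_odd (f := fun n : ℕ => √τ ^ n * √Real.pi *
    (Real.Gamma (((d : ℝ) + n) / 2) /
      (Real.Gamma (((n : ℝ) + 1) / 2) * Real.Gamma ((d : ℝ) / 2)))) heven hodd).mul_left δ⁻¹
  rw [h, ← ENNReal.ofReal_tsum_of_nonneg hpos (key.congr_terms hterm).summable,
    (key.congr_terms hterm).tsum_eq]
  congr 2
  rw [hyp2F1_self hτ hτ1 _ (by norm_num), Real.div_rpow hτ.le h3.le, ← Real.sqrt_eq_rpow,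
    ← Real.sqrt_eq_rpow, ← Real.sqrt_eq_rpow]
  have e1 : (1 - τ) ^ (-(((d : ℝ) + 1) / 2)) = (1 - τ)⁻¹ * ((√(1 - τ))⁻¹ * (1 - τ) ^ (-((d : ℝ) - 2) / 2)) := by
    rw [Real.sqrt_eq_rpow, ← Real.rpow_neg_one, ← Real.rpow_neg h3.le, ← Real.rpow_add h3,
      ← Real.rpow_add h3]
    congr 1
    ring
  rw [e1]
  have := Real.sqrt_pos.2 h3
  field_simp

-- The extra factor |y| t^{-1/2} exchanges the roles of the parities: the even terms are now
-- binomial, and the odd ones have coefficients ((d+2)/2)_m/(3/2)_m and sum by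
-- `hasSum_hyp2F1_three_halves`.
set_option maxHeartbeats 400000 in
theorem laplace_gauss_norm_value (hd : 1 ≤ d) {δ τ : ℝ} (hδ : 0 < δ) (hτ : 0 < τ) (hτ1 : τ < 1) :
    ∫⁻ t in Ioi (0 : ℝ), ENNReal.ofReal (Real.exp (-(δ * t)) * t ^ (-(1 / 2) : ℝ)) *
        ∫⁻ y : EuclideanSpace ℝ (Fin d), gaussDensity 1 y *
          ENNReal.ofReal (‖y‖ * Real.exp (2 * √(τ * δ * t) * ‖y‖))
      = ENNReal.ofReal (Real.Gamma (1 / 2) * (√δ)⁻¹ * ((1 / (1 - τ)) ^ (1 / 2 : ℝ) *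
      (Real.Gamma (((d : ℝ) + 1) / 2) / Real.Gamma ((d : ℝ) / 2)
        * hyp2F1 (-(d : ℝ) / 2) (1 / 2) (1 / 2) (-(τ / (1 - τ)))
      + 2 * (Real.Gamma (((d : ℝ) + 2) / 2) / (Real.Gamma (1 / 2) * Real.Gamma ((d : ℝ) / 2)))
        * (τ / (1 - τ)) ^ (1 / 2 : ℝ)
        * hyp2F1 (-((d : ℝ) - 1) / 2) 1 (3 / 2) (-(τ / (1 - τ)))))) := by
  have hd' : (0 : ℝ) < d := by exact_mod_cast hd
  have h3 : 0 < 1 - τ := by linarith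
  have hG := Real.Gamma_pos_of_pos (half_pos hd')
  have h := lintegral_laplace_gaussDensity hd 1 le_rfl hδ hτ
  simp only [Nat.cast_one, pow_one] at h
  rw [show (-1 / 2 : ℝ) = -(1 / 2) by norm_num] at h
  have hpos : ∀ n : ℕ, 0 ≤ (2 * √(τ * δ)) ^ n / n.factorial *
          ((1 / δ) ^ (((n : ℝ) - 1) / 2 + 1) * Real.Gamma (((n : ℝ) - 1) / 2 + 1)) *
          (Real.Gamma (((d : ℝ) + (n + 1 : ℕ)) / 2) / Real.Gamma ((d : ℝ) / 2)) := fun n => by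
    have := Real.Gamma_pos_of_pos (s := ((n : ℝ) - 1) / 2 + 1) (by
      have : (0 : ℝ) ≤ n := by positivity
      linarith)
    have := Real.Gamma_pos_of_pos (s := ((d : ℝ) + (n + 1 : ℕ)) / 2) (by positivity)
    positivity
  have hterm : ∀ n : ℕ, (2 * √(τ * δ)) ^ n / n.factorial *
          ((1 / δ) ^ (((n : ℝ) - 1) / 2 + 1) * Real.Gamma (((n : ℝ) - 1) / 2 + 1)) *
          (Real.Gamma (((d : ℝ) + (n + 1 : ℕ)) / 2) / Real.Gamma ((d : ℝ) / 2))
      = (√Real.pi * (√δ)⁻¹) * (√τ ^ n * (Real.Gamma (((d : ℝ) + (n + 1 : ℕ)) / 2) /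
        (Real.Gamma ((n : ℝ) / 2 + 1) * Real.Gamma ((d : ℝ) / 2)))) := fun n => by
    have e := factorial_eq_Gamma_mul n
    have hf := Nat.factorial_pos n
    have h1 := Real.Gamma_pos_of_pos (s := (n : ℝ) / 2 + 1) (by positivity)
    have h2 : (1 / δ) ^ (((n : ℝ) - 1) / 2 + 1) = (√δ)⁻¹ * (√δ ^ n)⁻¹ := by
      rw [show ((n : ℝ) - 1) / 2 + 1 = 1 / 2 + 1 / 2 * n by ring, one_div, Real.inv_rpow hδ.le,
        Real.rpow_add hδ, mul_inv, Real.rpow_mul hδ.le, Real.rpow_natCast, ← Real.sqrt_eq_rpow]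
    have hsδ := Real.sqrt_pos.2 hδ
    rw [h2, Real.sqrt_mul hτ.le, mul_pow, mul_pow, show ((n : ℝ) - 1) / 2 + 1 = (n + 1) / 2 by ring]
    generalize Real.Gamma (((n : ℝ) + 1) / 2) = G1 at *
    generalize Real.Gamma ((n : ℝ) / 2 + 1) = G2 at *
    field_simp
    linear_combination -e
  have heven : HasSum (fun m : ℕ => √τ ^ (2 * m) * (Real.Gamma (((d : ℝ) + (2 * m + 1 : ℕ)) / 2) /
        (Real.Gamma (((2 * m : ℕ) : ℝ) / 2 + 1) * Real.Gamma ((d : ℝ) / 2)))) _ :=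
    ((hasSum_one_sub_rpow_neg (((d : ℝ) + 1) / 2) (z := τ) (by rwa [abs_of_pos hτ])).mul_left
      (Real.Gamma (((d : ℝ) + 1) / 2) / Real.Gamma ((d : ℝ) / 2))).congr_terms
      fun m => by
      rw [pow_mul, Real.sq_sqrt hτ.le,
        show ((d : ℝ) + (2 * m + 1 : ℕ)) / 2 = (d + 1) / 2 + m by push_cast; ring,
        show ((2 * m : ℕ) : ℝ) / 2 + 1 = m + 1 by push_cast; ring, Gamma_add_nat (by positivity),
        Real.Gamma_nat_eq_factorial]
      have hf := Nat.factorial_pos m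
      field_simp
  have hodd : HasSum (fun m : ℕ => √τ ^ (2 * m + 1) *
        (Real.Gamma (((d : ℝ) + (2 * m + 1 + 1 : ℕ)) / 2) /
        (Real.Gamma (((2 * m + 1 : ℕ) : ℝ) / 2 + 1) * Real.Gamma ((d : ℝ) / 2)))) _ :=
    ((hasSum_hyp2F1_three_halves hτ hτ1 d).mul_left
      (2 * √τ * (Real.Gamma (((d : ℝ) + 2) / 2) / (Real.Gamma (1 / 2) * Real.Gamma ((d : ℝ) / 2))))).congr_terms
      fun m => by
      have h1 := ascPochhammer_eval_pos (b := 3 / 2) (by norm_num) m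
      have h2 := Real.Gamma_pos_of_pos (s := (1 / 2 : ℝ)) (by norm_num)
      rw [pow_succ, pow_mul, Real.sq_sqrt hτ.le,
        show ((d : ℝ) + (2 * m + 1 + 1 : ℕ)) / 2 = (d + 2) / 2 + m by push_cast; ring,
        show ((2 * m + 1 : ℕ) : ℝ) / 2 + 1 = 3 / 2 + m by push_cast; ring, Gamma_add_nat (by positivity),
        Gamma_add_nat (by norm_num), show (3 / 2 : ℝ) = 1 / 2 + 1 by norm_num,
        Real.Gamma_add_one (by norm_num)]
      rw [show (3 / 2 : ℝ) = 1 / 2 + 1 by norm_num] at h1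
      field_simp
  have key := (HasSum.even_add_odd (f := fun n : ℕ => √τ ^ n *
    (Real.Gamma (((d : ℝ) + (n + 1 : ℕ)) / 2) /
      (Real.Gamma ((n : ℝ) / 2 + 1) * Real.Gamma ((d : ℝ) / 2)))) heven hodd).mul_left
    (√Real.pi * (√δ)⁻¹)
  rw [h, ← ENNReal.ofReal_tsum_of_nonneg hpos (key.congr_terms hterm).summable,
    (key.congr_terms hterm).tsum_eq, Real.Gamma_one_half_eq]
  congr 2
  rw [hyp2F1_self hτ hτ1 _ (by norm_num), Real.div_rpow hτ.le h3.le, Real.div_rpow zero_le_one h3.le,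
    Real.one_rpow, ← Real.sqrt_eq_rpow, ← Real.sqrt_eq_rpow]
  have e1 : (1 - τ) ^ (-(((d : ℝ) + 1) / 2)) = (√(1 - τ))⁻¹ * (1 - τ) ^ (-(d : ℝ) / 2) := by
    rw [Real.sqrt_eq_rpow, ← Real.rpow_neg h3.le, ← Real.rpow_add h3]
    congr 1
    ring
  rw [e1]
  have h5 := Real.sqrt_pos.2 h3
  have h6 := Real.sq_sqrt h3.le
  generalize hyp2F1 (-((d : ℝ) - 1) / 2) 1 (3 / 2) (-(τ / (1 - τ))) = H
  generalize (1 - τ) ^ (-(d : ℝ) / 2) = W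
  rw [show H / (1 - τ) = H / √(1 - τ) ^ 2 by rw [h6]]
  field_simp

end Gaussian

/-! ### Jensen's inequality for unnormalized densities -/

section Jensen
variable {Ω : Type*} [MeasurableSpace Ω] {m : Measure Ω}

/-- Jensen's inequality for an unnormalized density `ρ`. -/
theorem lintegral_mul_rpow_le {p : ℝ} (hp : 1 ≤ p) {ρ f : Ω → ℝ≥0∞} (hρ : AEMeasurable ρ m)
    (hf : AEMeasurable f m) :
    (∫⁻ a, ρ a * f a ∂m) ^ p ≤ (∫⁻ a, ρ a ∂m) ^ (p - 1) * ∫⁻ a, ρ a * f a ^ p ∂m := by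
  have hp0 : 0 < p := by linarith
  -- Hölder in the form with exponents 1 - 1/p and 1/p on the integrals, applied to ρ and ρf^p; this
  -- form includes p = 1.
  have h := ENNReal.lintegral_mul_norm_pow_le (μ := m) hρ (hρ.mul (hf.pow_const p)) (p := 1 - 1 / p)
    (q := 1 / p) (by rw [sub_nonneg, div_le_one hp0]; exact hp) (by positivity) (by ring)
  have e : ∀ a, ρ a ^ (1 - 1 / p) * (ρ a * f a ^ p) ^ (1 / p) = ρ a * f a := fun a => by
    rw [ENNReal.mul_rpow_of_nonneg _ _ (by positivity), ← ENNReal.rpow_mul, mul_one_div_cancel hp0.ne',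
      ENNReal.rpow_one, ← mul_assoc, ← ENNReal.rpow_add_of_nonneg _ _
        (by rw [sub_nonneg, div_le_one hp0]; exact hp) (by positivity), sub_add_cancel,
      ENNReal.rpow_one]
  simp only [Pi.mul_apply, e] at h
  calc _ ≤ ((∫⁻ a, ρ a ∂m) ^ (1 - 1 / p) * (∫⁻ a, ρ a * f a ^ p ∂m) ^ (1 / p)) ^ p := by gcongr
    _ = _ := by
      rw [ENNReal.mul_rpow_of_nonneg _ _ hp0.le, ← ENNReal.rpow_mul, ← ENNReal.rpow_mul,
        one_div_mul_cancel hp0.ne', ENNReal.rpow_one, sub_mul, one_mul, one_div_mul_cancel hp0.ne']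

/-- Jensen at each point x, followed by Tonelli. Keeping (∫ρ)^{p-1} separate from the second
integral is what lets the constants be computed exactly. -/
theorem lintegral_lintegral_mul_rpow_le {X : Type*} [MeasurableSpace X] {ν : Measure X} [SFinite ν]
    [SFinite m] {p : ℝ} (hp : 1 ≤ p) {ρ : Ω → ℝ≥0∞} (hρ : Measurable ρ) {f : Ω → X → ℝ≥0∞}
    (hf : Measurable fun q : Ω × X => f q.1 q.2) :
    ∫⁻ x, (∫⁻ a, ρ a * f a x ∂m) ^ p ∂ν
      ≤ (∫⁻ a, ρ a ∂m) ^ (p - 1) * ∫⁻ a, ρ a * ∫⁻ x, f a x ^ p ∂ν ∂m := by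
  have hF : Measurable fun q : X × Ω => ρ q.2 * f q.2 q.1 ^ p :=
    (hρ.comp measurable_snd).mul ((hf.comp measurable_swap).pow_const p)
  calc _ ≤ ∫⁻ x, (∫⁻ a, ρ a ∂m) ^ (p - 1) * ∫⁻ a, ρ a * f a x ^ p ∂m ∂ν :=
        lintegral_mono fun x => lintegral_mul_rpow_le hp hρ.aemeasurable
          (hf.comp measurable_prodMk_right).aemeasurable
    _ = (∫⁻ a, ρ a ∂m) ^ (p - 1) * ∫⁻ x, ∫⁻ a, ρ a * f a x ^ p ∂m ∂ν :=
        lintegral_const_mul _ (Measurable.lintegral_prod_right hF)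
    _ = _ := by
        rw [lintegral_lintegral_swap hF.aemeasurable]
        congr 1
        refine lintegral_congr fun a => ?_
        exact lintegral_const_mul _ ((hf.comp measurable_prodMk_left).pow_const p)

end Jensen

/-! ### Weighted norms and the weighted Schur test -/

section Weighted
variable {d N : ℕ}

/-- The `p`-th power of the weighted norm, for `[0, ∞]`-valued functions. -/
noncomputable def wInt (θ : EuclideanSpace ℝ (Fin d) → ℝ) (p : ℝ)
    (G : EuclideanSpace ℝ (Fin d) → ℝ≥0∞) : ℝ≥0∞ :=
  ∫⁻ x, (ENNReal.ofReal (θ x) * G x) ^ p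

variable {θ : EuclideanSpace ℝ (Fin d) → ℝ} {p η Cθ : ℝ}

theorem wNorm_eq (hθ : ∀ x, 0 < θ x) (hp : 1 ≤ p)
    (v : EuclideanSpace ℝ (Fin d) → EuclideanSpace ℂ (Fin N)) :
    wNorm θ p v = (wInt θ p fun x => ‖v x‖ₑ) ^ (1 / p) := by
  have hp0 : 0 < p := by linarith
  rw [wNorm, eLpNorm_eq_lintegral_rpow_enorm_toReal (by simpa using hp0) ENNReal.ofReal_ne_top,
    ENNReal.toReal_ofReal hp0.le, wInt]
  simp only [enorm_smul, Real.enorm_of_nonneg (hθ _).le]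

theorem wNorm_rpow (hθ : ∀ x, 0 < θ x) (hp : 1 ≤ p)
    (v : EuclideanSpace ℝ (Fin d) → EuclideanSpace ℂ (Fin N)) :
    wNorm θ p v ^ p = wInt θ p fun x => ‖v x‖ₑ := by
  have hp0 : 0 < p := by linarith
  rw [wNorm_eq hθ hp, ← ENNReal.rpow_mul, one_div_mul_cancel hp0.ne', ENNReal.rpow_one]

theorem wInt_mono (hp : 1 ≤ p) {G G' : EuclideanSpace ℝ (Fin d) → ℝ≥0∞} (h : ∀ x, G x ≤ G' x) :
    wInt θ p G ≤ wInt θ p G' := by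
  refine lintegral_mono fun x => ?_
  have := h x
  have hp0 : 0 < p := by linarith
  gcongr

theorem wNorm_congr {v w : EuclideanSpace ℝ (Fin d) → EuclideanSpace ℂ (Fin N)} (h : v =ᵐ[volume] w) :
    wNorm θ p v = wNorm θ p w :=
  eLpNorm_congr_ae (h.mono fun x hx => by simp only [hx])

theorem wNorm_lt_top_iff (hθ : ∀ x, 0 < θ x) (hp : 1 ≤ p)
    (v : EuclideanSpace ℝ (Fin d) → EuclideanSpace ℂ (Fin N)) :
    wNorm θ p v < ⊤ ↔ (wInt θ p fun x => ‖v x‖ₑ) < ⊤ := by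
  have hp0 : 0 < p := by linarith
  rw [wNorm_eq hθ hp, ENNReal.rpow_lt_top_iff_of_pos (by positivity)]

theorem wInt_ae_lt_top (hθ : ∀ x, 0 < θ x) (hθc : Continuous θ) (hp : 1 ≤ p)
    {G : EuclideanSpace ℝ (Fin d) → ℝ≥0∞} (hG : Measurable G) (h : wInt θ p G < ⊤) :
    ∀ᵐ x, G x < ⊤ := by
  have hp0 : 0 < p := by linarith
  filter_upwards [ae_lt_top (by fun_prop) h.ne] with x hx
  rw [ENNReal.rpow_lt_top_iff_of_pos hp0] at hx
  exact lt_top_iff_ne_top.2 fun hc => by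
    rw [hc, ENNReal.mul_top (by simpa using hθ x)] at hx
    exact lt_irrefl _ hx

theorem locallyIntegrable_of_wNorm (hθ : ∀ x, 0 < θ x) (hθc : Continuous θ) (hp : 1 ≤ p)
    {v : EuclideanSpace ℝ (Fin d) → EuclideanSpace ℂ (Fin N)} (hv : AEStronglyMeasurable v)
    (h : wNorm θ p v < ⊤) : LocallyIntegrable v := by
  have hm : MemLp (fun x => θ x • v x) (ENNReal.ofReal p) volume :=
    ⟨hθc.aestronglyMeasurable.smul hv, h⟩
  have h1 : LocallyIntegrable (fun x => θ x • v x) volume := fun x =>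
    (hm.locallyIntegrable (by simpa using hp)) x
  have h2 : LocallyIntegrable (fun x => (θ x)⁻¹ • (θ x • v x)) volume :=
    h1.continuous_smul (hθc.inv₀ fun x => (hθ x).ne')
  refine h2.congr (Eventually.of_forall fun x => ?_)
  simp [smul_smul, inv_mul_cancel₀ (hθ x).ne']

/-- A continuous positive weight has a continuous reciprocal, so local integrability follows from
measurability and a finite norm. -/
theorem memWLp_iff (hθ : ∀ x, 0 < θ x) (hθc : Continuous θ) (hp : 1 ≤ p)
    {v : EuclideanSpace ℝ (Fin d) → EuclideanSpace ℂ (Fin N)} :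
    MemWLp θ p v ↔ AEStronglyMeasurable v ∧ wNorm θ p v < ⊤ :=
  ⟨fun h => ⟨h.1.aestronglyMeasurable, h.2⟩,
    fun h => ⟨locallyIntegrable_of_wNorm hθ hθc hp h.1 h.2, h.2⟩⟩

theorem MemWLp.congr {v w : EuclideanSpace ℝ (Fin d) → EuclideanSpace ℂ (Fin N)}
    (hv : MemWLp θ p v) (h : v =ᵐ[volume] w) : MemWLp θ p w :=
  ⟨hv.1.congr h, by rw [← wNorm_congr h]; exact hv.2⟩

theorem wNorm_add_le (hθc : Continuous θ) (hp : 1 ≤ p)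
    {v w : EuclideanSpace ℝ (Fin d) → EuclideanSpace ℂ (Fin N)} (hv : AEStronglyMeasurable v)
    (hw : AEStronglyMeasurable w) :
    wNorm θ p (fun x => v x + w x) ≤ wNorm θ p v + wNorm θ p w := by
  have := eLpNorm_add_le (hθc.aestronglyMeasurable.smul hv) (hθc.aestronglyMeasurable.smul hw)
    (p := ENNReal.ofReal p) (by simpa using hp)
  simp only [wNorm, smul_add]
  exact this

theorem wNorm_const_smul (c : ℂ) (v : EuclideanSpace ℝ (Fin d) → EuclideanSpace ℂ (Fin N)) :
    wNorm θ p (fun x => c • v x) = ‖c‖ₑ * wNorm θ p v := by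
  have := eLpNorm_const_smul c (fun x => θ x • v x) (ENNReal.ofReal p) volume
  rw [wNorm, wNorm, ← this]
  congr 1
  ext1 x
  exact smul_comm _ _ _

theorem wNorm_sub_le (hθc : Continuous θ) (hp : 1 ≤ p)
    {v w : EuclideanSpace ℝ (Fin d) → EuclideanSpace ℂ (Fin N)} (hv : AEStronglyMeasurable v)
    (hw : AEStronglyMeasurable w) :
    wNorm θ p (fun x => v x - w x) ≤ wNorm θ p v + wNorm θ p w := by
  have := eLpNorm_sub_le (hθc.aestronglyMeasurable.smul hv) (hθc.aestronglyMeasurable.smul hw)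
    (p := ENNReal.ofReal p) (by simpa using hp)
  simp only [wNorm, smul_sub]
  exact this

theorem ae_eq_zero_of_wNorm (hθ : ∀ x, 0 < θ x) (hθc : Continuous θ) (hp : 1 ≤ p)
    {v : EuclideanSpace ℝ (Fin d) → EuclideanSpace ℂ (Fin N)} (hv : AEStronglyMeasurable v)
    (h : wNorm θ p v = 0) : v =ᵐ[volume] 0 := by
  have := (eLpNorm_eq_zero_iff (hθc.aestronglyMeasurable.smul hv)
    (by simpa using by linarith)).1 h
  filter_upwards [this] with x hx
  simpa [(hθ x).ne'] using hx

/-- Weighted Schur test for averages over isometries. -/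
theorem wInt_schur (hθ : IsRadialWeight θ η Cθ) (hp : 1 ≤ p) {Ω : Type*} [MeasurableSpace Ω]
    {m : Measure Ω} [SFinite m] {τ : Ω → EuclideanSpace ℝ (Fin d) → EuclideanSpace ℝ (Fin d)}
    (hτ : Measurable fun q : Ω × EuclideanSpace ℝ (Fin d) => τ q.1 q.2)
    (hmp : ∀ a, MeasurePreserving (τ a)) {b : Ω → ℝ} (hb : Measurable b)
    (hτb : ∀ a x, ∃ z, ‖z‖ = ‖x‖ ∧ ‖z - τ a x‖ ≤ b a) {ρ W : Ω → ℝ≥0∞} (hρ : Measurable ρ)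
    (hW : Measurable W) {G : EuclideanSpace ℝ (Fin d) → ℝ≥0∞} (hG : Measurable G) :
    wInt θ p (fun x => ∫⁻ a, ρ a * (W a * G (τ a x)) ∂m) ≤
      ENNReal.ofReal Cθ ^ p * ((∫⁻ a, ρ a ∂m) ^ (p - 1) *
        ∫⁻ a, ρ a * (W a ^ p * ENNReal.ofReal (Real.exp (p * η * b a))) ∂m) * wInt θ p G := by
  have hp0 : 0 < p := by linarith
  obtain ⟨φ, hφ⟩ := hθ.radial
  have hθm : Measurable θ := hθ.continuous.measurable
  -- Radial symmetry enters here: θ(x) = θ(z) for the companion point z with |z| = |x|, and z lies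
  -- within b(a) of the point where G is evaluated. The unbounded rotation displacement |e^{tS}x -
  -- x| never appears.
  have hθle : ∀ a x, ENNReal.ofReal (θ x) ≤ ENNReal.ofReal Cθ *
      (ENNReal.ofReal (Real.exp (η * b a)) * ENNReal.ofReal (θ (τ a x))) := fun a x => by
    obtain ⟨z, hz, hzb⟩ := hτb a x
    rw [← ENNReal.ofReal_mul (by positivity), ← ENNReal.ofReal_mul hθ.const_pos.le]
    refine ENNReal.ofReal_le_ofReal ?_
    have h1 := hθ.growth (τ a x) (z - τ a x)
    rw [add_sub_cancel, hφ z, hz, ← hφ] at h1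
    have h2 := hθ.pos (τ a x)
    have h3 := hθ.const_pos
    have h4 := hθ.rate_nonneg
    calc θ x ≤ _ := h1
      _ ≤ Cθ * θ (τ a x) * Real.exp (η * b a) := by gcongr
      _ = _ := by ring
  let f : Ω → EuclideanSpace ℝ (Fin d) → ℝ≥0∞ := fun a x =>
    (W a * ENNReal.ofReal (Real.exp (η * b a))) * (ENNReal.ofReal (θ (τ a x)) * G (τ a x))
  have hf : Measurable fun q : Ω × EuclideanSpace ℝ (Fin d) => f q.1 q.2 := by
    refine Measurable.mul ?_ ?_
    · exact ((hW.comp measurable_fst).mul ((hb.comp measurable_fst).const_mul η).exp.ennreal_ofReal)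
    · exact ((hθm.comp hτ).ennreal_ofReal).mul (hG.comp hτ)
  have hfx : ∀ x, Measurable fun a => f a x := fun x => hf.comp measurable_prodMk_right
  have step : ∀ x, ENNReal.ofReal (θ x) * ∫⁻ a, ρ a * (W a * G (τ a x)) ∂m
      ≤ ENNReal.ofReal Cθ * ∫⁻ a, ρ a * f a x ∂m := fun x => by
    rw [← lintegral_const_mul' _ _ ENNReal.ofReal_ne_top,
      ← lintegral_const_mul' _ _ ENNReal.ofReal_ne_top]
    refine lintegral_mono fun a => ?_
    calc _ ≤ (ENNReal.ofReal Cθ *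
      (ENNReal.ofReal (Real.exp (η * b a)) * ENNReal.ofReal (θ (τ a x)))) *
        (ρ a * (W a * G (τ a x))) := by gcongr; exact hθle a x
      _ = _ := by simp only [f]; ring
  calc _ ≤ ∫⁻ x, ENNReal.ofReal Cθ ^ p * (∫⁻ a, ρ a * f a x ∂m) ^ p := by
        refine lintegral_mono fun x => ?_
        rw [← ENNReal.mul_rpow_of_nonneg _ _ hp0.le]
        exact ENNReal.rpow_le_rpow (step x) hp0.le
    _ = ENNReal.ofReal Cθ ^ p * ∫⁻ x, (∫⁻ a, ρ a * f a x ∂m) ^ p :=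
        lintegral_const_mul' _ _ (ENNReal.rpow_ne_top_of_nonneg hp0.le ENNReal.ofReal_ne_top)
    _ ≤ ENNReal.ofReal Cθ ^ p * ((∫⁻ a, ρ a ∂m) ^ (p - 1) * ∫⁻ a, ρ a * (∫⁻ x, f a x ^ p) ∂m) := by
        gcongr
        exact lintegral_lintegral_mul_rpow_le hp hρ hf
    _ = _ := by
        -- Since the inner map preserves Lebesgue measure, the x-integral is the same weighted norm
        -- of G for every a.
        have e : ∀ a, ∫⁻ x, f a x ^ p
            = W a ^ p * ENNReal.ofReal (Real.exp (p * η * b a)) * wInt θ p G := fun a => by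
          have hm' : Measurable fun x => (ENNReal.ofReal (θ x) * G x) ^ p :=
            ((hθm.ennreal_ofReal).mul hG).pow_const p
          have e1 : ∀ x, f a x ^ p = (W a * ENNReal.ofReal (Real.exp (η * b a))) ^ p *
              (fun x => (ENNReal.ofReal (θ x) * G x) ^ p) (τ a x) := fun x =>
            ENNReal.mul_rpow_of_nonneg _ _ hp0.le
          rw [lintegral_congr e1]
          refine (lintegral_const_mul _ (hm'.comp (hmp a).measurable)).trans ?_
          refine (congrArg _ ((hmp a).lintegral_comp hm')).trans ?_
          rw [ENNReal.mul_rpow_of_nonneg _ _ hp0.le,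
            ENNReal.ofReal_rpow_of_pos (Real.exp_pos _), ← Real.exp_mul, wInt]
          congr 4
          ring
        simp only [e]
        have hmm : Measurable fun a => ρ a *
            (W a ^ p * ENNReal.ofReal (Real.exp (p * η * b a))) :=
          hρ.mul ((hW.pow_const p).mul ((hb.const_mul (p * η)).exp.ennreal_ofReal))
        have e2 : ∫⁻ a, ρ a * (W a ^ p * ENNReal.ofReal (Real.exp (p * η * b a)) * wInt θ p G) ∂m
            = (∫⁻ a, ρ a * (W a ^ p * ENNReal.ofReal (Real.exp (p * η * b a))) ∂m) * wInt θ p G := by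
          rw [← lintegral_mul_const _ hmm]
          simp only [mul_assoc]
        rw [e2]
        ring

end Weighted

/-! ### Rotations generated by a skew-symmetric matrix -/

section Rotation
variable {d : ℕ} {S : Matrix (Fin d) (Fin d) ℝ}

theorem exp_smul_add (S : Matrix (Fin d) (Fin d) ℝ) (s t : ℝ) :
    NormedSpace.exp ((s + t) • S) = NormedSpace.exp (s • S) * NormedSpace.exp (t • S) := by
  rw [add_smul, Matrix.exp_add_of_commute]
  exact ((Commute.refl S).smul_left s).smul_right t

theorem expRotation_add (s t : ℝ) (x : EuclideanSpace ℝ (Fin d)) :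
    expRotation S (s + t) x = expRotation S s (expRotation S t x) := by
  rw [expRotation, exp_smul_add, map_mul]
  rfl

theorem expRotation_zero (x : EuclideanSpace ℝ (Fin d)) : expRotation S 0 x = x := by
  simp [expRotation]

/-- Transposing e^{tS} gives e^{-tS}, its inverse, so the matrix is orthogonal. -/
theorem norm_expRotation (hS : S.transpose = -S) (t : ℝ) (x : EuclideanSpace ℝ (Fin d)) :
    ‖expRotation S t x‖ = ‖x‖ := by
  have h : (NormedSpace.exp (t • S)).conjTranspose * NormedSpace.exp (t • S) = 1 := by
    rw [Matrix.conjTranspose_eq_transpose_of_trivial, ← Matrix.exp_transpose, Matrix.transpose_smul, hS,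
      smul_neg, ← neg_smul, ← exp_smul_add]
    simp
  have h2 : ContinuousLinearMap.adjoint (Matrix.toEuclideanCLM (n := Fin d) (𝕜 := ℝ) (NormedSpace.exp (t • S)))
      * Matrix.toEuclideanCLM (n := Fin d) (𝕜 := ℝ) (NormedSpace.exp (t • S)) = 1 := by
    rw [← ContinuousLinearMap.star_eq_adjoint, ← map_star, ← map_mul, Matrix.star_eq_conjTranspose, h,
      map_one]
  have h3 : ‖expRotation S t x‖ ^ 2 = ‖x‖ ^ 2 := by
    rw [← real_inner_self_eq_norm_sq, expRotation, ← ContinuousLinearMap.adjoint_inner_left,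
      ← mul_apply_eq_comp, h2, one_apply_eq_self, real_inner_self_eq_norm_sq]
  exact (pow_left_inj₀ (norm_nonneg _) (norm_nonneg _) two_ne_zero).1 h3

/-- `e^{tS}` as a linear isometry. -/
noncomputable def rotIso (hS : S.transpose = -S) (t : ℝ) :
    EuclideanSpace ℝ (Fin d) ≃ₗᵢ[ℝ] EuclideanSpace ℝ (Fin d) :=
  LinearIsometry.toLinearIsometryEquiv
    ⟨(Matrix.toEuclideanCLM (n := Fin d) (𝕜 := ℝ) (NormedSpace.exp (t • S))).toLinearMap,
      norm_expRotation hS t⟩ rfl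

theorem continuous_expRotation :
    Continuous fun q : ℝ × EuclideanSpace ℝ (Fin d) => expRotation S q.1 q.2 := by
  have h1 : Continuous fun t : ℝ => NormedSpace.exp (t • S) := by
    let : NormedRing (Matrix (Fin d) (Fin d) ℝ) := Matrix.linftyOpNormedRing
    let : NormedAlgebra ℝ (Matrix (Fin d) (Fin d) ℝ) := Matrix.linftyOpNormedAlgebra
    let : NormedAlgebra ℚ (Matrix (Fin d) (Fin d) ℝ) := Matrix.linftyOpNormedAlgebra
    exact NormedSpace.exp_continuous.comp (continuous_id.smul continuous_const)
  have h2 : Continuous fun M : Matrix (Fin d) (Fin d) ℝ =>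
      Matrix.toEuclideanCLM (n := Fin d) (𝕜 := ℝ) M :=
    LinearMap.continuous_of_finiteDimensional (𝕜 := ℝ)
      { toFun := fun M : Matrix (Fin d) (Fin d) ℝ => Matrix.toEuclideanCLM (n := Fin d) (𝕜 := ℝ) M
        map_add' := map_add _
        map_smul' := map_smul _ }
  exact (h2.comp (h1.comp continuous_fst)).clm_apply continuous_snd

theorem measurePreserving_expRotation_sub (hS : S.transpose = -S) (t : ℝ)
    (ψ : EuclideanSpace ℝ (Fin d)) : MeasurePreserving fun x => expRotation S t x - ψ :=
  (measurePreserving_sub_right volume ψ).comp (rotIso hS t).measurePreserving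

end Rotation

/-! ### The scalar complex heat kernel -/

section ScalarKernel
variable {d : ℕ}

/-- A positive factor leaves the argument unchanged, so the principal logarithm is additive here. -/
theorem ofReal_mul_cpow {r : ℝ} (hr : 0 < r) {z : ℂ} (hz : z ≠ 0) (w : ℂ) :
    ((r : ℂ) * z) ^ w = (r : ℂ) ^ w * z ^ w := by
  have hr' : (r : ℂ) ≠ 0 := by exact_mod_cast hr.ne'
  rw [Complex.cpow_def_of_ne_zero (mul_ne_zero hr' hz), Complex.cpow_def_of_ne_zero hr',
    Complex.cpow_def_of_ne_zero hz, Complex.log_ofReal_mul hr hz, add_mul, Complex.exp_add,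
    Complex.ofReal_log hr.le]

/-- The scalar heat kernel with diffusion coefficient `μ` and damping `β`. -/
noncomputable def scalarKernel (μ β : ℂ) (t : ℝ) (ψ : EuclideanSpace ℝ (Fin d)) : ℂ :=
  (((4 * Real.pi * t : ℝ) : ℂ) * μ) ^ (-(d : ℂ) / 2) *
    Complex.exp (-(t * β) - ((‖ψ‖ ^ 2 : ℝ) : ℂ) * (((4 * t : ℝ) : ℂ) * μ)⁻¹)

variable {μ β : ℂ}

theorem measurable_scalarKernel :
    Measurable fun q : ℝ × EuclideanSpace ℝ (Fin d) => scalarKernel μ β q.1 q.2 := by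
  unfold scalarKernel
  fun_prop

theorem continuous_scalarKernel (t : ℝ) :
    Continuous fun ψ : EuclideanSpace ℝ (Fin d) => scalarKernel μ β t ψ := by
  unfold scalarKernel
  fun_prop

theorem re_inv_pos (hμ : 0 < μ.re) {r : ℝ} (hr : 0 < r) : 0 < ((r : ℂ) * μ⁻¹).re := by
  have : μ ≠ 0 := fun h => by simp [h] at hμ
  rw [Complex.re_ofReal_mul, Complex.inv_re]
  have := Complex.normSq_pos.2 this
  positivity

/-- With u = z - w the integrand is a constant times exp(-b|x|² + c⟨u, x⟩), where b = (s+t)/(4stμ)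
and c = 1/(2sμ). Since Re b > 0, the complex Gaussian integral applies; it remains to match the
exponents and the powers of the prefactors. -/
theorem scalarKernel_conv (hμ : 0 < μ.re) {s t : ℝ} (hs : 0 < s) (ht : 0 < t)
    (z w : EuclideanSpace ℝ (Fin d)) :
    ∫ x, scalarKernel μ β s (z - x) * scalarKernel μ β t (x - w) = scalarKernel μ β (s + t) (z - w) := by
  have hμ0 : μ ≠ 0 := fun h => by simp [h] at hμ
  have hs' : (s : ℂ) ≠ 0 := by exact_mod_cast hs.ne'
  have ht' : (t : ℂ) ≠ 0 := by exact_mod_cast ht.ne'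
  have hst : 0 < s + t := by positivity
  have hst' : (s : ℂ) + t ≠ 0 := by exact_mod_cast hst.ne'
  set u := z - w with hu
  rw [← integral_add_right_eq_self (μ := volume) _ w]
  set b : ℂ := (((s + t) / (4 * s * t) : ℝ) : ℂ) * μ⁻¹ with hb
  set c : ℂ := ((1 / (2 * s) : ℝ) : ℂ) * μ⁻¹ with hc
  have hbre : 0 < b.re := re_inv_pos hμ (by positivity)
  set P : ℂ := (((4 * Real.pi * s : ℝ) : ℂ) * μ) ^ (-(d : ℂ) / 2) *
    (((4 * Real.pi * t : ℝ) : ℂ) * μ) ^ (-(d : ℂ) / 2) with hP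
  have e : ∀ x : EuclideanSpace ℝ (Fin d),
      scalarKernel μ β s (z - (x + w)) * scalarKernel μ β t (x + w - w)
      = P * Complex.exp (-((s + t) * β) - ((‖u‖ ^ 2 : ℝ) : ℂ) * (((4 * s : ℝ) : ℂ) * μ)⁻¹) *
        Complex.exp (-b * ‖x‖ ^ 2 + c * (inner ℝ u x : ℝ)) := fun x => by
    have h1 : z - (x + w) = u - x := by rw [hu]; abel
    rw [h1, add_sub_cancel_right, scalarKernel, scalarKernel, norm_sub_sq_real, hP, mul_mul_mul_comm,
      ← Complex.exp_add, mul_assoc (_ * _) (Complex.exp _) (Complex.exp _), ← Complex.exp_add]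
    congr 2
    rw [hb, hc]
    push_cast
    field_simp
    ring
  simp_rw [e]
  rw [integral_const_mul, GaussianFourier.integral_cexp_neg_mul_sq_norm_add hbre,
    finrank_euclideanSpace_fin, scalarKernel]
  have hpow : P * (Real.pi / b) ^ ((d : ℂ) / 2)
      = (((4 * Real.pi * (s + t) : ℝ) : ℂ) * μ) ^ (-(d : ℂ) / 2) := by
    have hpi := Real.pi_pos
    have h1 : (Real.pi : ℂ) / b = ((4 * Real.pi * s * t / (s + t) : ℝ) : ℂ) * μ := by
      rw [hb]; push_cast; field_simp
    have h2 : 0 < 4 * Real.pi * s * t / (s + t) := by positivity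
    rw [h1, hP, ofReal_mul_cpow (by positivity) hμ0, ofReal_mul_cpow (by positivity) hμ0,
      ofReal_mul_cpow h2 hμ0, ofReal_mul_cpow (by positivity) hμ0]
    have h3 : ((4 * Real.pi * s : ℝ) : ℂ) ^ ((d : ℂ) / 2) * ((4 * Real.pi * t : ℝ) : ℂ) ^ ((d : ℂ) / 2)
        = ((4 * Real.pi * s * t / (s + t) : ℝ) : ℂ) ^ ((d : ℂ) / 2) *
          ((4 * Real.pi * (s + t) : ℝ) : ℂ) ^ ((d : ℂ) / 2) := by
      rw [← Complex.mul_cpow_ofReal_nonneg (by positivity) (by positivity),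
        ← Complex.mul_cpow_ofReal_nonneg (by positivity) (by positivity), ← Complex.ofReal_mul,
        ← Complex.ofReal_mul]
      congr 2
      field_simp
    have n1 : ∀ r : ℝ, 0 < r → (r : ℂ) ^ ((d : ℂ) / 2) ≠ 0 := fun r hr =>
      (Complex.cpow_ne_zero_iff).2 (Or.inl (by exact_mod_cast hr.ne'))
    have n2 := n1 (4 * Real.pi * s) (by positivity)
    have n3 := n1 (4 * Real.pi * t) (by positivity)
    have n4 := n1 _ h2
    have n5 := n1 (4 * Real.pi * (s + t)) (by positivity)
    have n6 : μ ^ ((d : ℂ) / 2) ≠ 0 := (Complex.cpow_ne_zero_iff).2 (Or.inl hμ0)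
    rw [neg_div, Complex.cpow_neg, Complex.cpow_neg, Complex.cpow_neg, Complex.cpow_neg]
    generalize ((4 * Real.pi * s : ℝ) : ℂ) ^ ((d : ℂ) / 2) = a1 at *
    generalize ((4 * Real.pi * t : ℝ) : ℂ) ^ ((d : ℂ) / 2) = a2 at *
    generalize ((4 * Real.pi * s * t / (s + t) : ℝ) : ℂ) ^ ((d : ℂ) / 2) = a3 at *
    generalize ((4 * Real.pi * (s + t) : ℝ) : ℂ) ^ ((d : ℂ) / 2) = a4 at *
    generalize μ ^ ((d : ℂ) / 2) = a5 at *
    field_simp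
    linear_combination -h3
  rw [← hpow]
  have hexp : Complex.exp (-(((s + t : ℝ) : ℂ) * β) - ((‖u‖ ^ 2 : ℝ) : ℂ) * (((4 * (s + t) : ℝ) : ℂ) * μ)⁻¹)
      = Complex.exp (-((s + t) * β) - ((‖u‖ ^ 2 : ℝ) : ℂ) * (((4 * s : ℝ) : ℂ) * μ)⁻¹) *
        Complex.exp (c ^ 2 * ‖u‖ ^ 2 / (4 * b)) := by
    rw [← Complex.exp_add]
    congr 1
    rw [hb, hc]
    push_cast
    field_simp
    ring
  rw [hexp]
  ring

/-- The normalization cancels the Gaussian integral, leaving only the damping. The mass tends to 1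
as t ↓ 0, which drives strong continuity. -/
theorem integrable_scalarKernel (hμ : 0 < μ.re) {t : ℝ} (ht : 0 < t) :
    Integrable (fun ψ : EuclideanSpace ℝ (Fin d) => scalarKernel μ β t ψ) ∧
      ∫ ψ : EuclideanSpace ℝ (Fin d), scalarKernel μ β t ψ = Complex.exp (-(t * β)) := by
  have hμ0 : μ ≠ 0 := fun h => by simp [h] at hμ
  have ht' : (t : ℂ) ≠ 0 := by exact_mod_cast ht.ne'
  set b : ℂ := ((1 / (4 * t) : ℝ) : ℂ) * μ⁻¹ with hb
  have hbre : 0 < b.re := re_inv_pos hμ (by positivity)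
  have e : ∀ ψ : EuclideanSpace ℝ (Fin d), scalarKernel μ β t ψ =
      (((4 * Real.pi * t : ℝ) : ℂ) * μ) ^ (-(d : ℂ) / 2) * Complex.exp (-(t * β)) *
        Complex.exp (-b * ‖ψ‖ ^ 2) := fun ψ => by
    rw [scalarKernel, mul_assoc _ (Complex.exp _) (Complex.exp _), ← Complex.exp_add]
    congr 2
    rw [hb]
    push_cast
    field_simp
    ring
  simp_rw [e]
  constructor
  · refine Integrable.const_mul ?_ _
    simpa using GaussianFourier.integrable_cexp_neg_mul_sq_norm_add hbre 0
      (0 : EuclideanSpace ℝ (Fin d))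
  · rw [integral_const_mul, GaussianFourier.integral_cexp_neg_mul_sq_norm hbre,
      finrank_euclideanSpace_fin]
    have h1 : (Real.pi : ℂ) / b = ((4 * Real.pi * t : ℝ) : ℂ) * μ := by
      rw [hb]; push_cast; field_simp
    have h2 : (((4 * Real.pi * t : ℝ) : ℂ) * μ) ≠ 0 := by
      refine mul_ne_zero ?_ hμ0
      have := Real.pi_pos
      exact_mod_cast (by positivity : 4 * Real.pi * t ≠ 0)
    rw [h1, neg_div, Complex.cpow_neg]
    have := (Complex.cpow_ne_zero_iff (y := (d : ℂ) / 2)).2 (Or.inl h2)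
    field_simp

theorem norm_scalarKernel_le_const (hμ : 0 < μ.re) {t : ℝ} (ht : 0 < t)
    (ψ : EuclideanSpace ℝ (Fin d)) : ‖scalarKernel μ β t ψ‖ ≤
      ‖(((4 * Real.pi * t : ℝ) : ℂ) * μ) ^ (-(d : ℂ) / 2)‖ * Real.exp (-(t * β.re)) := by
  rw [scalarKernel, norm_mul, Complex.norm_exp]
  gcongr
  rw [Complex.sub_re, Complex.neg_re, Complex.re_ofReal_mul, Complex.re_ofReal_mul, mul_inv,
    ← Complex.ofReal_inv]
  have h1 := re_inv_pos hμ (r := (4 * t)⁻¹) (by positivity)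
  have h2 : 0 ≤ ‖ψ‖ ^ 2 * ((((4 * t)⁻¹ : ℝ) : ℂ) * μ⁻¹).re := by positivity
  linarith

theorem integrable_scalarKernel_mul (hμ : 0 < μ.re) {s t : ℝ} (hs : 0 < s) (ht : 0 < t)
    (z w : EuclideanSpace ℝ (Fin d)) :
    Integrable fun x => scalarKernel μ β s (z - x) * scalarKernel μ β t (x - w) :=
  ((integrable_scalarKernel hμ ht).1.comp_sub_right w).bdd_mul
    ((continuous_scalarKernel s).comp (by fun_prop)).aestronglyMeasurable
    (Eventually.of_forall fun x => norm_scalarKernel_le_const hμ hs (z - x))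

theorem hasLineDerivAt_scalarKernel (t : ℝ)
    {R : EuclideanSpace ℝ (Fin d) ≃ₗᵢ[ℝ] EuclideanSpace ℝ (Fin d)}
    (ξ x u : EuclideanSpace ℝ (Fin d)) :
    HasLineDerivAt ℝ (fun x => scalarKernel μ β t (R x - ξ))
      (-(((2 * inner ℝ (R x - ξ) (R u) : ℝ) : ℂ) * (((4 * t : ℝ) : ℂ) * μ)⁻¹) *
        scalarKernel μ β t (R x - ξ)) x u := by
  have h1 : HasLineDerivAt ℝ (fun x => ‖R x - ξ‖ ^ 2) (2 * inner ℝ (R x - ξ) (R u)) x u := by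
    have h2 : HasFDerivAt (fun x => R x - ξ) (R : EuclideanSpace ℝ (Fin d) →L[ℝ] EuclideanSpace ℝ (Fin d)) x :=
      (R : EuclideanSpace ℝ (Fin d) →L[ℝ] EuclideanSpace ℝ (Fin d)).hasFDerivAt.sub_const ξ
    have h3 := h2.norm_sq.hasLineDerivAt u
    refine h3.congr_deriv ?_
    simp [inner_sub_left]
  rw [HasLineDerivAt] at h1 ⊢
  have h4 := ((h1.ofReal_comp.mul_const (((4 * t : ℝ) : ℂ) * μ)⁻¹).const_sub (-(t * β))).cexp.const_mul
    ((((4 * Real.pi * t : ℝ) : ℂ) * μ) ^ (-(d : ℂ) / 2))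
  refine h4.congr_deriv ?_
  simp only [scalarKernel, zero_smul, add_zero]
  ring

/-- The prefactor is controlled by |μ| ≥ a_min and the Gaussian decay by Re μ⁻¹ = Re μ/|μ|² ≥
a₀/a_max². Normalizing the resulting real Gaussian of scale 4(a_max²/a₀)t leaves the factor
a₁^{d/2}. -/
theorem norm_scalarKernel_le {amin amax a0 b0 : ℝ} (hmin : 0 < amin) (ha0 : 0 < a0) (h1 : amin ≤ ‖μ‖)
    (h2 : ‖μ‖ ≤ amax) (h3 : a0 ≤ μ.re) (h4 : b0 ≤ β.re) {t : ℝ} (ht : 0 < t)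
    (ψ : EuclideanSpace ℝ (Fin d)) :
    ‖scalarKernel μ β t ψ‖ ≤ (amax ^ 2 / (amin * a0)) ^ ((d : ℝ) / 2) * Real.exp (-b0 * t) *
      ((Real.pi * (4 * (amax ^ 2 / a0) * t)) ^ (-(d : ℝ) / 2) *
        Real.exp (-‖ψ‖ ^ 2 / (4 * (amax ^ 2 / a0) * t))) := by
  have hpi := Real.pi_pos
  have hmax : 0 < amax := by linarith
  have hμn : 0 < ‖μ‖ := by linarith
  have e1 : ‖(((4 * Real.pi * t : ℝ) : ℂ) * μ) ^ (-(d : ℂ) / 2)‖ ≤ (4 * Real.pi * t * amin) ^ (-(d : ℝ) / 2) := by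
    -- The exponent is real, so the argument of μ does not contribute to the modulus of the power.
    rw [show (-(d : ℂ) / 2) = ((-(d : ℝ) / 2 : ℝ) : ℂ) by push_cast; rfl, Complex.norm_cpow_real, norm_mul,
      Complex.norm_real, Real.norm_of_nonneg (by positivity)]
    refine Real.rpow_le_rpow_of_nonpos (by positivity) (by gcongr) ?_
    have : (0 : ℝ) ≤ d := by positivity
    linarith
  have e2 : (4 * Real.pi * t * amin) ^ (-(d : ℝ) / 2) = (amax ^ 2 / (amin * a0)) ^ ((d : ℝ) / 2) *
      (Real.pi * (4 * (amax ^ 2 / a0) * t)) ^ (-(d : ℝ) / 2) := by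
    have : (amax ^ 2 / (amin * a0)) ^ ((d : ℝ) / 2) = ((amin * a0) / amax ^ 2) ^ (-(d : ℝ) / 2) := by
      rw [neg_div, Real.rpow_neg (by positivity), ← Real.inv_rpow (by positivity), inv_div]
    rw [this, ← Real.mul_rpow (by positivity) (by positivity)]
    congr 1
    field_simp
  have e3 : (-(t * β) - ((‖ψ‖ ^ 2 : ℝ) : ℂ) * (((4 * t : ℝ) : ℂ) * μ)⁻¹).re
      ≤ -b0 * t + -‖ψ‖ ^ 2 / (4 * (amax ^ 2 / a0) * t) := by
    rw [Complex.sub_re, Complex.neg_re, Complex.re_ofReal_mul, Complex.re_ofReal_mul, mul_inv,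
      ← Complex.ofReal_inv, Complex.re_ofReal_mul, Complex.inv_re, Complex.normSq_eq_norm_sq]
    have h5 : a0 / amax ^ 2 ≤ μ.re / ‖μ‖ ^ 2 := by
      have : 0 ≤ μ.re := by linarith
      gcongr
    have h6 : ‖ψ‖ ^ 2 * ((4 * t)⁻¹ * (a0 / amax ^ 2)) ≤ ‖ψ‖ ^ 2 * ((4 * t)⁻¹ * (μ.re / ‖μ‖ ^ 2)) := by
      gcongr
    have h7 : -‖ψ‖ ^ 2 / (4 * (amax ^ 2 / a0) * t) = -(‖ψ‖ ^ 2 * ((4 * t)⁻¹ * (a0 / amax ^ 2))) := by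
      field_simp
    rw [h7]
    have h8 := mul_le_mul_of_nonneg_left h4 ht.le
    linarith
  rw [scalarKernel, norm_mul, Complex.norm_exp]
  calc _ ≤ (4 * Real.pi * t * amin) ^ (-(d : ℝ) / 2) *
        Real.exp (-b0 * t + -‖ψ‖ ^ 2 / (4 * (amax ^ 2 / a0) * t)) := by gcongr
    _ = _ := by rw [e2, Real.exp_add]; ring

end ScalarKernel

/-! ### Functions of diagonalizable matrices and spectral quantities -/

section Diagonalization
variable {N : ℕ} {Y : Matrix (Fin N) (Fin N) ℂ}

/-- The linear map `c ↦ Y diag(c) Y⁻¹`, with values in operators on the Euclidean space. -/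
noncomputable def diagOp (Y : Matrix (Fin N) (Fin N) ℂ) :
    (Fin N → ℂ) →L[ℂ] (EuclideanSpace ℂ (Fin N) →L[ℂ] EuclideanSpace ℂ (Fin N)) :=
  LinearMap.toContinuousLinearMap
    { toFun := fun c => Matrix.toEuclideanCLM (n := Fin N) (𝕜 := ℂ) (Y * Matrix.diagonal c * Y⁻¹)
      map_add' := fun c c' => by
        rw [show Matrix.diagonal (c + c') = _ from (Matrix.diagonal_add c c').symm, Matrix.mul_add, Matrix.add_mul, map_add]
      map_smul' := fun a c => by
        rw [Matrix.diagonal_smul, Matrix.mul_smul, Matrix.smul_mul, map_smul, RingHom.id_apply] }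

theorem diagOp_apply (c : Fin N → ℂ) : diagOp Y c =
    Matrix.toEuclideanCLM (n := Fin N) (𝕜 := ℂ) (Y * Matrix.diagonal c * Y⁻¹) := rfl

theorem inv_mul_of_isUnit (hY : IsUnit Y) : Y⁻¹ * Y = 1 :=
  Matrix.nonsing_inv_mul _ ((Matrix.isUnit_iff_isUnit_det _).1 hY)

theorem mul_inv_of_isUnit (hY : IsUnit Y) : Y * Y⁻¹ = 1 :=
  Matrix.mul_nonsing_inv _ ((Matrix.isUnit_iff_isUnit_det _).1 hY)

theorem conj_diagonal_mul (hY : IsUnit Y) (c c' : Fin N → ℂ) :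
    (Y * Matrix.diagonal c * Y⁻¹) * (Y * Matrix.diagonal c' * Y⁻¹)
      = Y * Matrix.diagonal (c * c') * Y⁻¹ := by
  calc _ = Y * Matrix.diagonal c * (Y⁻¹ * Y) * Matrix.diagonal c' * Y⁻¹ := by
        simp only [Matrix.mul_assoc]
    _ = _ := by
        rw [inv_mul_of_isUnit hY, Matrix.mul_one, Matrix.mul_assoc Y, Matrix.diagonal_mul_diagonal]
        rfl

theorem diagOp_mul (hY : IsUnit Y) (c c' : Fin N → ℂ) :
    diagOp Y (c * c') = diagOp Y c ∘L diagOp Y c' := by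
  rw [diagOp_apply, diagOp_apply, diagOp_apply, ← conj_diagonal_mul hY, map_mul]
  rfl

theorem diagOp_one (hY : IsUnit Y) : diagOp Y 1 = 1 := by
  have : Matrix.diagonal (1 : Fin N → ℂ) = 1 := Matrix.diagonal_one
  rw [diagOp_apply, this, Matrix.mul_one, mul_inv_of_isUnit hY, map_one]

-- The spectral norm of a diagonal matrix is the maximum modulus of its entries; conjugation by Y
-- costs |Y||Y⁻¹|. This is the only source of the factor κ.
open scoped Matrix.Norms.L2Operator in
theorem norm_diagOp_le {c : Fin N → ℂ} {C : ℝ} (hC : 0 ≤ C) (h : ∀ k, ‖c k‖ ≤ C) :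
    ‖diagOp Y c‖ ≤ condNumber Y * C := by
  have h1 : ‖Matrix.toEuclideanCLM (n := Fin N) (𝕜 := ℂ) (Matrix.diagonal c)‖ ≤ C := by
    have h2 : ‖Matrix.diagonal c‖ = ‖c‖ := Matrix.l2_opNorm_diagonal c
    rw [Matrix.l2_opNorm_def] at h2
    exact h2.le.trans ((pi_norm_le_iff_of_nonneg hC).2 h)
  rw [diagOp_apply, map_mul, map_mul, condNumber, matSpectralNorm, matSpectralNorm]
  refine (norm_mul_le _ _).trans ?_
  calc _ ≤ ‖Matrix.toEuclideanCLM (n := Fin N) (𝕜 := ℂ) Y‖ * C *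
        ‖Matrix.toEuclideanCLM (n := Fin N) (𝕜 := ℂ) Y⁻¹‖ := by
        gcongr
        exact (norm_mul_le _ _).trans (by gcongr)
    _ = _ := by ring

theorem condNumber_nonneg (Y : Matrix (Fin N) (Fin N) ℂ) : 0 ≤ condNumber Y :=
  mul_nonneg (norm_nonneg _) (norm_nonneg _)

variable {M : Matrix (Fin N) (Fin N) ℂ}

theorem eq_conj_diagonal (hY : IsUnit Y) (hM : (Y⁻¹ * M * Y).IsDiag) :
    M = Y * Matrix.diagonal (fun k => (Y⁻¹ * M * Y) k k) * Y⁻¹ := by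
  have h : Matrix.diagonal (fun k => (Y⁻¹ * M * Y) k k) = Y⁻¹ * M * Y := hM.diagonal_diag
  rw [h]
  calc M = (Y * Y⁻¹) * M * (Y * Y⁻¹) := by rw [mul_inv_of_isUnit hY]; simp
    _ = _ := by simp only [Matrix.mul_assoc]

theorem spectrum_conj_diagonal (hY : IsUnit Y) (c : Fin N → ℂ) :
    spectrum ℂ (Y * Matrix.diagonal c * Y⁻¹) = Set.range c := by
  obtain ⟨u, rfl⟩ := hY
  rw [← Matrix.coe_units_inv, spectrum.units_conjugate, spectrum_diagonal]

theorem le_specRadius {c : Fin N → ℂ} (h : spectrum ℂ M = Set.range c) (k : Fin N) :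
    ‖c k‖ ≤ specRadius M := by
  have h1 : spectralRadius ℂ M = ⨆ k, (‖c k‖₊ : ℝ≥0∞) := by
    rw [spectralRadius, h, iSup_range]
  have h2 : spectralRadius ℂ M ≠ ⊤ := by
    rw [h1]
    refine ne_top_of_le_ne_top (ENNReal.sum_ne_top.2 fun k _ => ENNReal.coe_ne_top) 
      (b := ∑ k, (‖c k‖₊ : ℝ≥0∞)) (iSup_le fun k => ?_)
    exact Finset.single_le_sum (f := fun k => (‖c k‖₊ : ℝ≥0∞)) (fun _ _ => zero_le) (Finset.mem_univ k)
  have h3 : (‖c k‖₊ : ℝ≥0∞) ≤ spectralRadius ℂ M := by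
    rw [h1]
    exact le_iSup (fun k => (‖c k‖₊ : ℝ≥0∞)) k
  exact ENNReal.toReal_mono h2 h3

theorem lowerAbscissa_le {c : Fin N → ℂ} (h : spectrum ℂ M = Set.range c) (k : Fin N) :
    lowerAbscissa M ≤ (c k).re := by
  rw [lowerAbscissa, specAbscissa, ← spectrum.neg_eq, h, neg_le]
  refine le_csSup ?_ ⟨-c k, by simp, by simp⟩
  exact (((Set.finite_range c).neg).image _).bddAbove

/-- The spectrum is finite and nonempty, so the spectral abscissa is attained and the strict
inequality survives. -/
theorem lowerAbscissa_pos {c : Fin N → ℂ} (hN : 1 ≤ N) (h : spectrum ℂ M = Set.range c)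
    (hc : ∀ k, 0 < (c k).re) : 0 < lowerAbscissa M := by
  rw [lowerAbscissa, specAbscissa, ← spectrum.neg_eq, h]
  have hne : (Complex.re '' (-Set.range c)).Nonempty := ⟨_, -c ⟨0, hN⟩, by simp, rfl⟩
  obtain ⟨z, hz, e⟩ := hne.csSup_mem (((Set.finite_range c).neg).image _)
  obtain ⟨k, hk⟩ := hz
  rw [← e]
  have := hc k
  rw [hk] at this
  simpa using this

end Diagonalization

/-! ### The matrix heat kernel -/

/-- The properties of a matrix-valued heat kernel on which the semigroup theory rests: Gaussian
bounds for the kernel `K t ψ` and its directional derivative `K' t ψ u`, the convolution law, and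
concentration as `t ↓ 0`. -/
structure IsHeatKernel {d N : ℕ} (S : Matrix (Fin d) (Fin d) ℝ)
    (K : ℝ → EuclideanSpace ℝ (Fin d) → EuclideanSpace ℂ (Fin N) →L[ℂ] EuclideanSpace ℂ (Fin N))
    (K' : ℝ → EuclideanSpace ℝ (Fin d) → EuclideanSpace ℝ (Fin d) →
      EuclideanSpace ℂ (Fin N) →L[ℂ] EuclideanSpace ℂ (Fin N)) (c b s₀ a : ℝ) : Prop where
  dim_pos : 1 ≤ d
  skew : S.transpose = -S
  const_nonneg : 0 ≤ c
  scale_pos : 0 < s₀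
  a_pos : 0 < a
  meas : StronglyMeasurable fun q : ℝ × EuclideanSpace ℝ (Fin d) => K q.1 q.2
  meas' : StronglyMeasurable fun q : ℝ × EuclideanSpace ℝ (Fin d) × EuclideanSpace ℝ (Fin d) =>
    K' q.1 q.2.1 q.2.2
  cont : ∀ t, Continuous (K t)
  cont' : ∀ t u, Continuous fun ψ => K' t ψ u
  bound : ∀ t > 0, ∀ ψ, ‖K t ψ‖ₑ ≤ ENNReal.ofReal (c * Real.exp (-b * t)) * gaussDensity (s₀ * t) ψ
  bound' : ∀ t > 0, ∀ ψ u, ‖K' t ψ u‖ₑ ≤ ENNReal.ofReal (c * Real.exp (-b * t)) *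
    (gaussDensity (s₀ * t) ψ * ENNReal.ofReal (|inner ℝ ψ u| / (2 * t * a)))
  conv : ∀ s > 0, ∀ t > 0, ∀ z ξ, ∫ ζ, K s (z - ζ) ∘L K t (expRotation S t ζ - ξ)
    = K (s + t) (expRotation S t z - ξ)
  tendsto : Tendsto (fun t => ∫ ψ, K t ψ) (𝓝[>] 0) (𝓝 1)
  lineDeriv : ∀ t ξ x u, HasLineDerivAt ℝ (fun x => K t (expRotation S t x - ξ))
    (K' t (expRotation S t x - ξ) (expRotation S t u)) x u

section MatrixKernel
variable {d N : ℕ} {Y A B : Matrix (Fin N) (Fin N) ℂ}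

/-- The heat kernel `H` as a function of `t` and `ψ = e^{tS}x - ξ`. -/
noncomputable def kernelOp (Y A B : Matrix (Fin N) (Fin N) ℂ) (t : ℝ) (ψ : EuclideanSpace ℝ (Fin d)) :
    EuclideanSpace ℂ (Fin N) →L[ℂ] EuclideanSpace ℂ (Fin N) :=
  diagOp Y fun k => scalarKernel ((Y⁻¹ * A * Y) k k) ((Y⁻¹ * B * Y) k k) t ψ

/-- The derivative of `kernelOp` in the direction `u`. -/
noncomputable def kernelOpDeriv (Y A B : Matrix (Fin N) (Fin N) ℂ) (t : ℝ)
    (ψ u : EuclideanSpace ℝ (Fin d)) : EuclideanSpace ℂ (Fin N) →L[ℂ] EuclideanSpace ℂ (Fin N) :=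
  diagOp Y fun k => -(((2 * inner ℝ ψ u : ℝ) : ℂ) * (((4 * t : ℝ) : ℂ) * (Y⁻¹ * A * Y) k k)⁻¹) *
    scalarKernel ((Y⁻¹ * A * Y) k k) ((Y⁻¹ * B * Y) k k) t ψ

theorem spectrum_eq_range (hY : SimultaneouslyDiagonalizes Y A B) :
    spectrum ℂ A = Set.range (fun k => (Y⁻¹ * A * Y) k k) ∧
    spectrum ℂ B = Set.range (fun k => (Y⁻¹ * B * Y) k k) :=
  ⟨by conv_lhs => rw [eq_conj_diagonal hY.1 hY.2.1, spectrum_conj_diagonal hY.1],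
    by conv_lhs => rw [eq_conj_diagonal hY.1 hY.2.2, spectrum_conj_diagonal hY.1]⟩

/-- Power, inverse and exponential all act entrywise in the common eigenbasis, so the kernel is Y
diag(·) Y⁻¹ with scalar kernels on the diagonal. -/
theorem toEuclideanCLM_heatKernel (hY : SimultaneouslyDiagonalizes Y A B)
    (hA : ∀ μ ∈ spectrum ℂ A, 0 < μ.re) (S : Matrix (Fin d) (Fin d) ℝ)
    (x ξ : EuclideanSpace ℝ (Fin d)) {t : ℝ} (ht : 0 < t) :
    Matrix.toEuclideanCLM (n := Fin N) (𝕜 := ℂ) (heatKernel Y A B S x ξ t)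
      = kernelOp Y A B t (expRotation S t x - ξ) := by
  set α : Fin N → ℂ := fun k => (Y⁻¹ * A * Y) k k with hα
  set β : Fin N → ℂ := fun k => (Y⁻¹ * B * Y) k k with hβ
  have hAe : A = Y * Matrix.diagonal α * Y⁻¹ := eq_conj_diagonal hY.1 hY.2.1
  have hBe : B = Y * Matrix.diagonal β * Y⁻¹ := eq_conj_diagonal hY.1 hY.2.2
  have hα0 : ∀ k, α k ≠ 0 := fun k h => by
    have := hA (α k) (by rw [(spectrum_eq_range hY).1]; exact ⟨k, rfl⟩)
    simp [h] at this
  set r := ‖expRotation S t x - ξ‖ with hr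
  have h1 : matFun Y (((4 * Real.pi * t : ℝ) : ℂ) • A) (fun z => z ^ (-(d : ℂ) / 2))
      = Y * Matrix.diagonal (fun k => (((4 * Real.pi * t : ℝ) : ℂ) * α k) ^ (-(d : ℂ) / 2)) * Y⁻¹ := by
    rw [matFun, Matrix.mul_smul, Matrix.smul_mul]
    rfl
  have hsm : ∀ (a : ℂ) (c : Fin N → ℂ), a • (Y * Matrix.diagonal c * Y⁻¹)
      = Y * Matrix.diagonal (a • c) * Y⁻¹ := fun a c => by
    rw [Matrix.diagonal_smul, Matrix.mul_smul, Matrix.smul_mul]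
  have h2 : (((4 * t : ℝ) : ℂ) • A)⁻¹ = Y * Matrix.diagonal (fun k => (((4 * t : ℝ) : ℂ) * α k)⁻¹) * Y⁻¹ := by
    refine Matrix.inv_eq_right_inv ?_
    rw [hAe, hsm, conj_diagonal_mul hY.1]
    have : (((4 * t : ℝ) : ℂ) • α * fun k => (((4 * t : ℝ) : ℂ) * α k)⁻¹) = 1 := by
      ext k
      have h4 : ((4 * t : ℝ) : ℂ) ≠ 0 := by exact_mod_cast (by positivity : 4 * t ≠ 0)
      simp only [Pi.mul_apply, Pi.smul_apply, smul_eq_mul, Pi.one_apply]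
      exact mul_inv_cancel₀ (mul_ne_zero h4 (hα0 k))
    have h5 : Matrix.diagonal (1 : Fin N → ℂ) = 1 := Matrix.diagonal_one
    rw [this, h5, Matrix.mul_one, mul_inv_of_isUnit hY.1]
  have h3 : -((t : ℂ) • B) - ((r ^ 2 : ℝ) : ℂ) • (((4 * t : ℝ) : ℂ) • A)⁻¹
      = Y * Matrix.diagonal (fun k => -(t * β k) - ((r ^ 2 : ℝ) : ℂ) * (((4 * t : ℝ) : ℂ) * α k)⁻¹) * Y⁻¹ := by
    rw [h2, hBe, hsm, hsm, ← Matrix.neg_mul, ← Matrix.mul_neg, ← Matrix.sub_mul, ← Matrix.mul_sub,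
      show -Matrix.diagonal ((t : ℂ) • β) = _ from Matrix.diagonal_neg _, Matrix.diagonal_sub]
    rfl
  rw [heatKernel, h1, h3, Matrix.exp_conj _ _ hY.1, Matrix.exp_diagonal, conj_diagonal_mul hY.1,
    kernelOp, diagOp_apply]
  congr 4
  ext k
  simp only [Pi.mul_apply, scalarKernel, ← hr]
  rw [Pi.coe_exp, ← Complex.exp_eq_exp_ℂ]

/-- The spectrum of A⁻¹ consists of the reciprocals of the eigenvalues, so ρ(A⁻¹) dominates every
1/|μ|. -/
theorem aMin_bounds (hN : 1 ≤ N) (hY : SimultaneouslyDiagonalizes Y A B)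
    (hA : ∀ μ ∈ spectrum ℂ A, 0 < μ.re) : 0 < aMin A ∧ ∀ k, aMin A ≤ ‖(Y⁻¹ * A * Y) k k‖ := by
  set α : Fin N → ℂ := fun k => (Y⁻¹ * A * Y) k k with hα
  have hAe : A = Y * Matrix.diagonal α * Y⁻¹ := eq_conj_diagonal hY.1 hY.2.1
  have hα0 : ∀ k, α k ≠ 0 := fun k h => by
    have := hA (α k) (by rw [(spectrum_eq_range hY).1]; exact ⟨k, rfl⟩)
    simp [h] at this
  have h2 : A⁻¹ = Y * Matrix.diagonal α⁻¹ * Y⁻¹ := by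
    refine Matrix.inv_eq_right_inv ?_
    rw [hAe, conj_diagonal_mul hY.1]
    have : α * α⁻¹ = 1 := by
      ext k
      exact mul_inv_cancel₀ (hα0 k)
    have h5 : Matrix.diagonal (1 : Fin N → ℂ) = 1 := Matrix.diagonal_one
    rw [this, h5, Matrix.mul_one, mul_inv_of_isUnit hY.1]
  have h3 : spectrum ℂ A⁻¹ = Set.range α⁻¹ := by rw [h2, spectrum_conj_diagonal hY.1]
  have h4 : ∀ k, ‖α k‖⁻¹ ≤ specRadius A⁻¹ := fun k => by
    have := le_specRadius h3 k
    simpa using this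
  have h5 : 0 < specRadius A⁻¹ := by
    have := norm_pos_iff.2 (hα0 ⟨0, hN⟩)
    exact (inv_pos.2 this).trans_le (h4 _)
  refine ⟨inv_pos.2 h5, fun k => ?_⟩
  have := norm_pos_iff.2 (hα0 k)
  exact inv_le_of_inv_le₀ this (h4 k)

/-- The kernel depends on its space variable through the norm only, and |e^{tS}ζ - ξ| = |ζ -
e^{-tS}ξ|. The rotation thus moves onto the fixed point ξ and the scalar convolution law applies
entrywise. -/
theorem kernelOp_conv (hY : IsUnit Y) (hα : ∀ k, 0 < ((Y⁻¹ * A * Y) k k).re)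
    {S : Matrix (Fin d) (Fin d) ℝ} (hS : S.transpose = -S) {s t : ℝ} (hs : 0 < s) (ht : 0 < t)
    (z ξ : EuclideanSpace ℝ (Fin d)) :
    ∫ ζ, kernelOp Y A B s (z - ζ) ∘L kernelOp Y A B t (expRotation S t ζ - ξ)
      = kernelOp Y A B (s + t) (expRotation S t z - ξ) := by
  have e : ∀ ζ : EuclideanSpace ℝ (Fin d), ‖expRotation S t ζ - ξ‖ = ‖ζ - (rotIso hS t).symm ξ‖ :=
    fun ζ => by
      rw [← (rotIso hS t).norm_map (ζ - _), map_sub, LinearIsometryEquiv.apply_symm_apply]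
      rfl
  have e' : ∀ (s : ℝ) (ζ : EuclideanSpace ℝ (Fin d)), kernelOp Y A B s (expRotation S t ζ - ξ)
      = kernelOp Y A B s (ζ - (rotIso hS t).symm ξ) := fun s ζ => by
    simp only [kernelOp, scalarKernel, e]
  have hi : ∀ k, Integrable fun ζ => ((fun k => scalarKernel ((Y⁻¹ * A * Y) k k) ((Y⁻¹ * B * Y) k k) s
      (z - ζ)) * fun k => scalarKernel ((Y⁻¹ * A * Y) k k) ((Y⁻¹ * B * Y) k k) t
        (ζ - (rotIso hS t).symm ξ)) k := fun k => integrable_scalarKernel_mul (hα k) hs ht z _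
  simp_rw [e', kernelOp, ← diagOp_mul hY]
  rw [ContinuousLinearMap.integral_comp_comm _ (Integrable.of_eval hi)]
  congr 1
  ext k
  rw [eval_integral hi]
  exact scalarKernel_conv (hα k) hs ht z _

theorem tendsto_integral_kernelOp (hY : IsUnit Y) (hα : ∀ k, 0 < ((Y⁻¹ * A * Y) k k).re) :
    Tendsto (fun t => ∫ ψ : EuclideanSpace ℝ (Fin d), kernelOp Y A B t ψ) (𝓝[>] 0) (𝓝 1) := by
  have : ∀ᶠ t : ℝ in 𝓝[>] (0 : ℝ), diagOp Y (fun k => Complex.exp (-((t : ℂ) * (Y⁻¹ * B * Y) k k)))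
      = ∫ ψ : EuclideanSpace ℝ (Fin d), kernelOp Y A B t ψ := by
    filter_upwards [self_mem_nhdsWithin] with t ht
    have hi : ∀ k, Integrable (fun ψ : EuclideanSpace ℝ (Fin d) => scalarKernel ((Y⁻¹ * A * Y) k k) ((Y⁻¹ * B * Y) k k) t ψ) :=
      fun k => (integrable_scalarKernel (hα k) ht).1
    simp_rw [kernelOp]
    rw [ContinuousLinearMap.integral_comp_comm _ (Integrable.of_eval hi)]
    congr 1
    ext k
    rw [eval_integral hi]
    exact (integrable_scalarKernel (hα k) ht).2.symm
  refine Tendsto.congr' this ?_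
  rw [← diagOp_one hY]
  refine ((diagOp Y).continuous.tendsto _).comp (tendsto_pi_nhds.2 fun k => ?_)
  have : Continuous fun t : ℝ => Complex.exp (-(t * (Y⁻¹ * B * Y) k k)) := by fun_prop
  refine (this.tendsto' 0 _ ?_).mono_left nhdsWithin_le_nhds
  simp

theorem hasLineDerivAt_kernelOp {S : Matrix (Fin d) (Fin d) ℝ} (hS : S.transpose = -S) (t : ℝ)
    (ξ x u : EuclideanSpace ℝ (Fin d)) :
    HasLineDerivAt ℝ (fun x => kernelOp Y A B t (expRotation S t x - ξ))
      (kernelOpDeriv Y A B t (expRotation S t x - ξ) (expRotation S t u)) x u := by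
  have h := hasDerivAt_pi.2 fun k => hasLineDerivAt_scalarKernel (μ := (Y⁻¹ * A * Y) k k)
    (β := (Y⁻¹ * B * Y) k k) t (R := rotIso hS t) ξ x u
  have h3 : HasFDerivAt (fun c : Fin N → ℂ => diagOp Y c) ((diagOp Y).restrictScalars ℝ)
      ((fun (s : ℝ) (k : Fin N) => scalarKernel ((Y⁻¹ * A * Y) k k) ((Y⁻¹ * B * Y) k k) t
        (rotIso hS t (x + s • u) - ξ)) 0) :=
    ((diagOp Y).restrictScalars ℝ).hasFDerivAt
  exact h3.comp_hasDerivAt (0 : ℝ) h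

theorem measurable_kernelOpDeriv_aux (μ β : ℂ) :
    Measurable fun q : ℝ × EuclideanSpace ℝ (Fin d) × EuclideanSpace ℝ (Fin d) =>
      -(((2 * inner ℝ q.2.1 q.2.2 : ℝ) : ℂ) * (((4 * q.1 : ℝ) : ℂ) * μ)⁻¹) *
        scalarKernel μ β q.1 q.2.1 := by
  have h3 : Measurable fun q : ℝ × EuclideanSpace ℝ (Fin d) × EuclideanSpace ℝ (Fin d) =>
      (q.1, q.2.1) := by fun_prop
  have h1 := (measurable_scalarKernel (d := d) (μ := μ) (β := β)).comp h3
  have h2 : Measurable fun q : ℝ × EuclideanSpace ℝ (Fin d) × EuclideanSpace ℝ (Fin d) =>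
      -(((2 * inner ℝ q.2.1 q.2.2 : ℝ) : ℂ) * (((4 * q.1 : ℝ) : ℂ) * μ)⁻¹) := by fun_prop
  exact h2.mul h1

set_option maxHeartbeats 800000 in
theorem isHeatKernel_kernelOp (hd : 1 ≤ d) (hN : 1 ≤ N) {S : Matrix (Fin d) (Fin d) ℝ}
    (hY : SimultaneouslyDiagonalizes Y A B) (hA : ∀ μ ∈ spectrum ℂ A, 0 < μ.re)
    (hS : S.transpose = -S) :
    IsHeatKernel S (kernelOp Y A B) (kernelOpDeriv Y A B) (condNumber Y * a1 A ^ ((d : ℝ) / 2))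
      (lowerAbscissa B) (4 * (aMax A ^ 2 / lowerAbscissa A)) (aMin A) := by
  set α : Fin N → ℂ := fun k => (Y⁻¹ * A * Y) k k with hα
  set β : Fin N → ℂ := fun k => (Y⁻¹ * B * Y) k k with hβ
  obtain ⟨hsA, hsB⟩ := spectrum_eq_range hY
  have hαre : ∀ k, 0 < (α k).re := fun k => hA (α k) (by rw [hsA]; exact ⟨k, rfl⟩)
  obtain ⟨hmin, hmin'⟩ := aMin_bounds hN hY hA
  have ha0 := lowerAbscissa_pos hN hsA hαre
  have ha0' := lowerAbscissa_le hsA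
  have hb0' := lowerAbscissa_le hsB
  have hmax := le_specRadius hsA
  have hmax0 : 0 < aMax A := (hmin.trans_le (hmin' ⟨0, hN⟩)).trans_le (hmax ⟨0, hN⟩)
  have ha1 : 0 < a1 A := by rw [a1]; positivity
  have hbd : ∀ t > 0, ∀ (ψ : EuclideanSpace ℝ (Fin d)) k, ‖scalarKernel (α k) (β k) t ψ‖ ≤
      a1 A ^ ((d : ℝ) / 2) * Real.exp (-lowerAbscissa B * t) *
      ((Real.pi * (4 * (aMax A ^ 2 / lowerAbscissa A) * t)) ^ (-(d : ℝ) / 2) *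
        Real.exp (-‖ψ‖ ^ 2 / (4 * (aMax A ^ 2 / lowerAbscissa A) * t))) := fun t ht ψ k =>
    norm_scalarKernel_le hmin ha0 (hmin' k) (hmax k) (ha0' k) (hb0' k) ht ψ
  have hκ := condNumber_nonneg Y
  have hpi := Real.pi_pos
  refine
    { dim_pos := hd
      skew := hS
      const_nonneg := by positivity
      scale_pos := by positivity
      a_pos := hmin
      meas := ?_
      meas' := ?_
      cont := fun t => ?_
      cont' := fun t u => ?_
      bound := fun t ht ψ => ?_
      bound' := fun t ht ψ u => ?_
      conv := fun s hs t ht z ξ => ?_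
      tendsto := ?_
      lineDeriv := fun t ξ x u => ?_ }
  · refine (diagOp Y).continuous.comp_stronglyMeasurable (Measurable.stronglyMeasurable ?_)
    exact measurable_pi_lambda _ fun k => measurable_scalarKernel
  · refine (diagOp Y).continuous.comp_stronglyMeasurable (Measurable.stronglyMeasurable ?_)
    exact measurable_pi_lambda _ fun k => measurable_kernelOpDeriv_aux _ _
  · exact (diagOp Y).continuous.comp (continuous_pi fun k => continuous_scalarKernel t)
  · refine (diagOp Y).continuous.comp (continuous_pi fun k => ?_)
    exact Continuous.mul (by fun_prop) (continuous_scalarKernel t)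
  · rw [gaussDensity, ← ENNReal.ofReal_mul (by positivity), ← ofReal_norm]
    refine ENNReal.ofReal_le_ofReal ?_
    refine (norm_diagOp_le (by positivity) (hbd t ht ψ)).trans (le_of_eq ?_)
    ring
  · rw [gaussDensity, ← ENNReal.ofReal_mul (by positivity), ← ENNReal.ofReal_mul (by positivity),
      ← ofReal_norm]
    refine ENNReal.ofReal_le_ofReal ?_
    -- The logarithmic derivative of each scalar kernel has modulus |⟨ψ, u⟩|/(2t|μ|), to which |μ| ≥
    -- a_min is applied.
    refine (norm_diagOp_le (C := |inner ℝ ψ u| / (2 * t * aMin A) *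
      (a1 A ^ ((d : ℝ) / 2) * Real.exp (-lowerAbscissa B * t) *
        ((Real.pi * (4 * (aMax A ^ 2 / lowerAbscissa A) * t)) ^ (-(d : ℝ) / 2) *
        Real.exp (-‖ψ‖ ^ 2 / (4 * (aMax A ^ 2 / lowerAbscissa A) * t))))) ?_ fun k => ?_).trans
      (le_of_eq ?_)
    · positivity
    · rw [norm_mul]
      refine mul_le_mul ?_ (hbd t ht ψ k) (norm_nonneg _) (by positivity)
      have h1 := hmin' k
      have h2 : 0 < ‖α k‖ := hmin.trans_le h1
      rw [norm_neg, norm_mul, norm_inv, norm_mul, Complex.norm_real, Complex.norm_real, norm_mul,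
        Real.norm_of_nonneg (by positivity : 0 ≤ 4 * t), Real.norm_eq_abs (inner ℝ ψ u),
        Real.norm_of_nonneg (by norm_num : (0 : ℝ) ≤ 2)]
      calc 2 * |inner ℝ ψ u| * (4 * t * ‖α k‖)⁻¹ = |inner ℝ ψ u| / (2 * t * ‖α k‖) := by
            field_simp
            ring
        _ ≤ _ := by gcongr
    · ring
  · exact kernelOp_conv hY.1 hαre hS hs ht z ξ
  · exact tendsto_integral_kernelOp hY.1 hαre
  · exact hasLineDerivAt_kernelOp hS t ξ x u

end MatrixKernel

/-! ### Gaussian averages and the resolvent majorant -/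

section GaussianAverages
variable {d N : ℕ} {S : Matrix (Fin d) (Fin d) ℝ} {θ : EuclideanSpace ℝ (Fin d) → ℝ} {p η Cθ s₀ : ℝ}

/-- The average of `G` over the rotated and Gaussian distributed points `e^{tS}x - √(s₀t) y`. -/
noncomputable def gaussAvg (S : Matrix (Fin d) (Fin d) ℝ) (s₀ t : ℝ)
    (G : EuclideanSpace ℝ (Fin d) → ℝ≥0∞) (x : EuclideanSpace ℝ (Fin d)) : ℝ≥0∞ :=
  ∫⁻ y, gaussDensity 1 y * G (expRotation S t x - √(s₀ * t) • y)

/-- The exponential moment `E exp(κ|y|)` of the Gaussian density. -/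
noncomputable def expMoment (d : ℕ) (κ : ℝ) : ℝ≥0∞ :=
  ∫⁻ y : EuclideanSpace ℝ (Fin d), gaussDensity 1 y * ENNReal.ofReal (Real.exp (κ * ‖y‖))

/-- Since κ|y| ≤ κ²/2 + |y|²/2, the integrand is dominated by a multiple of the Gaussian density of
scale 2. -/
theorem expMoment_lt_top (hd : 1 ≤ d) (κ : ℝ) : expMoment d κ < ⊤ := by
  have h2 : ∫⁻ y : EuclideanSpace ℝ (Fin d), gaussDensity 2 y = 1 := by
    have := lintegral_gaussDensity_mul (d := d) (s := 2) (by norm_num) fun _ => 1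
    simpa [lintegral_gaussDensity_one hd] using this
  have hpi := Real.pi_pos
  have hle : ∀ y : EuclideanSpace ℝ (Fin d), gaussDensity 1 y * ENNReal.ofReal (Real.exp (κ * ‖y‖)) ≤
      ENNReal.ofReal ((2 : ℝ) ^ ((d : ℝ) / 2) * Real.exp (κ ^ 2 / 2)) * gaussDensity 2 y := fun y => by
    rw [gaussDensity, gaussDensity, ← ENNReal.ofReal_mul (by positivity),
      ← ENNReal.ofReal_mul (by positivity)]
    refine ENNReal.ofReal_le_ofReal ?_
    have h3 : Real.exp (-‖y‖ ^ 2 / 1) * Real.exp (κ * ‖y‖) ≤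
        Real.exp (κ ^ 2 / 2) * Real.exp (-‖y‖ ^ 2 / 2) := by
      rw [← Real.exp_add, ← Real.exp_add]
      refine Real.exp_le_exp.2 ?_
      nlinarith [sq_nonneg (‖y‖ - κ)]
    have h4 : (2 : ℝ) ^ ((d : ℝ) / 2) * (Real.pi * 2) ^ (-(d : ℝ) / 2)
        = (Real.pi * 1) ^ (-(d : ℝ) / 2) := by
      rw [Real.mul_rpow hpi.le (by norm_num), mul_one, neg_div, Real.rpow_neg (by norm_num : (0 : ℝ) ≤ 2)]
      have : (0 : ℝ) < 2 ^ ((d : ℝ) / 2) := by positivity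
      field_simp
    calc _ = (Real.pi * 1) ^ (-(d : ℝ) / 2) * (Real.exp (-‖y‖ ^ 2 / 1) * Real.exp (κ * ‖y‖)) := by ring
      _ ≤ (Real.pi * 1) ^ (-(d : ℝ) / 2) * (Real.exp (κ ^ 2 / 2) * Real.exp (-‖y‖ ^ 2 / 2)) := by gcongr
      _ = _ := by rw [← h4]; ring
  refine (lintegral_mono hle).trans_lt ?_
  rw [lintegral_const_mul' _ _ ENNReal.ofReal_ne_top, h2, mul_one]
  exact ENNReal.ofReal_lt_top

@[fun_prop]
theorem Measurable.expRotation {α : Type*} [MeasurableSpace α] {f : α → ℝ}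
    {g : α → EuclideanSpace ℝ (Fin d)} (hf : Measurable f) (hg : Measurable g) :
    Measurable fun a => expRotation S (f a) (g a) := by
  have h := (continuous_expRotation (S := S)).measurable.comp (hf.prodMk hg)
  exact h

@[fun_prop]
theorem Measurable.gaussDensity {α : Type*} [MeasurableSpace α] {f : α → ℝ}
    {g : α → EuclideanSpace ℝ (Fin d)} (hf : Measurable f) (hg : Measurable g) :
    Measurable fun a => gaussDensity (f a) (g a) := by
  have h := (measurable_gaussDensity (d := d)).comp (hf.prodMk hg)
  exact h

@[fun_prop]
theorem Measurable.gaussAvg {α : Type*} [MeasurableSpace α] {f : α → ℝ}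
    {g : α → EuclideanSpace ℝ (Fin d)} (hf : Measurable f) (hg : Measurable g)
    {G : EuclideanSpace ℝ (Fin d) → ℝ≥0∞} (hG : Measurable G) :
    Measurable fun a => gaussAvg S s₀ (f a) G (g a) := by
  have h : Measurable fun q : α × EuclideanSpace ℝ (Fin d) =>
      _root_.gaussDensity 1 q.2 * G (OrnsteinUhlenbeck.expRotation S (f q.1) (g q.1) - √(s₀ * f q.1) • q.2) := by
    fun_prop
  exact h.lintegral_prod_right'

/-- The companion point e^{tS}x required by `wInt_schur`: it has the norm of x and differs from the
evaluation point only by the Gaussian shift. -/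
theorem rotation_shift_near (hS : S.transpose = -S) (t : ℝ) (x y : EuclideanSpace ℝ (Fin d)) :
    ∃ z, ‖z‖ = ‖x‖ ∧ ‖z - (expRotation S t x - √(s₀ * t) • y)‖ ≤ √(s₀ * t) * ‖y‖ := by
  refine ⟨expRotation S t x, norm_expRotation hS t x, ?_⟩
  rw [sub_sub_cancel, norm_smul, Real.norm_of_nonneg (Real.sqrt_nonneg _)]

theorem lintegral_prod_mul_left {α β : Type*} [MeasurableSpace α] [MeasurableSpace β] {μ : Measure α}
    {ν : Measure β} [SFinite ν] {a : α → ℝ≥0∞} (ha : Measurable a) {F : α → β → ℝ≥0∞}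
    (hF : Measurable fun q : α × β => F q.1 q.2) :
    ∫⁻ q, a q.1 * F q.1 q.2 ∂(μ.prod ν) = ∫⁻ x, a x * ∫⁻ y, F x y ∂ν ∂μ := by
  have hm : Measurable fun q : α × β => a q.1 * F q.1 q.2 := by fun_prop
  have hx : ∀ x, Measurable (F x) := fun x => hF.comp measurable_prodMk_left
  rw [lintegral_prod _ hm.aemeasurable]
  exact lintegral_congr fun x => lintegral_const_mul (μ := ν) (a x) (hx x)

/-- Weighted `L^p` bound for averages over time and the Gaussian variable. -/
theorem wInt_timeAvg_le (hθ : IsRadialWeight θ η Cθ) (hp : 1 ≤ p) (hS : S.transpose = -S)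
    {r w : ℝ → ℝ≥0∞} (hr : Measurable r) (hw : Measurable w) {n : ℝ → EuclideanSpace ℝ (Fin d) → ℝ≥0∞}
    (hn : Measurable fun q : ℝ × EuclideanSpace ℝ (Fin d) => n q.1 q.2)
    {G : EuclideanSpace ℝ (Fin d) → ℝ≥0∞} (hG : Measurable G) :
    wInt θ p (fun x => ∫⁻ t in Ioi 0, r t * (w t * ∫⁻ y, gaussDensity 1 y *
        (n t y * G (expRotation S t x - √(s₀ * t) • y)))) ≤
      ENNReal.ofReal Cθ ^ p * ((∫⁻ t in Ioi 0, r t * ∫⁻ y, gaussDensity 1 y * n t y) ^ (p - 1) *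
        ∫⁻ t in Ioi 0, r t * (w t ^ p * ∫⁻ y, gaussDensity 1 y *
          (n t y * ENNReal.ofReal (Real.exp (p * η * √(s₀ * t) * ‖y‖))))) * wInt θ p G := by
  let m : Measure (ℝ × EuclideanSpace ℝ (Fin d)) := (volume.restrict (Ioi 0)).prod volume
  have hγ : Measurable fun q : ℝ × EuclideanSpace ℝ (Fin d) => gaussDensity 1 q.2 := by fun_prop
  have hb : Measurable fun q : ℝ × EuclideanSpace ℝ (Fin d) => √(s₀ * q.1) * ‖q.2‖ := by fun_prop
  have hρ : Measurable fun q : ℝ × EuclideanSpace ℝ (Fin d) =>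
      r q.1 * (gaussDensity 1 q.2 * n q.1 q.2) := (hr.comp measurable_fst).mul (hγ.mul hn)
  have hW : Measurable fun q : ℝ × EuclideanSpace ℝ (Fin d) => w q.1 := hw.comp measurable_fst
  -- The product r·γ·n, with γ the Gaussian density, is the density whose mass carries the power p -
  -- 1, while w stays with the function and is raised to the power p. Distributing a time factor
  -- between r and w is thus a free choice that affects the bound.
  have key := wInt_schur (m := m) (τ := fun q x => expRotation S q.1 x - √(s₀ * q.1) • q.2) hθ hp
    (by fun_prop) (fun q => measurePreserving_expRotation_sub hS _ _) hb
    (fun q x => rotation_shift_near hS q.1 x q.2) hρ hW hG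
  have hτ : ∀ x, Measurable fun q : ℝ × EuclideanSpace ℝ (Fin d) =>
      expRotation S q.1 x - √(s₀ * q.1) • q.2 := fun x => by fun_prop
  have e1 : ∀ x, ∫⁻ t in Ioi 0, r t * (w t * ∫⁻ y, gaussDensity 1 y *
        (n t y * G (expRotation S t x - √(s₀ * t) • y)))
      = ∫⁻ q, r q.1 * (gaussDensity 1 q.2 * n q.1 q.2) *
        (w q.1 * G (expRotation S q.1 x - √(s₀ * q.1) • q.2)) ∂m := fun x => by
    have := lintegral_prod_mul_left (μ := volume.restrict (Ioi 0)) (ν := volume) (hr.mul hw)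
      (F := fun t y => gaussDensity 1 y * (n t y * G (expRotation S t x - √(s₀ * t) • y)))
      (hγ.mul (hn.mul (hG.comp (hτ x))))
    simp only [Pi.mul_apply, mul_assoc] at this
    rw [← this]
    refine lintegral_congr fun q => ?_
    ring
  have e2 : ∫⁻ q, r q.1 * (gaussDensity 1 q.2 * n q.1 q.2) ∂m
      = ∫⁻ t in Ioi 0, r t * ∫⁻ y, gaussDensity 1 y * n t y :=
    lintegral_prod_mul_left hr (F := fun t y => gaussDensity 1 y * n t y) (hγ.mul hn)
  have e3 : ∫⁻ q, r q.1 * (gaussDensity 1 q.2 * n q.1 q.2) * (w q.1 ^ p *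
        ENNReal.ofReal (Real.exp (p * η * (√(s₀ * q.1) * ‖q.2‖)))) ∂m
      = ∫⁻ t in Ioi 0, r t * (w t ^ p * ∫⁻ y, gaussDensity 1 y *
          (n t y * ENNReal.ofReal (Real.exp (p * η * √(s₀ * t) * ‖y‖)))) := by
    have hE : Measurable fun q : ℝ × EuclideanSpace ℝ (Fin d) =>
        ENNReal.ofReal (Real.exp (p * η * √(s₀ * q.1) * ‖q.2‖)) := by fun_prop
    have := lintegral_prod_mul_left (μ := volume.restrict (Ioi 0)) (ν := volume) (hr.mul (hw.pow_const p))
      (F := fun t y => gaussDensity 1 y *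
          (n t y * ENNReal.ofReal (Real.exp (p * η * √(s₀ * t) * ‖y‖)))) (hγ.mul (hn.mul hE))
    simp only [Pi.mul_apply, mul_assoc] at this ⊢
    rw [← this]
    refine lintegral_congr fun q => ?_
    ring
  rw [e2, e3] at key
  simp_rw [e1]
  exact key

/-- Weighted `L^p` bound for the Gaussian average at a fixed time. -/
theorem wInt_gaussAvg_le (hd : 1 ≤ d) (hθ : IsRadialWeight θ η Cθ) (hp : 1 ≤ p)
    (hS : S.transpose = -S) (t : ℝ) {G : EuclideanSpace ℝ (Fin d) → ℝ≥0∞} (hG : Measurable G) :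
    wInt θ p (gaussAvg S s₀ t G) ≤
      ENNReal.ofReal Cθ ^ p * expMoment d (p * η * √(s₀ * t)) * wInt θ p G := by
  have key := wInt_schur (m := (volume : Measure (EuclideanSpace ℝ (Fin d))))
    (τ := fun y x => expRotation S t x - √(s₀ * t) • y) (b := fun y => √(s₀ * t) * ‖y‖) hθ hp
    (by fun_prop)
    (fun q => measurePreserving_expRotation_sub hS _ _) (by fun_prop)
    (fun y x => rotation_shift_near hS t x y) (ρ := fun y => gaussDensity 1 y) (by fun_prop)
    (measurable_const (a := (1 : ℝ≥0∞))) hG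
  simp only [one_mul, ENNReal.one_rpow, lintegral_gaussDensity_one hd, ← mul_assoc (p * η)] at key
  exact key

/-- The majorant of the resolvent: the Laplace transform of Gaussian averages. -/
noncomputable def laplaceAvg (S : Matrix (Fin d) (Fin d) ℝ) (s₀ δ : ℝ)
    (G : EuclideanSpace ℝ (Fin d) → ℝ≥0∞) (x : EuclideanSpace ℝ (Fin d)) : ℝ≥0∞ :=
  ∫⁻ t in Ioi 0, ENNReal.ofReal (Real.exp (-(δ * t))) * gaussAvg S s₀ t G x

theorem measurable_laplaceAvg {G : EuclideanSpace ℝ (Fin d) → ℝ≥0∞} (hG : Measurable G) (δ : ℝ) :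
    Measurable (laplaceAvg S s₀ δ G) := by
  refine Measurable.lintegral_prod_left' (f := fun q : ℝ × EuclideanSpace ℝ (Fin d) =>
    ENNReal.ofReal (Real.exp (-(δ * q.1))) * gaussAvg S s₀ q.1 G q.2) ?_
  fun_prop

/-- Raising the rate allows pη'√(s₀t) to equal 2√(κt) exactly, the form in which the Laplace
integrals are evaluated. -/
theorem OrnsteinUhlenbeck.IsRadialWeight.mono_rate (hθ : IsRadialWeight θ η Cθ) {η' : ℝ} (h : η ≤ η') :
    IsRadialWeight θ η' Cθ where
  continuous := hθ.continuous
  rate_nonneg := hθ.rate_nonneg.trans h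
  const_pos := hθ.const_pos
  pos := hθ.pos
  growth x y := by
    refine (hθ.growth x y).trans ?_
    have := hθ.const_pos
    have := hθ.pos x
    gcongr
  radial := hθ.radial

theorem lintegral_exp_neg {δ : ℝ} (hδ : 0 < δ) :
    ∫⁻ t in Ioi (0 : ℝ), ENNReal.ofReal (Real.exp (-(δ * t))) = ENNReal.ofReal δ⁻¹ := by
  rw [← ofReal_integral_eq_lintegral_ofReal]
  · have := integral_exp_mul_Ioi (a := -δ) (by linarith) 0
    congr 1
    simp only [← neg_mul]
    rw [this]
    simp
  · have := integrableOn_exp_mul_Ioi (a := -δ) (by linarith) 0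
    simp only [neg_mul] at this
    exact this
  · exact Eventually.of_forall fun t => (Real.exp_pos _).le

/-- The resolvent majorant is bounded on `L^p_θ` when `δ` exceeds the growth rate. -/
theorem wInt_laplaceAvg_le (hd : 1 ≤ d) (hθ : IsRadialWeight θ η Cθ) (hp : 1 ≤ p) (hs₀ : 0 < s₀)
    (hS : S.transpose = -S) {δ : ℝ} (hδ : s₀ * η ^ 2 * p / 4 < δ) :
    ∃ C : ℝ≥0∞, C ≠ ⊤ ∧ ∀ G : EuclideanSpace ℝ (Fin d) → ℝ≥0∞, Measurable G →
      wInt θ p (laplaceAvg S s₀ δ G) ≤ C * wInt θ p G := by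
  have hp0 : 0 < p := by linarith
  have hη := hθ.rate_nonneg
  have hδ0 : 0 < δ := lt_of_le_of_lt (by positivity) hδ
  -- The exponent pη√(s₀t) equals 2√(κ₁t), and the hypothesis on δ says κ₁ < pδ. Splitting e^{-δt}
  -- into a density e^{-εt} and a factor e^{-(δ-ε)t} that is raised to the power p gives the decay
  -- rate δ' = pδ - (p-1)ε. With κ the midpoint and ε = (pδ - κ)/p one gets δ' = κ + ε > κ. Without
  -- the splitting the stronger condition κ₁ < δ would be needed: hence one factor p in ω against p²
  -- in the condition on η₂. The midpoint is positive even for η = 0.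
  set κ₁ := s₀ * η ^ 2 * p ^ 2 / 4 with hκ₁
  have hκ₁0 : 0 ≤ κ₁ := by positivity
  have hκ1lt : κ₁ < p * δ := by
    have := mul_lt_mul_of_pos_left hδ hp0
    rw [hκ₁]
    linarith
  set κ := (κ₁ + p * δ) / 2 with hκ
  have hκ0 : 0 < κ := by positivity
  have hκlt : κ < p * δ := by linarith
  set ε := (p * δ - κ) / p with hε
  have hε0 : 0 < ε := div_pos (by linarith) hp0
  have hpε : p * ε = p * δ - κ := by rw [hε]; field_simp
  set δ' := p * δ - (p - 1) * ε with hδ'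
  have hδ'κ : κ < δ' := by linarith
  have hδ'0 : 0 < δ' := hκ0.trans hδ'κ
  set η' := 2 * √(κ / (s₀ * p ^ 2)) with hη'
  have hηη' : η ≤ η' := by
    have : η / 2 ≤ √(κ / (s₀ * p ^ 2)) := by
      refine Real.le_sqrt_of_sq_le ?_
      rw [le_div_iff₀ (by positivity)]
      have : κ₁ ≤ κ := by linarith
      refine le_trans (le_of_eq ?_) this
      rw [hκ₁]
      ring
    linarith
  have hsq : ∀ t, 0 < t → p * η' * √(s₀ * t) = 2 * √(κ / δ' * δ' * t) := fun t ht => by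
    have e : κ / δ' * δ' * t = p ^ 2 * (κ / (s₀ * p ^ 2)) * (s₀ * t) := by field_simp
    have e' : √(p ^ 2 * (κ / (s₀ * p ^ 2)) * (s₀ * t)) = p * √(κ / (s₀ * p ^ 2)) * √(s₀ * t) := by
      rw [Real.sqrt_mul (by positivity), Real.sqrt_mul (by positivity), Real.sqrt_sq hp0.le]
    rw [e, e', hη']
    ring
  have key := fun (G : EuclideanSpace ℝ (Fin d) → ℝ≥0∞) (hG : Measurable G) =>
    wInt_timeAvg_le (s₀ := s₀) (hθ.mono_rate hηη') hp hS
      (r := fun t => ENNReal.ofReal (Real.exp (-(ε * t))))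
      (w := fun t => ENNReal.ofReal (Real.exp (-((δ - ε) * t)))) (by fun_prop) (by fun_prop)
      (n := fun _ _ => 1) measurable_const hG
  simp only [one_mul, mul_one, lintegral_gaussDensity_one hd, lintegral_exp_neg hε0] at key
  have e1 : ∀ t, ENNReal.ofReal (Real.exp (-(ε * t))) * (ENNReal.ofReal (Real.exp (-((δ - ε) * t))) ^ p *
      expMoment d (p * η' * √(s₀ * t))) = ENNReal.ofReal (Real.exp (-(δ' * t))) *
      expMoment d (p * η' * √(s₀ * t)) := fun t => by
    rw [← mul_assoc, ENNReal.ofReal_rpow_of_pos (Real.exp_pos _), ← ENNReal.ofReal_mul (by positivity),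
      ← Real.exp_mul, ← Real.exp_add]
    congr 3
    rw [hδ']
    ring
  have e2 : ∫⁻ t in Ioi (0 : ℝ), ENNReal.ofReal (Real.exp (-(δ' * t))) *
      expMoment d (p * η' * √(s₀ * t)) ≠ ⊤ := by
    have := laplace_gauss_value hd hδ'0 (div_pos hκ0 hδ'0) ((div_lt_one hδ'0).2 hδ'κ)
    rw [setLIntegral_congr_fun (g := fun t => ENNReal.ofReal (Real.exp (-(δ' * t))) *
      ∫⁻ y : EuclideanSpace ℝ (Fin d), gaussDensity 1 y *
        ENNReal.ofReal (Real.exp (2 * √(κ / δ' * δ' * t) * ‖y‖))) measurableSet_Ioi, this]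
    · exact ENNReal.ofReal_ne_top
    · intro t ht
      simp only [expMoment, hsq t ht]
  have e3 := lintegral_congr (μ := volume.restrict (Ioi (0 : ℝ))) e1
  simp only [expMoment] at e3 e2
  simp only [e3] at key
  refine ⟨_, ?_, fun G hG => (le_of_eq ?_).trans (key G hG)⟩
  · refine ENNReal.mul_ne_top (ENNReal.rpow_ne_top_of_nonneg hp0.le ENNReal.ofReal_ne_top) ?_
    exact ENNReal.mul_ne_top (ENNReal.rpow_ne_top_of_nonneg (by linarith) ENNReal.ofReal_ne_top) e2
  · congr 1
    ext1 x
    refine lintegral_congr fun t => ?_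
    rw [← mul_assoc, ← ENNReal.ofReal_mul (by positivity), ← Real.exp_add, gaussAvg]
    congr 3
    ring

end GaussianAverages

/-! ### Operator-valued Fubini and the semigroup law -/

section FubiniOperator
variable {X α V : Type*} [MeasurableSpace X] [MeasurableSpace α] [NormedAddCommGroup V]
  [NormedSpace ℂ V] [CompleteSpace V] {μ : Measure α} [SFinite μ] {ν : Measure X} [SFinite ν]

theorem stronglyMeasurable_clm_apply {α W : Type*} [MeasurableSpace α] [NormedAddCommGroup W]
    [NormedSpace ℂ W] {L : α → W →L[ℂ] W} {f : α → W} (hL : StronglyMeasurable L)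
    (hf : StronglyMeasurable f) : StronglyMeasurable fun a => L a (f a) := by
  have h := (isBoundedBilinearMap_apply (𝕜 := ℂ) (E := W) (F := W)).continuous.comp_stronglyMeasurable
    (hL.prodMk hf)
  exact h

/-- A family of operators applied to a parameter integral. -/
theorem integral_clm_apply_integral {L : X → V →L[ℂ] V} (hL : StronglyMeasurable L) {φ : X → α → V}
    (hφ : StronglyMeasurable fun q : X × α => φ q.1 q.2)
    (h : ∫⁻ ξ, ‖L ξ‖ₑ * ∫⁻ a, ‖φ ξ a‖ₑ ∂μ ∂ν < ⊤) (h' : ∀ᵐ ξ ∂ν, ∫⁻ a, ‖φ ξ a‖ₑ ∂μ < ⊤) :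
    ∫ ξ, L ξ (∫ a, φ ξ a ∂μ) ∂ν = ∫ a, ∫ ξ, L ξ (φ ξ a) ∂ν ∂μ := by
  have hm : StronglyMeasurable fun q : X × α => L q.1 (φ q.1 q.2) :=
    stronglyMeasurable_clm_apply (hL.comp_measurable measurable_fst) hφ
  have hφx : ∀ ξ, StronglyMeasurable (φ ξ) := fun ξ => hφ.comp_measurable measurable_prodMk_left
  have e : ∫ ξ, L ξ (∫ a, φ ξ a ∂μ) ∂ν = ∫ ξ, ∫ a, L ξ (φ ξ a) ∂μ ∂ν := by
    refine integral_congr_ae ?_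
    filter_upwards [h'] with ξ hξ
    exact (ContinuousLinearMap.integral_comp_comm _ ⟨(hφx ξ).aestronglyMeasurable, hξ⟩).symm
  rw [e]
  refine integral_integral_swap (f := fun ξ a => L ξ (φ ξ a)) ⟨hm.aestronglyMeasurable, ?_⟩
  have hm' : Measurable (Function.uncurry fun ξ a => ‖L ξ (φ ξ a)‖ₑ) := hm.enorm
  refine (lintegral_prod _ hm'.aemeasurable).trans_lt ?_
  refine lt_of_le_of_lt (lintegral_mono fun ξ => ?_) h
  rw [← lintegral_const_mul _ (hφx ξ).enorm]
  exact lintegral_mono fun a => (L ξ).le_opENorm _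

end FubiniOperator

section HeatOperator
variable {d N : ℕ} {S : Matrix (Fin d) (Fin d) ℝ}
  {K : ℝ → EuclideanSpace ℝ (Fin d) → EuclideanSpace ℂ (Fin N) →L[ℂ] EuclideanSpace ℂ (Fin N)}
  {K' : ℝ → EuclideanSpace ℝ (Fin d) → EuclideanSpace ℝ (Fin d) →
      EuclideanSpace ℂ (Fin N) →L[ℂ] EuclideanSpace ℂ (Fin N)} {c b s₀ a : ℝ}
  {f g : EuclideanSpace ℝ (Fin d) → EuclideanSpace ℂ (Fin N)}

/-- The operator with kernel `K t (e^{tS}x - ξ)`. -/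
noncomputable def heatOp (S : Matrix (Fin d) (Fin d) ℝ)
    (K : ℝ → EuclideanSpace ℝ (Fin d) → EuclideanSpace ℂ (Fin N) →L[ℂ] EuclideanSpace ℂ (Fin N))
    (t : ℝ) (f : EuclideanSpace ℝ (Fin d) → EuclideanSpace ℂ (Fin N))
    (x : EuclideanSpace ℝ (Fin d)) : EuclideanSpace ℂ (Fin N) :=
  ∫ ξ, K t (expRotation S t x - ξ) (f ξ)

/-- The Laplace transform of the semigroup. -/
noncomputable def resolventOp (S : Matrix (Fin d) (Fin d) ℝ)
    (K : ℝ → EuclideanSpace ℝ (Fin d) → EuclideanSpace ℂ (Fin N) →L[ℂ] EuclideanSpace ℂ (Fin N))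
    (lam : ℂ) (f : EuclideanSpace ℝ (Fin d) → EuclideanSpace ℂ (Fin N))
    (x : EuclideanSpace ℝ (Fin d)) : EuclideanSpace ℂ (Fin N) :=
  ∫ t in Ioi (0 : ℝ), Complex.exp (-(lam * t)) • heatOp S K t f x

/-- The equality holds at every point, because f is only integrated against a kernel.
Representatives may therefore be replaced by strongly measurable ones throughout. -/
theorem heatOp_congr_ae (h : f =ᵐ[volume] g) (t : ℝ) : heatOp S K t f = heatOp S K t g := by
  ext1 x
  exact integral_congr_ae (h.mono fun ξ hξ => by simp only [hξ])

theorem resolventOp_congr_ae (h : f =ᵐ[volume] g) (lam : ℂ) :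
    resolventOp S K lam f = resolventOp S K lam g := by
  ext1 x
  simp only [resolventOp, heatOp_congr_ae h]

namespace IsHeatKernel

theorem stronglyMeasurable_comp (hK : IsHeatKernel S K K' c b s₀ a) {α : Type*} [MeasurableSpace α]
    {t : α → ℝ} {ψ : α → EuclideanSpace ℝ (Fin d)} (ht : Measurable t) (hψ : Measurable ψ) :
    StronglyMeasurable fun q => K (t q) (ψ q) := by
  have h := hK.meas.comp_measurable (ht.prodMk hψ)
  exact h

theorem stronglyMeasurable_apply (hK : IsHeatKernel S K K' c b s₀ a) {α : Type*} [MeasurableSpace α]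
    {t : α → ℝ} {ψ : α → EuclideanSpace ℝ (Fin d)} {f : α → EuclideanSpace ℂ (Fin N)}
    (ht : Measurable t) (hψ : Measurable ψ) (hf : StronglyMeasurable f) :
    StronglyMeasurable fun q => K (t q) (ψ q) (f q) :=
  stronglyMeasurable_clm_apply (hK.stronglyMeasurable_comp ht hψ) hf

/-- The Gaussian bound combined with the substitution ξ = e^{tS}x - √(s₀t) y; all later estimates of
the semigroup pass through `gaussAvg`. -/
theorem lintegral_kernel_le (hK : IsHeatKernel S K K' c b s₀ a) {t : ℝ} (ht : 0 < t)
    (x : EuclideanSpace ℝ (Fin d)) (G : EuclideanSpace ℝ (Fin d) → ℝ≥0∞) :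
    ∫⁻ ξ, ‖K t (expRotation S t x - ξ)‖ₑ * G ξ ≤
      ENNReal.ofReal (c * Real.exp (-b * t)) * gaussAvg S s₀ t G x := by
  have h := hK.scale_pos
  rw [gaussAvg, ← lintegral_gaussDensity_mul (by positivity) fun y => G (expRotation S t x - y),
    ← lintegral_const_mul' _ _ ENNReal.ofReal_ne_top,
    ← lintegral_sub_left_eq_self _ (expRotation S t x)]
  refine lintegral_mono fun ξ => ?_
  rw [sub_sub_cancel, ← mul_assoc]
  gcongr
  exact hK.bound t ht _

theorem enorm_heatOp_le (hK : IsHeatKernel S K K' c b s₀ a) {t : ℝ} (ht : 0 < t)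
    (f : EuclideanSpace ℝ (Fin d) → EuclideanSpace ℂ (Fin N)) (x : EuclideanSpace ℝ (Fin d)) :
    ‖heatOp S K t f x‖ₑ ≤
      ENNReal.ofReal (c * Real.exp (-b * t)) * gaussAvg S s₀ t (fun ξ => ‖f ξ‖ₑ) x := by
  refine (enorm_integral_le_lintegral_enorm _).trans ?_
  refine le_trans (lintegral_mono fun ξ => ?_) (hK.lintegral_kernel_le ht x fun ξ => ‖f ξ‖ₑ)
  exact ContinuousLinearMap.le_opENorm _ _

theorem integrable_kernel_apply (hK : IsHeatKernel S K K' c b s₀ a) (hf : StronglyMeasurable f)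
    {t : ℝ} (ht : 0 < t) {x : EuclideanSpace ℝ (Fin d)}
    (h : gaussAvg S s₀ t (fun ξ => ‖f ξ‖ₑ) x < ⊤) :
    Integrable fun ξ => K t (expRotation S t x - ξ) (f ξ) := by
  refine ⟨(hK.stronglyMeasurable_apply (t := fun _ => t) (by fun_prop)
    (by fun_prop) hf).aestronglyMeasurable, ?_⟩
  refine lt_of_le_of_lt ((lintegral_mono fun ξ => ContinuousLinearMap.le_opENorm _ _).trans
    (hK.lintegral_kernel_le ht x fun ξ => ‖f ξ‖ₑ)) ?_
  exact ENNReal.mul_lt_top ENNReal.ofReal_lt_top h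

theorem stronglyMeasurable_heatOp (hK : IsHeatKernel S K K' c b s₀ a) (hf : StronglyMeasurable f)
    {α : Type*} [MeasurableSpace α] {t : α → ℝ} {x : α → EuclideanSpace ℝ (Fin d)}
    (ht : Measurable t) (hx : Measurable x) :
    StronglyMeasurable fun q => heatOp S K (t q) f (x q) := by
  have h : StronglyMeasurable fun q : α × EuclideanSpace ℝ (Fin d) =>
      K (t q.1) (expRotation S (t q.1) (x q.1) - q.2) (f q.2) :=
    hK.stronglyMeasurable_apply (by fun_prop) (by fun_prop)
      (hf.comp_measurable measurable_snd)
  exact h.integral_prod_right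

theorem stronglyMeasurable_resolventOp (hK : IsHeatKernel S K K' c b s₀ a)
    (hf : StronglyMeasurable f) (lam : ℂ) : StronglyMeasurable (resolventOp S K lam f) := by
  have h : StronglyMeasurable fun q : EuclideanSpace ℝ (Fin d) × ℝ =>
      Complex.exp (-(lam * q.2)) • heatOp S K q.2 f q.1 := by
    have h1 : Measurable fun q : EuclideanSpace ℝ (Fin d) × ℝ => Complex.exp (-(lam * q.2)) := by
      fun_prop
    refine h1.stronglyMeasurable.smul ?_
    exact hK.stronglyMeasurable_heatOp hf measurable_snd measurable_fst
  exact h.integral_prod_right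

/-- The first kernel is bounded by its Gaussian prefactor, and the second is integrable because ξ ↦
e^{tS}ξ - ζ preserves measure. -/
theorem integrable_kernel_comp (hK : IsHeatKernel S K K' c b s₀ a) {s t : ℝ} (hs : 0 < s) (ht : 0 < t)
    (z ζ : EuclideanSpace ℝ (Fin d)) :
    Integrable fun ξ => K s (z - ξ) ∘L K t (expRotation S t ξ - ζ) := by
  have hs₀ := hK.scale_pos
  have hm : StronglyMeasurable fun ξ => K s (z - ξ) ∘L K t (expRotation S t ξ - ζ) := by
    have h := (isBoundedBilinearMap_comp (𝕜 := ℂ) (E := EuclideanSpace ℂ (Fin N))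
      (F := EuclideanSpace ℂ (Fin N)) (G := EuclideanSpace ℂ (Fin N))).continuous.comp_stronglyMeasurable
      ((hK.stronglyMeasurable_comp (t := fun _ => s) (ψ := fun ξ => z - ξ) (by fun_prop)
        (by fun_prop)).prodMk
        (hK.stronglyMeasurable_comp (t := fun _ => t) (ψ := fun ξ => expRotation S t ξ - ζ)
        (by fun_prop) (by fun_prop)))
    exact h
  refine ⟨hm.aestronglyMeasurable, ?_⟩
  set C : ℝ≥0∞ := ENNReal.ofReal (c * Real.exp (-b * s)) *
    ENNReal.ofReal ((Real.pi * (s₀ * s)) ^ (-(d : ℝ) / 2)) * ENNReal.ofReal (c * Real.exp (-b * t))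
  have hC : C ≠ ⊤ := ENNReal.mul_ne_top (ENNReal.mul_ne_top ENNReal.ofReal_ne_top
    ENNReal.ofReal_ne_top) ENNReal.ofReal_ne_top
  have hle : ∀ ξ, ‖K s (z - ξ) ∘L K t (expRotation S t ξ - ζ)‖ₑ ≤
      C * gaussDensity (s₀ * t) (expRotation S t ξ - ζ) := fun ξ => by
    have h1 : gaussDensity (s₀ * s) (z - ξ) ≤ ENNReal.ofReal ((Real.pi * (s₀ * s)) ^ (-(d : ℝ) / 2)) := by
      refine ENNReal.ofReal_le_ofReal (mul_le_of_le_one_right (by have := Real.pi_pos; positivity) ?_)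
      rw [Real.exp_le_one_iff, neg_div, neg_nonpos]
      positivity
    calc ‖K s (z - ξ) ∘L K t (expRotation S t ξ - ζ)‖ₑ
        ≤ ‖K s (z - ξ)‖ₑ * ‖K t (expRotation S t ξ - ζ)‖ₑ := by
          rw [← ofReal_norm, ← ofReal_norm, ← ofReal_norm, ← ENNReal.ofReal_mul (norm_nonneg _)]
          exact ENNReal.ofReal_le_ofReal (ContinuousLinearMap.opNorm_comp_le _ _)
      _ ≤ (ENNReal.ofReal (c * Real.exp (-b * s)) *
          ENNReal.ofReal ((Real.pi * (s₀ * s)) ^ (-(d : ℝ) / 2))) *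
          (ENNReal.ofReal (c * Real.exp (-b * t)) * gaussDensity (s₀ * t) (expRotation S t ξ - ζ)) := by
        gcongr
        · exact (hK.bound s hs _).trans (by gcongr)
        · exact hK.bound t ht _
      _ = _ := by rw [← mul_assoc]
  refine lt_of_le_of_lt (lintegral_mono hle) ?_
  have hg : Measurable fun y : EuclideanSpace ℝ (Fin d) => gaussDensity (s₀ * t) y := by fun_prop
  rw [lintegral_const_mul' _ _ hC,
    (measurePreserving_expRotation_sub hK.skew t ζ).lintegral_comp hg]
  have := lintegral_gaussDensity_mul (d := d) (s := s₀ * t) (by positivity) fun _ => 1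
  simp only [mul_one, lintegral_gaussDensity_one hK.dim_pos] at this
  rw [this, mul_one]
  exact hC.lt_top

/-- The semigroup law. -/
theorem heatOp_heatOp (hK : IsHeatKernel S K K' c b s₀ a) (hf : StronglyMeasurable f) {s t : ℝ}
    (hs : 0 < s) (ht : 0 < t) {x : EuclideanSpace ℝ (Fin d)}
    (h : ∀ᵐ ξ, gaussAvg S s₀ t (fun ξ => ‖f ξ‖ₑ) ξ < ⊤)
    (hx : gaussAvg S s₀ s (gaussAvg S s₀ t fun ξ => ‖f ξ‖ₑ) x < ⊤) :
    heatOp S K s (heatOp S K t f) x = heatOp S K (s + t) f x := by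
  have hle : ∀ ξ, ∫⁻ ζ, ‖K t (expRotation S t ξ - ζ) (f ζ)‖ₑ ≤ ENNReal.ofReal (c * Real.exp (-b * t)) *
      gaussAvg S s₀ t (fun ξ => ‖f ξ‖ₑ) ξ := fun ξ =>
    (lintegral_mono fun ζ => ContinuousLinearMap.le_opENorm _ _).trans
      (hK.lintegral_kernel_le ht ξ fun ξ => ‖f ξ‖ₑ)
  have hm : StronglyMeasurable fun q : EuclideanSpace ℝ (Fin d) × EuclideanSpace ℝ (Fin d) =>
      K t (expRotation S t q.1 - q.2) (f q.2) :=
    hK.stronglyMeasurable_apply (t := fun _ => t) (by fun_prop) (by fun_prop)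
      (hf.comp_measurable measurable_snd)
  have key := integral_clm_apply_integral (L := fun ξ => K s (expRotation S s x - ξ))
    (φ := fun ξ ζ => K t (expRotation S t ξ - ζ) (f ζ)) (μ := volume) (ν := volume)
    (hK.stronglyMeasurable_comp (t := fun _ => s) (by fun_prop) (by fun_prop)) hm
    (by
      refine lt_of_le_of_lt (b := ENNReal.ofReal (c * Real.exp (-b * t)) *
        (ENNReal.ofReal (c * Real.exp (-b * s)) *
          gaussAvg S s₀ s (gaussAvg S s₀ t fun ξ => ‖f ξ‖ₑ) x)) ?_
        (ENNReal.mul_lt_top ENNReal.ofReal_lt_top (ENNReal.mul_lt_top ENNReal.ofReal_lt_top hx))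
      refine le_trans ?_ (mul_le_mul_right (hK.lintegral_kernel_le hs x _) _)
      rw [← lintegral_const_mul' _ _ ENNReal.ofReal_ne_top]
      refine lintegral_mono fun ξ => ?_
      calc _ ≤ ‖K s (expRotation S s x - ξ)‖ₑ * _ := mul_le_mul_right (hle ξ) _
        _ = _ := by ring)
    (h.mono fun ξ hξ => (hle ξ).trans_lt (ENNReal.mul_lt_top ENNReal.ofReal_lt_top hξ))
  calc heatOp S K s (heatOp S K t f) x
      = ∫ ζ, ∫ ξ, K s (expRotation S s x - ξ) (K t (expRotation S t ξ - ζ) (f ζ)) := key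
    _ = heatOp S K (s + t) f x := by
      refine integral_congr_ae (Eventually.of_forall fun ζ => ?_)
      have h1 := ContinuousLinearMap.integral_apply
        (hK.integrable_kernel_comp hs ht (expRotation S s x) ζ) (f ζ)
      simp only [ContinuousLinearMap.comp_apply] at h1
      simp only
      rw [← h1, hK.conv s hs t ht, ← expRotation_add, add_comm t s]

end IsHeatKernel

end HeatOperator

/-! ### The Laplace transform of the semigroup on weighted spaces -/

section WeightedResolvent
variable {d N : ℕ} {S : Matrix (Fin d) (Fin d) ℝ}
  {K : ℝ → EuclideanSpace ℝ (Fin d) → EuclideanSpace ℂ (Fin N) →L[ℂ] EuclideanSpace ℂ (Fin N)}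
  {K' : ℝ → EuclideanSpace ℝ (Fin d) → EuclideanSpace ℝ (Fin d) →
      EuclideanSpace ℂ (Fin N) →L[ℂ] EuclideanSpace ℂ (Fin N)} {c b s₀ a : ℝ}
  {f g : EuclideanSpace ℝ (Fin d) → EuclideanSpace ℂ (Fin N)}
  {θ : EuclideanSpace ℝ (Fin d) → ℝ} {η Cθ p : ℝ} {lam : ℂ}
  {G : EuclideanSpace ℝ (Fin d) → ℝ≥0∞}

theorem gaussAvg_laplaceAvg (hG : Measurable G) (h δ : ℝ) (x : EuclideanSpace ℝ (Fin d)) :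
    gaussAvg S s₀ h (laplaceAvg S s₀ δ G) x = ∫⁻ t in Ioi 0, ENNReal.ofReal (Real.exp (-(δ * t))) *
      gaussAvg S s₀ h (gaussAvg S s₀ t G) x := by
  have hm : Measurable (Function.uncurry fun (y : EuclideanSpace ℝ (Fin d)) (t : ℝ) =>
      gaussDensity 1 y * (ENNReal.ofReal (Real.exp (-(δ * t))) *
        gaussAvg S s₀ t G (expRotation S h x - √(s₀ * h) • y))) := by
    simp only [Function.uncurry_def]
    fun_prop
  calc _ = ∫⁻ y, ∫⁻ t in Ioi 0, gaussDensity 1 y * (ENNReal.ofReal (Real.exp (-(δ * t))) *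
        gaussAvg S s₀ t G (expRotation S h x - √(s₀ * h) • y)) := by
        refine lintegral_congr fun y => ?_
        exact (lintegral_const_mul' _ _ ENNReal.ofReal_ne_top).symm
    _ = ∫⁻ t in Ioi 0, ∫⁻ y, gaussDensity 1 y * (ENNReal.ofReal (Real.exp (-(δ * t))) *
        gaussAvg S s₀ t G (expRotation S h x - √(s₀ * h) • y)) :=
        lintegral_lintegral_swap hm.aemeasurable
    _ = _ := by
        refine lintegral_congr fun t => ?_
        rw [gaussAvg, ← lintegral_const_mul' _ _ ENNReal.ofReal_ne_top]
        refine lintegral_congr fun y => ?_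
        ring

theorem ae_of_laplace_lt_top {δ : ℝ} {F : ℝ → ℝ≥0∞} (hF : Measurable F)
    (h : ∫⁻ t in Ioi (0 : ℝ), ENNReal.ofReal (Real.exp (-(δ * t))) * F t < ⊤) :
    ∀ᵐ t ∂(volume.restrict (Ioi (0 : ℝ))), F t < ⊤ := by
  have hm : Measurable fun t => ENNReal.ofReal (Real.exp (-(δ * t))) * F t := by fun_prop
  filter_upwards [ae_lt_top hm h.ne] with t ht
  refine lt_top_iff_ne_top.2 fun hc => ?_
  rw [hc, ENNReal.mul_top (by simp [Real.exp_pos])] at ht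
  exact lt_irrefl _ ht

theorem wInt_const_mul_le {A : ℝ≥0∞} (hA : A ≠ ⊤) (hp : 1 ≤ p) :
    wInt θ p (fun x => A * G x) = A ^ p * wInt θ p G := by
  have hp0 : 0 ≤ p := by linarith
  rw [wInt, wInt, ← lintegral_const_mul' _ _ (ENNReal.rpow_ne_top_of_nonneg hp0 hA)]
  refine lintegral_congr fun x => ?_
  rw [← ENNReal.mul_rpow_of_nonneg _ _ hp0]
  congr 1
  ring

namespace IsHeatKernel

theorem enorm_exp_smul_heatOp_le (hK : IsHeatKernel S K K' c b s₀ a) (lam : ℂ) {t : ℝ} (ht : 0 < t)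
    (f : EuclideanSpace ℝ (Fin d) → EuclideanSpace ℂ (Fin N)) (x : EuclideanSpace ℝ (Fin d)) :
    ‖Complex.exp (-(lam * t)) • heatOp S K t f x‖ₑ ≤ ENNReal.ofReal c *
      (ENNReal.ofReal (Real.exp (-((lam.re + b) * t))) * gaussAvg S s₀ t (fun ξ => ‖f ξ‖ₑ) x) := by
  have hc := hK.const_nonneg
  have h1 : ‖Complex.exp (-(lam * t))‖ₑ = ENNReal.ofReal (Real.exp (-(lam.re * t))) := by
    rw [← ofReal_norm, Complex.norm_exp]
    simp
  rw [enorm_smul, h1]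
  refine (mul_le_mul_right (hK.enorm_heatOp_le ht f x) _).trans (le_of_eq ?_)
  rw [← mul_assoc, ← mul_assoc, ← ENNReal.ofReal_mul (by positivity), ← ENNReal.ofReal_mul hc]
  congr 2
  rw [show -((lam.re + b) * t) = -(lam.re * t) + -b * t by ring, Real.exp_add]
  ring

theorem lintegral_exp_smul_heatOp_le (hK : IsHeatKernel S K K' c b s₀ a) (lam : ℂ)
    (f : EuclideanSpace ℝ (Fin d) → EuclideanSpace ℂ (Fin N)) (x : EuclideanSpace ℝ (Fin d)) :
    ∫⁻ t in Ioi (0 : ℝ), ‖Complex.exp (-(lam * t)) • heatOp S K t f x‖ₑ ≤ ENNReal.ofReal c *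
      laplaceAvg S s₀ (lam.re + b) (fun ξ => ‖f ξ‖ₑ) x := by
  rw [laplaceAvg, ← lintegral_const_mul' _ _ ENNReal.ofReal_ne_top]
  exact setLIntegral_mono' measurableSet_Ioi fun t ht => hK.enorm_exp_smul_heatOp_le lam ht f x

theorem enorm_resolventOp_le (hK : IsHeatKernel S K K' c b s₀ a) (lam : ℂ)
    (f : EuclideanSpace ℝ (Fin d) → EuclideanSpace ℂ (Fin N)) (x : EuclideanSpace ℝ (Fin d)) :
    ‖resolventOp S K lam f x‖ₑ ≤ ENNReal.ofReal c *
      laplaceAvg S s₀ (lam.re + b) (fun ξ => ‖f ξ‖ₑ) x :=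
  (enorm_integral_le_lintegral_enorm _).trans (hK.lintegral_exp_smul_heatOp_le lam f x)

theorem integrableOn_exp_smul_heatOp (hK : IsHeatKernel S K K' c b s₀ a) (hf : StronglyMeasurable f)
    {x : EuclideanSpace ℝ (Fin d)} (h : laplaceAvg S s₀ (lam.re + b) (fun ξ => ‖f ξ‖ₑ) x < ⊤) :
    IntegrableOn (fun t : ℝ => Complex.exp (-(lam * t)) • heatOp S K t f x) (Ioi 0) := by
  have h1 : Measurable fun t : ℝ => Complex.exp (-(lam * t)) := by fun_prop
  exact ⟨(h1.stronglyMeasurable.smul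
      (hK.stronglyMeasurable_heatOp hf measurable_id measurable_const)).aestronglyMeasurable,
    (hK.lintegral_exp_smul_heatOp_le lam f x).trans_lt (ENNReal.mul_lt_top ENNReal.ofReal_lt_top h)⟩

theorem wInt_gaussAvg_lt_top (hK : IsHeatKernel S K K' c b s₀ a) (hθ : IsRadialWeight θ η Cθ)
    (hp : 1 ≤ p) (t : ℝ) (hG : Measurable G) (h : wInt θ p G < ⊤) :
    wInt θ p (gaussAvg S s₀ t G) < ⊤ := by
  refine (wInt_gaussAvg_le hK.dim_pos hθ hp hK.skew t hG).trans_lt (ENNReal.mul_lt_top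
    (ENNReal.mul_lt_top ?_ (expMoment_lt_top hK.dim_pos _)) h)
  exact ENNReal.rpow_lt_top_of_nonneg (by linarith) ENNReal.ofReal_ne_top

theorem ae_gaussAvg_lt_top (hK : IsHeatKernel S K K' c b s₀ a) (hθ : IsRadialWeight θ η Cθ)
    (hp : 1 ≤ p) (t : ℝ) (hG : Measurable G) (h : wInt θ p G < ⊤) :
    ∀ᵐ x, gaussAvg S s₀ t G x < ⊤ :=
  wInt_ae_lt_top hθ.pos hθ.continuous hp (measurable_const.gaussAvg measurable_id hG)
    (hK.wInt_gaussAvg_lt_top hθ hp t hG h)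

theorem wInt_laplaceAvg_lt_top (hK : IsHeatKernel S K K' c b s₀ a) (hθ : IsRadialWeight θ η Cθ)
    (hp : 1 ≤ p) {δ : ℝ} (hδ : s₀ * η ^ 2 * p / 4 < δ) (hG : Measurable G) (h : wInt θ p G < ⊤) :
    wInt θ p (laplaceAvg S s₀ δ G) < ⊤ := by
  obtain ⟨C, hC, hle⟩ := wInt_laplaceAvg_le hK.dim_pos hθ hp hK.scale_pos hK.skew hδ
  exact (hle G hG).trans_lt (ENNReal.mul_lt_top hC.lt_top h)

theorem ae_laplaceAvg_lt_top (hK : IsHeatKernel S K K' c b s₀ a) (hθ : IsRadialWeight θ η Cθ)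
    (hp : 1 ≤ p) {δ : ℝ} (hδ : s₀ * η ^ 2 * p / 4 < δ) (hG : Measurable G) (h : wInt θ p G < ⊤) :
    ∀ᵐ x, laplaceAvg S s₀ δ G x < ⊤ :=
  wInt_ae_lt_top hθ.pos hθ.continuous hp (measurable_laplaceAvg hG δ)
    (hK.wInt_laplaceAvg_lt_top hθ hp hδ hG h)

theorem exists_wNorm_resolventOp_le (hK : IsHeatKernel S K K' c b s₀ a)
    (hθ : IsRadialWeight θ η Cθ) (hp : 1 ≤ p) (hlam : s₀ * η ^ 2 * p / 4 < lam.re + b) :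
    ∃ C : ℝ≥0∞, C ≠ ⊤ ∧ ∀ f : EuclideanSpace ℝ (Fin d) → EuclideanSpace ℂ (Fin N),
      StronglyMeasurable f → wNorm θ p (resolventOp S K lam f) ≤ C * wNorm θ p f := by
  have hp0 : 0 < p := by linarith
  obtain ⟨C, hC, hle⟩ := wInt_laplaceAvg_le hK.dim_pos hθ hp hK.scale_pos hK.skew hlam
  refine ⟨(ENNReal.ofReal c ^ p * C) ^ (1 / p), ENNReal.rpow_ne_top_of_nonneg (by positivity)
    (ENNReal.mul_ne_top (ENNReal.rpow_ne_top_of_nonneg hp0.le ENNReal.ofReal_ne_top) hC),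
    fun f hf => ?_⟩
  rw [wNorm_eq hθ.pos hp, wNorm_eq hθ.pos hp, ← ENNReal.mul_rpow_of_nonneg _ _ (by positivity)]
  refine ENNReal.rpow_le_rpow ?_ (by positivity)
  refine (wInt_mono hp (hK.enorm_resolventOp_le lam f)).trans ?_
  rw [wInt_const_mul_le ENNReal.ofReal_ne_top hp, mul_assoc]
  gcongr
  exact hle _ hf.enorm

theorem wNorm_heatOp_lt_top (hK : IsHeatKernel S K K' c b s₀ a) (hθ : IsRadialWeight θ η Cθ)
    (hp : 1 ≤ p) {t : ℝ} (ht : 0 < t) (hf : StronglyMeasurable f) (h : wNorm θ p f < ⊤) :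
    wNorm θ p (heatOp S K t f) < ⊤ := by
  rw [wNorm_lt_top_iff hθ.pos hp] at h ⊢
  refine (wInt_mono hp (hK.enorm_heatOp_le ht f)).trans_lt ?_
  rw [wInt_const_mul_le ENNReal.ofReal_ne_top hp]
  exact ENNReal.mul_lt_top (ENNReal.rpow_lt_top_of_nonneg (by linarith) ENNReal.ofReal_ne_top)
    (hK.wInt_gaussAvg_lt_top hθ hp t hf.enorm h)

/-- Linearity of the resolvent. -/
theorem resolventOp_add_smul (hK : IsHeatKernel S K K' c b s₀ a) (hf : StronglyMeasurable f)
    (hg : StronglyMeasurable g) (α β : ℂ) {x : EuclideanSpace ℝ (Fin d)}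
    (h1 : laplaceAvg S s₀ (lam.re + b) (fun ξ => ‖f ξ‖ₑ) x < ⊤)
    (h2 : laplaceAvg S s₀ (lam.re + b) (fun ξ => ‖g ξ‖ₑ) x < ⊤) :
    resolventOp S K lam (fun ξ => α • f ξ + β • g ξ) x
      = α • resolventOp S K lam f x + β • resolventOp S K lam g x := by
  have hm1 : Measurable fun t => gaussAvg S s₀ t (fun ξ => ‖f ξ‖ₑ) x :=
    measurable_id.gaussAvg measurable_const hf.enorm
  have hm2 : Measurable fun t => gaussAvg S s₀ t (fun ξ => ‖g ξ‖ₑ) x :=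
    measurable_id.gaussAvg measurable_const hg.enorm
  have hadd := integral_add ((hK.integrableOn_exp_smul_heatOp hf h1).smul α)
    ((hK.integrableOn_exp_smul_heatOp hg h2).smul β)
  simp only [Pi.smul_apply] at hadd
  rw [resolventOp, resolventOp, resolventOp, ← integral_smul, ← integral_smul, ← hadd]
  refine integral_congr_ae ?_
  filter_upwards [ae_of_laplace_lt_top hm1 h1, ae_of_laplace_lt_top hm2 h2,
    ae_restrict_mem measurableSet_Ioi] with t ht1 ht2 ht
  have e : heatOp S K t (fun ξ => α • f ξ + β • g ξ) x = α • heatOp S K t f x + β • heatOp S K t g x := by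
    simp only [heatOp, map_add, map_smul]
    have hadd := integral_add ((hK.integrable_kernel_apply hf ht ht1).smul α)
      ((hK.integrable_kernel_apply hg ht ht2).smul β)
    simp only [Pi.smul_apply] at hadd
    rw [hadd, integral_smul, integral_smul]
  rw [e, smul_add, smul_comm _ α, smul_comm _ β]

/-- T(h) is taken under the Laplace integral and combined with T(t) by the semigroup law. Fubini is
justified at each x where the Gaussian average of the resolvent majorant is finite, which is almost
every x. -/
theorem heatOp_resolventOp (hK : IsHeatKernel S K K' c b s₀ a) (hθ : IsRadialWeight θ η Cθ)
    (hp : 1 ≤ p) (hlam : s₀ * η ^ 2 * p / 4 < lam.re + b) (hf : StronglyMeasurable f)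
    (hfn : wNorm θ p f < ⊤) {h : ℝ} (hh : 0 < h) :
    ∀ᵐ x, heatOp S K h (resolventOp S K lam f) x
      = ∫ t in Ioi (0 : ℝ), Complex.exp (-(lam * t)) • heatOp S K (t + h) f x := by
  rw [wNorm_lt_top_iff hθ.pos hp] at hfn
  have hL := hK.wInt_laplaceAvg_lt_top hθ hp hlam hf.enorm hfn
  filter_upwards [hK.ae_gaussAvg_lt_top hθ hp h (measurable_laplaceAvg hf.enorm _) hL] with x hx
  have hφ : StronglyMeasurable fun q : EuclideanSpace ℝ (Fin d) × ℝ =>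
      Complex.exp (-(lam * q.2)) • heatOp S K q.2 f q.1 := by
    have h1 : Measurable fun q : EuclideanSpace ℝ (Fin d) × ℝ => Complex.exp (-(lam * q.2)) := by
      fun_prop
    exact h1.stronglyMeasurable.smul (hK.stronglyMeasurable_heatOp hf measurable_snd measurable_fst)
  have key := integral_clm_apply_integral (L := fun ξ => K h (expRotation S h x - ξ))
    (φ := fun ξ t => Complex.exp (-(lam * t)) • heatOp S K t f ξ) (μ := volume.restrict (Ioi (0 : ℝ)))
    (ν := volume) (hK.stronglyMeasurable_comp (t := fun _ => h) (by fun_prop) (by fun_prop)) hφ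
    (by
      refine lt_of_le_of_lt (b := ENNReal.ofReal c * (ENNReal.ofReal (c * Real.exp (-b * h)) *
        gaussAvg S s₀ h (laplaceAvg S s₀ (lam.re + b) fun ξ => ‖f ξ‖ₑ) x)) ?_
        (ENNReal.mul_lt_top ENNReal.ofReal_lt_top (ENNReal.mul_lt_top ENNReal.ofReal_lt_top hx))
      refine le_trans ?_ (mul_le_mul_right (hK.lintegral_kernel_le hh x _) _)
      rw [← lintegral_const_mul' _ _ ENNReal.ofReal_ne_top]
      refine lintegral_mono fun ξ => ?_
      calc _ ≤ ‖K h (expRotation S h x - ξ)‖ₑ * _ :=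
            mul_le_mul_right (hK.lintegral_exp_smul_heatOp_le lam f ξ) _
        _ = _ := by ring)
    (by
      filter_upwards [hK.ae_laplaceAvg_lt_top hθ hp hlam hf.enorm hfn] with ξ hξ
      exact (hK.lintegral_exp_smul_heatOp_le lam f ξ).trans_lt
        (ENNReal.mul_lt_top ENNReal.ofReal_lt_top hξ))
  rw [gaussAvg_laplaceAvg hf.enorm] at hx
  have hm : Measurable fun t => gaussAvg S s₀ h (gaussAvg S s₀ t fun ξ => ‖f ξ‖ₑ) x := by
    refine Measurable.lintegral_prod_right' (f := fun q : ℝ × EuclideanSpace ℝ (Fin d) =>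
      gaussDensity 1 q.2 * gaussAvg S s₀ q.1 (fun ξ => ‖f ξ‖ₑ)
        (expRotation S h x - √(s₀ * h) • q.2)) ?_
    have := hf.enorm
    fun_prop
  refine Eq.trans key (integral_congr_ae ?_)
  filter_upwards [ae_of_laplace_lt_top hm hx, ae_restrict_mem measurableSet_Ioi] with t ht ht0
  simp only [map_smul]
  rw [integral_smul, add_comm t h,
    ← hK.heatOp_heatOp hf hh ht0 (hK.ae_gaussAvg_lt_top hθ hp t hf.enorm hfn) ht]
  rfl

/-- The same integral as for the opposite order, so the resolvent commutes with T(h). -/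
theorem resolventOp_heatOp (hK : IsHeatKernel S K K' c b s₀ a) (hθ : IsRadialWeight θ η Cθ)
    (hp : 1 ≤ p) (hlam : s₀ * η ^ 2 * p / 4 < lam.re + b) (hf : StronglyMeasurable f)
    (hfn : wNorm θ p f < ⊤) {h : ℝ} (hh : 0 < h) :
    ∀ᵐ x, resolventOp S K lam (heatOp S K h f) x
      = ∫ t in Ioi (0 : ℝ), Complex.exp (-(lam * t)) • heatOp S K (t + h) f x := by
  rw [wNorm_lt_top_iff hθ.pos hp] at hfn
  have hm : Measurable (gaussAvg S s₀ h fun ξ => ‖f ξ‖ₑ) :=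
    measurable_const.gaussAvg measurable_id hf.enorm
  filter_upwards [hK.ae_laplaceAvg_lt_top hθ hp hlam hm
    (hK.wInt_gaussAvg_lt_top hθ hp h hf.enorm hfn)] with x hx
  refine integral_congr_ae ?_
  filter_upwards [ae_of_laplace_lt_top (measurable_id.gaussAvg measurable_const hm) hx,
    ae_restrict_mem measurableSet_Ioi] with t ht ht0
  rw [hK.heatOp_heatOp hf ht0 hh (hK.ae_gaussAvg_lt_top hθ hp h hf.enorm hfn) ht]

/-- Shifting t by h turns the Laplace integral of T(t+h)f into e^{λh} times the tail over (h, ∞),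
which is the resolvent minus its part over (0, h]. -/
theorem heatOp_resolventOp_eq (hK : IsHeatKernel S K K' c b s₀ a) (hθ : IsRadialWeight θ η Cθ)
    (hp : 1 ≤ p) (hlam : s₀ * η ^ 2 * p / 4 < lam.re + b) (hf : StronglyMeasurable f)
    (hfn : wNorm θ p f < ⊤) {h : ℝ} (hh : 0 < h) :
    ∀ᵐ x, heatOp S K h (resolventOp S K lam f) x = Complex.exp (lam * h) •
      (resolventOp S K lam f x - ∫ t in Ioc 0 h, Complex.exp (-(lam * t)) • heatOp S K t f x) := by
  have hfn' := hfn
  rw [wNorm_lt_top_iff hθ.pos hp] at hfn'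
  filter_upwards [hK.heatOp_resolventOp hθ hp hlam hf hfn hh,
    hK.ae_laplaceAvg_lt_top hθ hp hlam hf.enorm hfn'] with x hx hx'
  have hi := hK.integrableOn_exp_smul_heatOp hf hx'
  have h1 : resolventOp S K lam f x = (∫ t in Ioc 0 h, Complex.exp (-(lam * t)) • heatOp S K t f x) +
      ∫ t in Ioi h, Complex.exp (-(lam * t)) • heatOp S K t f x := by
    rw [resolventOp, ← Ioc_union_Ioi_eq_Ioi hh.le]
    exact setIntegral_union Ioc_disjoint_Ioi_same measurableSet_Ioi
      (hi.mono_set Ioc_subset_Ioi_self) (hi.mono_set (Ioi_subset_Ioi hh.le))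
  have h2 := (measurePreserving_add_right volume h).setIntegral_preimage_emb
    (measurableEmbedding_addRight h) (fun t : ℝ => Complex.exp (-(lam * t)) • heatOp S K t f x) (Ioi h)
  rw [preimage_add_const_Ioi, sub_self] at h2
  rw [hx, h1, add_sub_cancel_left, ← h2, ← integral_smul]
  refine integral_congr_ae (Eventually.of_forall fun t => ?_)
  simp only
  rw [smul_smul, ← Complex.exp_add]
  congr 2
  push_cast
  ring

end IsHeatKernel

end WeightedResolvent

/-! ### Strong continuity at t = 0 -/

section StrongContinuity
variable {d N : ℕ} {S : Matrix (Fin d) (Fin d) ℝ}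
  {K : ℝ → EuclideanSpace ℝ (Fin d) → EuclideanSpace ℂ (Fin N) →L[ℂ] EuclideanSpace ℂ (Fin N)}
  {K' : ℝ → EuclideanSpace ℝ (Fin d) → EuclideanSpace ℝ (Fin d) →
      EuclideanSpace ℂ (Fin N) →L[ℂ] EuclideanSpace ℂ (Fin N)} {c b s₀ a : ℝ}
  {f : EuclideanSpace ℝ (Fin d) → EuclideanSpace ℂ (Fin N)}
  {θ : EuclideanSpace ℝ (Fin d) → ℝ} {η Cθ p : ℝ}

theorem wInt_mono_ae (hp : 1 ≤ p) {G G' : EuclideanSpace ℝ (Fin d) → ℝ≥0∞} (h : ∀ᵐ x, G x ≤ G' x) :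
    wInt θ p G ≤ wInt θ p G' := by
  refine lintegral_mono_ae (h.mono fun x hx => ?_)
  have hp0 : 0 < p := by linarith
  gcongr

theorem wNorm_le_of_ae_le (hθ : ∀ x, 0 < θ x) (hp : 1 ≤ p)
    {v : EuclideanSpace ℝ (Fin d) → EuclideanSpace ℂ (Fin N)}
    {G : EuclideanSpace ℝ (Fin d) → ℝ≥0∞} {A : ℝ≥0∞} (hA : A ≠ ⊤) (h : ∀ᵐ x, ‖v x‖ₑ ≤ A * G x) :
    wNorm θ p v ≤ A * wInt θ p G ^ (1 / p) := by
  have hp0 : 0 < p := by linarith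
  rw [wNorm_eq hθ hp]
  calc _ ≤ (A ^ p * wInt θ p G) ^ (1 / p) := by
        rw [← wInt_const_mul_le hA hp]
        exact ENNReal.rpow_le_rpow (wInt_mono_ae hp h) (by positivity)
    _ = _ := by
        rw [ENNReal.mul_rpow_of_nonneg _ _ (by positivity), ← ENNReal.rpow_mul,
          mul_one_div_cancel hp0.ne', ENNReal.rpow_one]

theorem eLpNorm_smul_comp_le (hθc : Continuous θ) (hθ : ∀ x, 0 < θ x)
    {g : EuclideanSpace ℝ (Fin d) → EuclideanSpace ℝ (Fin d)} (hg : MeasurePreserving g)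
    (hf : StronglyMeasurable f) {θ' : EuclideanSpace ℝ (Fin d) → ℝ} {C : ℝ}
    (h : ∀ x, |θ' x| ≤ C * θ (g x)) :
    eLpNorm (fun x => θ' x • f (g x)) (ENNReal.ofReal p) volume ≤ ENNReal.ofReal C * wNorm θ p f := by
  have hF : AEStronglyMeasurable (fun x => θ x • f x) volume :=
    hθc.aestronglyMeasurable.smul hf.aestronglyMeasurable
  rw [wNorm, ← eLpNorm_comp_measurePreserving hF hg]
  refine eLpNorm_le_mul_eLpNorm_of_ae_le_mul (Eventually.of_forall fun x => ?_) _
  rw [norm_smul, Function.comp_apply, norm_smul, Real.norm_eq_abs, Real.norm_of_nonneg (hθ _).le,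
    ← mul_assoc]
  gcongr
  exact h x

/-- The map `x ↦ e^{tS}x - √(s₀t) y`, jointly continuous in `t` and `x`. -/
noncomputable def rotShift (S : Matrix (Fin d) (Fin d) ℝ) (s₀ : ℝ) (y : EuclideanSpace ℝ (Fin d)) :
    C(ℝ, C(EuclideanSpace ℝ (Fin d), EuclideanSpace ℝ (Fin d))) :=
  ContinuousMap.curry ⟨fun q => expRotation S q.1 q.2 - √(s₀ * q.1) • y,
    continuous_expRotation.sub (by fun_prop)⟩

theorem rotShift_apply (y x : EuclideanSpace ℝ (Fin d)) (t : ℝ) :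
    rotShift S s₀ y t x = expRotation S t x - √(s₀ * t) • y := rfl

/-- Composition with measure preserving continuous maps acts on L^p continuously with respect to the
compact-open topology, and the rotated shifts tend to the identity there. This is why `rotShift`
takes values in a space of continuous maps. -/
theorem tendsto_eLpNorm_rotShift (hS : S.transpose = -S) (hp : 1 ≤ p)
    {F : EuclideanSpace ℝ (Fin d) → EuclideanSpace ℂ (Fin N)} (hF : MemLp F (ENNReal.ofReal p) volume)
    (y : EuclideanSpace ℝ (Fin d)) :
    Tendsto (fun t => eLpNorm (fun x => F (expRotation S t x - √(s₀ * t) • y) - F x)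
      (ENNReal.ofReal p) volume) (𝓝 0) (𝓝 0) := by
  have : Fact (1 ≤ ENNReal.ofReal p) := ⟨by simpa using hp⟩
  have hmp : ∀ t, MeasurePreserving (rotShift S s₀ y t) := fun t =>
    measurePreserving_expRotation_sub hS t (√(s₀ * t) • y)
  have h0 : rotShift S s₀ y 0 = ContinuousMap.id _ := by
    ext1 x
    simp [rotShift_apply, expRotation_zero]
  have h1 := Filter.Tendsto.compMeasurePreservingLp (μ := volume) (ν := volume)
    (tendsto_const_nhds (x := hF.toLp F) (f := 𝓝 (0 : ℝ))) ((rotShift S s₀ y).continuous.tendsto 0) hmp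
    (hmp 0) ENNReal.ofReal_ne_top
  simp only [Lp.toLp_compMeasurePreserving] at h1
  rw [Lp.tendsto_Lp_iff_tendsto_eLpNorm''] at h1
  refine h1.congr fun t => ?_
  rw [h0]
  rfl

/-- Continuity of rotations and translations in the weighted space. -/
theorem tendsto_wNorm_rotShift (hS : S.transpose = -S) (hp : 1 ≤ p) (hθ : IsRadialWeight θ η Cθ)
    (hW : WeightTranslationContinuous θ) (hf : StronglyMeasurable f) (hfn : wNorm θ p f < ⊤)
    (y : EuclideanSpace ℝ (Fin d)) :
    Tendsto (fun t => wNorm θ p fun x => f (expRotation S t x - √(s₀ * t) • y) - f x)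
      (𝓝 0) (𝓝 0) := by
  have hF : MemLp (fun x => θ x • f x) (ENNReal.ofReal p) volume :=
    ⟨hθ.continuous.aestronglyMeasurable.smul hf.aestronglyMeasurable, hfn⟩
  have hmp : ∀ t, MeasurePreserving fun x => expRotation S t x - √(s₀ * t) • y := fun t =>
    measurePreserving_expRotation_sub hS t _
  have h1 := tendsto_eLpNorm_rotShift (s₀ := s₀) hS hp hF y
  obtain ⟨φ, hφ⟩ := hθ.radial
  -- With x' the moved point, θ(x)(f(x') - f(x)) = [(θf)(x') - (θf)(x)] + (θ(x) - θ(x'))f(x'). The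
  -- first part is unweighted L^p continuity of θf. In the second, θ(x) = θ(e^{tS}x), so the
  -- assumption on small translations of θ makes the bracket uniformly small relative to θ(x').
  have h2 : Tendsto (fun t => eLpNorm (fun x => (θ x - θ (expRotation S t x - √(s₀ * t) • y)) •
      f (expRotation S t x - √(s₀ * t) • y)) (ENNReal.ofReal p) volume) (𝓝 0) (𝓝 0) := by
    rw [ENNReal.tendsto_nhds_zero]
    intro ε hε
    obtain ⟨n, hn, hnε⟩ := ENNReal.exists_nnreal_pos_mul_lt hfn.ne hε.ne'
    obtain ⟨δ, hδ, hδ'⟩ := hW n (by exact_mod_cast hn)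
    have hc : Continuous fun t : ℝ => ‖√(s₀ * t) • y‖ := by fun_prop
    have hev : ∀ᶠ t in 𝓝 (0 : ℝ), ‖√(s₀ * t) • y‖ < δ :=
      (hc.tendsto 0).eventually_lt_const (by simpa using hδ)
    filter_upwards [hev] with t ht
    refine le_trans (eLpNorm_smul_comp_le hθ.continuous hθ.pos (hmp t) hf (C := n) fun x => ?_) ?_
    · have h3 := hδ' _ ht.le (expRotation S t x - √(s₀ * t) • y)
      rw [sub_add_cancel, hφ (expRotation S t x), norm_expRotation hS, ← hφ, abs_div,
        abs_of_pos (hθ.pos (_ - _)), div_le_iff₀ (hθ.pos _)] at h3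
      exact h3
    · rw [ENNReal.ofReal_coe_nnreal]
      exact hnε.le
  refine tendsto_of_tendsto_of_tendsto_of_le_of_le tendsto_const_nhds (by simpa using h1.add h2)
    (fun _ => zero_le) fun t => ?_
  have hfc : AEStronglyMeasurable (fun x => f (expRotation S t x - √(s₀ * t) • y)) volume :=
    (hf.comp_measurable (hmp t).measurable).aestronglyMeasurable
  have hθm := hθ.continuous.measurable
  have hθc : AEStronglyMeasurable (fun x => θ (expRotation S t x - √(s₀ * t) • y)) volume :=
    (hθm.comp (hmp t).measurable).aestronglyMeasurable
  refine le_trans (le_of_eq ?_) (eLpNorm_add_le ((hθc.smul hfc).sub hF.1)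
    ((hθ.continuous.aestronglyMeasurable.sub hθc).smul hfc) (by simpa using hp))
  rw [wNorm]
  congr 1
  ext1 x
  simp only [Pi.add_apply, sub_smul, smul_sub]
  abel

theorem wNorm_rotShift_le (hS : S.transpose = -S) (hθ : IsRadialWeight θ η Cθ)
    (hf : StronglyMeasurable f) (t : ℝ) (y : EuclideanSpace ℝ (Fin d)) :
    wNorm θ p (fun x => f (expRotation S t x - √(s₀ * t) • y)) ≤
      ENNReal.ofReal (Cθ * Real.exp (η * (√(s₀ * t) * ‖y‖))) * wNorm θ p f := by
  refine eLpNorm_smul_comp_le hθ.continuous hθ.pos (measurePreserving_expRotation_sub hS t _) hf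
    fun x => ?_
  obtain ⟨φ, hφ⟩ := hθ.radial
  have h1 := hθ.growth (expRotation S t x - √(s₀ * t) • y) (√(s₀ * t) • y)
  rw [sub_add_cancel, hφ (expRotation S t x), norm_expRotation hS, ← hφ, norm_smul,
    Real.norm_of_nonneg (Real.sqrt_nonneg _)] at h1
  rw [abs_of_pos (hθ.pos x)]
  linarith

/-- The Gaussian average of the increments `f(e^{tS}x - √(s₀t)y) - f(x)`. -/
noncomputable def incrementAvg (S : Matrix (Fin d) (Fin d) ℝ) (s₀ t : ℝ)
    (f : EuclideanSpace ℝ (Fin d) → EuclideanSpace ℂ (Fin N)) (x : EuclideanSpace ℝ (Fin d)) : ℝ≥0∞ :=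
  ∫⁻ y, gaussDensity 1 y * ‖f (expRotation S t x - √(s₀ * t) • y) - f x‖ₑ

/-- Jensen moves the p-th power inside the Gaussian average. Then dominated convergence in y
applies, the majorant being an exponential in |y|, uniform for 0 < t ≤ 1. -/
theorem tendsto_wInt_incrementAvg (hd : 1 ≤ d) (hs₀ : 0 < s₀) (hS : S.transpose = -S) (hp : 1 ≤ p)
    (hθ : IsRadialWeight θ η Cθ) (hW : WeightTranslationContinuous θ) (hf : StronglyMeasurable f)
    (hfn : wNorm θ p f < ⊤) :
    Tendsto (fun t => wInt θ p (incrementAvg S s₀ t f)) (𝓝[>] 0) (𝓝 0) := by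
  have hp0 : 0 < p := by linarith
  have hη := hθ.rate_nonneg
  have hCθ := hθ.const_pos
  have hθm := hθ.continuous.measurable
  set Φ : ℝ → EuclideanSpace ℝ (Fin d) → ℝ≥0∞ := fun t y =>
    wInt θ p fun x => ‖f (expRotation S t x - √(s₀ * t) • y) - f x‖ₑ with hΦ
  have hm : ∀ t, Measurable fun q : EuclideanSpace ℝ (Fin d) × EuclideanSpace ℝ (Fin d) =>
      ENNReal.ofReal (θ q.2) * ‖f (expRotation S t q.2 - √(s₀ * t) • q.1) - f q.2‖ₑ := fun t => by
    have h1 : StronglyMeasurable fun q : EuclideanSpace ℝ (Fin d) × EuclideanSpace ℝ (Fin d) =>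
        f (expRotation S t q.2 - √(s₀ * t) • q.1) := hf.comp_measurable (by fun_prop)
    have h2 := (h1.sub (hf.comp_measurable measurable_snd)).enorm
    exact Measurable.mul (by fun_prop) h2
  have h1 : ∀ t, wInt θ p (incrementAvg S s₀ t f) ≤ ∫⁻ y, gaussDensity 1 y * Φ t y := fun t => by
    have h2 := lintegral_lintegral_mul_rpow_le (m := volume) (ν := volume) hp
      (ρ := fun y : EuclideanSpace ℝ (Fin d) => gaussDensity 1 y) (by fun_prop)
      (f := fun y x => ENNReal.ofReal (θ x) * ‖f (expRotation S t x - √(s₀ * t) • y) - f x‖ₑ) (hm t)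
    rw [lintegral_gaussDensity_one hd, ENNReal.one_rpow, one_mul] at h2
    refine le_trans (le_of_eq (lintegral_congr fun x => ?_)) h2
    rw [incrementAvg, ← lintegral_const_mul' _ _ ENNReal.ofReal_ne_top]
    congr 2
    ext1 y
    ring
  have hΦt : ∀ y, Tendsto (fun t => gaussDensity 1 y * Φ t y) (𝓝[>] 0) (𝓝 0) := fun y => by
    have h2 := ((ENNReal.continuous_rpow_const (y := p)).tendsto 0).comp
      (tendsto_wNorm_rotShift (s₀ := s₀) hS hp hθ hW hf hfn y)
    rw [ENNReal.zero_rpow_of_pos hp0] at h2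
    have h3 := ENNReal.Tendsto.const_mul (a := gaussDensity 1 y)
      (h2.mono_left (nhdsWithin_le_nhds (s := Ioi 0)))
      (Or.inr ENNReal.ofReal_ne_top)
    rw [mul_zero] at h3
    refine h3.congr fun t => ?_
    rw [Function.comp_apply, wNorm_rpow hθ.pos hp]
  have hbd : ∀ t ∈ Ioc (0 : ℝ) 1, ∀ y, Φ t y ≤ (ENNReal.ofReal (Cθ + 1) * wNorm θ p f) ^ p *
      ENNReal.ofReal (Real.exp (p * η * √s₀ * ‖y‖)) := fun t ht y => by
    have hfc : AEStronglyMeasurable (fun x => f (expRotation S t x - √(s₀ * t) • y)) volume :=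
      (hf.comp_measurable (by fun_prop)).aestronglyMeasurable
    have h2 := wNorm_sub_le hθ.continuous hp hfc hf.aestronglyMeasurable
    have h3 : ENNReal.ofReal (Cθ * Real.exp (η * (√(s₀ * t) * ‖y‖))) * wNorm θ p f + wNorm θ p f ≤
        ENNReal.ofReal (Cθ + 1) * wNorm θ p f * ENNReal.ofReal (Real.exp (η * √s₀ * ‖y‖)) := by
      have h4 : √(s₀ * t) ≤ √s₀ := Real.sqrt_le_sqrt (mul_le_of_le_one_right hs₀.le ht.2)
      have h5 : Real.exp (η * (√(s₀ * t) * ‖y‖)) ≤ Real.exp (η * √s₀ * ‖y‖) := by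
        rw [mul_assoc]
        gcongr
      have h6 : 1 ≤ Real.exp (η * √s₀ * ‖y‖) := Real.one_le_exp (by positivity)
      calc _ = ENNReal.ofReal (Cθ * Real.exp (η * (√(s₀ * t) * ‖y‖)) + 1) * wNorm θ p f := by
            rw [ENNReal.ofReal_add (by positivity) zero_le_one, ENNReal.ofReal_one]
            ring
        _ ≤ ENNReal.ofReal ((Cθ + 1) * Real.exp (η * √s₀ * ‖y‖)) * wNorm θ p f := by
            gcongr
            nlinarith
        _ = _ := by
            rw [ENNReal.ofReal_mul (by positivity)]
            ring
    rw [hΦ]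
    simp only
    rw [← wNorm_rpow hθ.pos hp]
    refine (ENNReal.rpow_le_rpow (h2.trans ((add_le_add_left (wNorm_rotShift_le hS hθ hf t y) _).trans
      h3)) hp0.le).trans (le_of_eq ?_)
    rw [ENNReal.mul_rpow_of_nonneg _ _ hp0.le, ENNReal.ofReal_rpow_of_pos (Real.exp_pos _),
      ← Real.exp_mul]
    congr 3
    ring
  have hfin : (ENNReal.ofReal (Cθ + 1) * wNorm θ p f) ^ p ≠ ⊤ :=
    ENNReal.rpow_ne_top_of_nonneg hp0.le (ENNReal.mul_ne_top ENNReal.ofReal_ne_top hfn.ne)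
  have h2 := tendsto_lintegral_filter_of_dominated_convergence (μ := volume) (l := 𝓝[>] (0 : ℝ))
    (F := fun t y => gaussDensity 1 y * Φ t y) (f := fun _ => 0)
    (fun y => (ENNReal.ofReal (Cθ + 1) * wNorm θ p f) ^ p *
      (gaussDensity 1 y * ENNReal.ofReal (Real.exp (p * η * √s₀ * ‖y‖))))
    (Eventually.of_forall fun t => ?_) ?_ ?_ (Eventually.of_forall hΦt)
  · rw [lintegral_zero] at h2
    exact tendsto_of_tendsto_of_tendsto_of_le_of_le tendsto_const_nhds h2 (fun _ => zero_le) h1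
  · have hΦm : Measurable (Φ t) :=
      Measurable.lintegral_prod_right' (f := fun q : EuclideanSpace ℝ (Fin d) × EuclideanSpace ℝ (Fin d) =>
        (ENNReal.ofReal (θ q.2) * ‖f (expRotation S t q.2 - √(s₀ * t) • q.1) - f q.2‖ₑ) ^ p)
        ((hm t).pow_const p)
    fun_prop
  · filter_upwards [Ioc_mem_nhdsGT (zero_lt_one' ℝ)] with t ht
    refine Eventually.of_forall fun y => ?_
    refine (mul_le_mul_right (hbd t ht y) _).trans (le_of_eq ?_)
    ring
  · rw [lintegral_const_mul' _ _ hfin]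
    exact ENNReal.mul_ne_top hfin (expMoment_lt_top hd _).ne

namespace IsHeatKernel

theorem integrable_kernel (hK : IsHeatKernel S K K' c b s₀ a) {t : ℝ} (ht : 0 < t) :
    Integrable fun ψ => K t ψ := by
  have hs₀ := hK.scale_pos
  refine ⟨(hK.stronglyMeasurable_comp (t := fun _ => t) (by fun_prop)
    measurable_id).aestronglyMeasurable, ?_⟩
  refine (lintegral_mono (hK.bound t ht)).trans_lt ?_
  rw [lintegral_const_mul' _ _ ENNReal.ofReal_ne_top]
  have := lintegral_gaussDensity_mul (d := d) (s := s₀ * t) (by positivity) fun _ => 1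
  simp only [mul_one, lintegral_gaussDensity_one hK.dim_pos] at this
  rw [this, mul_one]
  exact ENNReal.ofReal_lt_top

/-- Removing (m(t) - 1)f(x), with m(t) the total mass of the kernel, leaves ∫ K(f(ξ) - f(x)) dξ, in
which only increments of f appear. -/
theorem enorm_heatOp_sub_le (hK : IsHeatKernel S K K' c b s₀ a) (hf : StronglyMeasurable f)
    {t : ℝ} (ht : 0 < t) {x : EuclideanSpace ℝ (Fin d)}
    (hx : gaussAvg S s₀ t (fun ξ => ‖f ξ‖ₑ) x < ⊤) :
    ‖heatOp S K t f x - f x - ((∫ ψ, K t ψ) - 1) (f x)‖ₑ ≤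
      ENNReal.ofReal (c * Real.exp (-b * t)) * incrementAvg S s₀ t f x := by
  have hi : Integrable fun ξ => K t (expRotation S t x - ξ) := (hK.integrable_kernel ht).comp_sub_left _
  have h1 : (∫ ψ, K t ψ) (f x) = ∫ ξ, K t (expRotation S t x - ξ) (f x) := by
    rw [← integral_sub_left_eq_self _ volume (expRotation S t x), ContinuousLinearMap.integral_apply hi]
  have h2 : heatOp S K t f x - f x - ((∫ ψ, K t ψ) - 1) (f x)
      = ∫ ξ, K t (expRotation S t x - ξ) (f ξ - f x) := by
    simp only [map_sub]
    rw [integral_sub (hK.integrable_kernel_apply hf ht hx) (hi.apply_continuousLinearMap _), ← h1,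
      sub_apply, one_apply_eq_self, heatOp]
    abel
  rw [h2]
  refine (enorm_integral_le_lintegral_enorm _).trans ?_
  refine le_trans (lintegral_mono fun ξ => ContinuousLinearMap.le_opENorm _ _)
    (hK.lintegral_kernel_le ht x fun ξ => ‖f ξ - f x‖ₑ)

/-- Strong continuity of the semigroup at `t = 0`. -/
theorem tendsto_wNorm_heatOp_sub (hK : IsHeatKernel S K K' c b s₀ a) (hp : 1 ≤ p)
    (hθ : IsRadialWeight θ η Cθ) (hW : WeightTranslationContinuous θ) (hf : StronglyMeasurable f)
    (hfn : wNorm θ p f < ⊤) :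
    Tendsto (fun t => wNorm θ p fun x => heatOp S K t f x - f x) (𝓝[>] 0) (𝓝 0) := by
  have hp0 : 0 < p := by linarith
  have hfn' := hfn
  rw [wNorm_lt_top_iff hθ.pos hp] at hfn'
  have h1 : ∀ᶠ t in 𝓝[>] (0 : ℝ), wNorm θ p (fun x => heatOp S K t f x - f x) ≤
      ENNReal.ofReal (c * Real.exp (-b * t)) * wInt θ p (incrementAvg S s₀ t f) ^ (1 / p) +
      ‖(∫ ψ, K t ψ) - 1‖ₑ * wNorm θ p f := by
    filter_upwards [self_mem_nhdsWithin] with t ht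
    have hm1 : AEStronglyMeasurable (fun x => heatOp S K t f x - f x - ((∫ ψ, K t ψ) - 1) (f x))
        volume :=
      ((hK.stronglyMeasurable_heatOp hf measurable_const measurable_id).sub hf).aestronglyMeasurable.sub
        ((ContinuousLinearMap.continuous _).comp_aestronglyMeasurable hf.aestronglyMeasurable)
    have hm2 : AEStronglyMeasurable (fun x => ((∫ ψ, K t ψ) - 1) (f x)) volume :=
      (ContinuousLinearMap.continuous _).comp_aestronglyMeasurable hf.aestronglyMeasurable
    have h2 := wNorm_add_le hθ.continuous hp hm1 hm2
    simp only [sub_add_cancel] at h2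
    refine h2.trans (add_le_add ?_ ?_)
    · refine wNorm_le_of_ae_le hθ.pos hp ENNReal.ofReal_ne_top ?_
      filter_upwards [hK.ae_gaussAvg_lt_top hθ hp t hf.enorm hfn'] with x hx
      exact hK.enorm_heatOp_sub_le hf ht hx
    · rw [wNorm_eq hθ.pos hp f]
      exact wNorm_le_of_ae_le hθ.pos hp enorm_ne_top
        (Eventually.of_forall fun x => ContinuousLinearMap.le_opENorm _ _)
  have h2 : Tendsto (fun t : ℝ => ENNReal.ofReal (c * Real.exp (-b * t))) (𝓝[>] 0)
      (𝓝 (ENNReal.ofReal (c * Real.exp (-b * 0)))) := by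
    have : Continuous fun t : ℝ => ENNReal.ofReal (c * Real.exp (-b * t)) :=
      ENNReal.continuous_ofReal.comp (by fun_prop)
    exact (this.tendsto 0).mono_left nhdsWithin_le_nhds
  have h3 : Tendsto (fun t => wInt θ p (incrementAvg S s₀ t f) ^ (1 / p)) (𝓝[>] 0) (𝓝 0) := by
    have := ((ENNReal.continuous_rpow_const (y := 1 / p)).tendsto 0).comp
      (tendsto_wInt_incrementAvg hK.dim_pos hK.scale_pos hK.skew hp hθ hW hf hfn)
    rwa [ENNReal.zero_rpow_of_pos (by positivity)] at this
  have h4 := ENNReal.Tendsto.mul h2 (Or.inr ENNReal.zero_ne_top) h3 (Or.inr ENNReal.ofReal_ne_top)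
  have h5 : Tendsto (fun t => ‖(∫ ψ, K t ψ) - 1‖ₑ) (𝓝[>] 0) (𝓝 0) := by
    have h0 := hK.tendsto.sub_const 1
    rw [sub_self] at h0
    have := ENNReal.tendsto_ofReal (tendsto_zero_iff_norm_tendsto_zero.1 h0)
    simpa only [ofReal_norm, ENNReal.ofReal_zero] using this
  have h6 := ENNReal.Tendsto.mul_const h5 (Or.inr hfn.ne)
  have h7 := h4.add h6
  rw [mul_zero, zero_mul, add_zero] at h7
  exact tendsto_of_tendsto_of_tendsto_of_le_of_le' tendsto_const_nhds h7
    (Eventually.of_forall fun _ => zero_le) h1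

end IsHeatKernel

end StrongContinuity

/-! ### The resolvent as inverse of λI - A -/

section Generator
variable {d N : ℕ} {S : Matrix (Fin d) (Fin d) ℝ}
  {K : ℝ → EuclideanSpace ℝ (Fin d) → EuclideanSpace ℂ (Fin N) →L[ℂ] EuclideanSpace ℂ (Fin N)}
  {K' : ℝ → EuclideanSpace ℝ (Fin d) → EuclideanSpace ℝ (Fin d) →
      EuclideanSpace ℂ (Fin N) →L[ℂ] EuclideanSpace ℂ (Fin N)} {c b s₀ a : ℝ}
  {f v w : EuclideanSpace ℝ (Fin d) → EuclideanSpace ℂ (Fin N)}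
  {θ : EuclideanSpace ℝ (Fin d) → ℝ} {η Cθ p : ℝ} {lam : ℂ}

theorem wNorm_smul_add_smul_le (hθc : Continuous θ) (hp : 1 ≤ p) (hv : StronglyMeasurable v)
    (hw : StronglyMeasurable w) (α β : ℂ) :
    wNorm θ p (fun x => α • v x + β • w x) ≤ ‖α‖ₑ * wNorm θ p v + ‖β‖ₑ * wNorm θ p w := by
  rw [← wNorm_const_smul, ← wNorm_const_smul]
  exact wNorm_add_le hθc hp (v := fun x => α • v x) (w := fun x => β • w x)
    (hv.const_smul α).aestronglyMeasurable (hw.const_smul β).aestronglyMeasurable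

theorem tendsto_exp_mul_sub_div (lam : ℂ) :
    Tendsto (fun h : ℝ => ((h⁻¹ : ℝ) : ℂ) * (Complex.exp (lam * h) - 1) - lam) (𝓝[>] 0) (𝓝 0) := by
  have h1 : HasDerivAt (fun h : ℝ => Complex.exp (lam * h)) lam 0 := by
    have h2 : HasDerivAt (fun h : ℝ => lam * (h : ℂ)) lam 0 := by
      have := (hasDerivAt_id (0 : ℝ)).ofReal_comp.const_mul lam
      simpa using this
    simpa using h2.cexp
  have h3 := h1.tendsto_slope_zero_right
  have h4 := h3.sub_const lam
  rw [sub_self] at h4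
  refine h4.congr fun h => ?_
  simp

theorem tendsto_exp_sub_one (lam : ℂ) :
    Tendsto (fun h : ℝ => Complex.exp (lam * h) - 1) (𝓝[>] 0) (𝓝 0) := by
  have : Continuous fun h : ℝ => Complex.exp (lam * h) - 1 := by fun_prop
  exact (this.tendsto' 0 0 (by simp)).mono_left nhdsWithin_le_nhds

theorem tendsto_enorm_zero {u : ℝ → ℂ} {l : Filter ℝ} (h : Tendsto u l (𝓝 0)) :
    Tendsto (fun t => ‖u t‖ₑ) l (𝓝 0) := by
  have := ENNReal.tendsto_ofReal (tendsto_zero_iff_norm_tendsto_zero.1 h)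
  simpa only [ofReal_norm, ENNReal.ofReal_zero] using this

namespace IsHeatKernel

theorem tendsto_wNorm_exp_smul_heatOp_sub (hK : IsHeatKernel S K K' c b s₀ a) (hp : 1 ≤ p)
    (hθ : IsRadialWeight θ η Cθ) (hW : WeightTranslationContinuous θ) (hf : StronglyMeasurable f)
    (hfn : wNorm θ p f < ⊤) (lam : ℂ) :
    Tendsto (fun t : ℝ => wNorm θ p fun x => Complex.exp (-(lam * t)) • heatOp S K t f x - f x)
      (𝓝[>] 0) (𝓝 0) := by
  have h1 := hK.tendsto_wNorm_heatOp_sub hp hθ hW hf hfn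
  have h2 : Tendsto (fun t : ℝ => Complex.exp (-lam * t)) (𝓝[>] 0) (𝓝 1) := by
    have : Continuous fun h : ℝ => Complex.exp (-lam * h) := by fun_prop
    exact (this.tendsto' 0 1 (by simp)).mono_left nhdsWithin_le_nhds
  have h3 : Tendsto (fun t : ℝ => ‖Complex.exp (-lam * t)‖ₑ) (𝓝[>] 0) (𝓝 1) := by
    have := ENNReal.tendsto_ofReal h2.norm
    simpa only [ofReal_norm, norm_one, ENNReal.ofReal_one] using this
  have h4 := tendsto_enorm_zero (tendsto_exp_sub_one (-lam))
  have h5 := (ENNReal.Tendsto.mul h3 (Or.inr ENNReal.zero_ne_top) h1 (Or.inr ENNReal.one_ne_top)).add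
    (ENNReal.Tendsto.mul_const h4 (Or.inr hfn.ne))
  rw [mul_zero, zero_mul, add_zero] at h5
  refine tendsto_of_tendsto_of_tendsto_of_le_of_le tendsto_const_nhds h5 (fun _ => zero_le) fun t => ?_
  have hm := (hK.stronglyMeasurable_heatOp hf (measurable_const (a := t)) measurable_id).sub hf
  refine le_trans (le_of_eq ?_) (wNorm_smul_add_smul_le hθ.continuous hp hm hf
    (Complex.exp (-lam * t)) (Complex.exp (-lam * t) - 1))
  congr 1
  ext1 x
  simp only [Pi.sub_apply, neg_mul, id_eq]
  module

/-- Minkowski's integral inequality for a time average, obtained from Jensen with the uniform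
density 1/h on (0, h]. -/
theorem wNorm_average_le (hK : IsHeatKernel S K K' c b s₀ a) (hp : 1 ≤ p)
    (hθ : IsRadialWeight θ η Cθ) (hf : StronglyMeasurable f) (lam : ℂ) {h : ℝ} (hh : 0 < h) {M : ℝ≥0∞}
    (hM : ∀ t ∈ Ioc 0 h,
      wNorm θ p (fun x => Complex.exp (-(lam * t)) • heatOp S K t f x - f x) ≤ M) :
    wNorm θ p (fun x => h⁻¹ • ∫ t in Ioc 0 h, (Complex.exp (-(lam * t)) • heatOp S K t f x - f x)) ≤ M := by
  have hp0 : 0 < p := by linarith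
  have hθm := hθ.continuous.measurable
  have hm : StronglyMeasurable fun q : ℝ × EuclideanSpace ℝ (Fin d) =>
      Complex.exp (-(lam * q.1)) • heatOp S K q.1 f q.2 - f q.2 := by
    have h1 : Measurable fun q : ℝ × EuclideanSpace ℝ (Fin d) => Complex.exp (-(lam * q.1)) := by
      fun_prop
    exact (h1.stronglyMeasurable.smul
      (hK.stronglyMeasurable_heatOp hf measurable_fst measurable_snd)).sub
      (hf.comp_measurable measurable_snd)
  have hρ : ∫⁻ _ in Ioc 0 h, ENNReal.ofReal h⁻¹ = 1 := by
    rw [setLIntegral_const, Real.volume_Ioc, sub_zero, ← ENNReal.ofReal_mul (by positivity),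
      inv_mul_cancel₀ hh.ne', ENNReal.ofReal_one]
  have h1 : ∀ x, ‖h⁻¹ • ∫ t in Ioc 0 h, (Complex.exp (-(lam * t)) • heatOp S K t f x - f x)‖ₑ ≤
      1 * ∫⁻ t in Ioc 0 h, ENNReal.ofReal h⁻¹ * ‖Complex.exp (-(lam * t)) • heatOp S K t f x - f x‖ₑ :=
    fun x => by
      rw [one_mul, lintegral_const_mul' _ _ ENNReal.ofReal_ne_top, enorm_smul,
        Real.enorm_of_nonneg (by positivity)]
      gcongr
      exact enorm_integral_le_lintegral_enorm _
  refine (wNorm_le_of_ae_le hθ.pos hp ENNReal.one_ne_top (Eventually.of_forall h1)).trans ?_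
  rw [one_mul]
  have h2 := lintegral_lintegral_mul_rpow_le (m := volume.restrict (Ioc 0 h)) (ν := volume) hp
    (ρ := fun _ => ENNReal.ofReal h⁻¹) measurable_const
    (f := fun (t : ℝ) x => ENNReal.ofReal (θ x) *
      ‖Complex.exp (-(lam * t)) • heatOp S K t f x - f x‖ₑ)
    (Measurable.mul (by fun_prop) hm.enorm)
  rw [hρ, ENNReal.one_rpow, one_mul] at h2
  have h3 : wInt θ p (fun x => ∫⁻ t in Ioc 0 h, ENNReal.ofReal h⁻¹ *
      ‖Complex.exp (-(lam * t)) • heatOp S K t f x - f x‖ₑ) ≤ M ^ p := by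
    calc _ = ∫⁻ x, (∫⁻ t in Ioc 0 h, ENNReal.ofReal h⁻¹ * (ENNReal.ofReal (θ x) *
          ‖Complex.exp (-(lam * t)) • heatOp S K t f x - f x‖ₑ)) ^ p := by
          refine lintegral_congr fun x => ?_
          rw [← lintegral_const_mul' _ _ ENNReal.ofReal_ne_top]
          congr 2
          ext1 t
          ring
      _ ≤ _ := h2
      _ ≤ ∫⁻ _ in Ioc 0 h, ENNReal.ofReal h⁻¹ * M ^ p := by
          refine setLIntegral_mono' measurableSet_Ioc fun t ht => mul_le_mul_right ?_ _
          have h4 := ENNReal.rpow_le_rpow (hM t ht) hp0.le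
          rwa [wNorm_rpow hθ.pos hp] at h4
      _ = M ^ p := by
          rw [lintegral_mul_const _ measurable_const, hρ, one_mul]
  calc _ ≤ (M ^ p) ^ (1 / p) := ENNReal.rpow_le_rpow h3 (by positivity)
    _ = M := by rw [← ENNReal.rpow_mul, mul_one_div_cancel hp0.ne', ENNReal.rpow_one]

theorem tendsto_wNorm_average (hK : IsHeatKernel S K K' c b s₀ a) (hp : 1 ≤ p)
    (hθ : IsRadialWeight θ η Cθ) (hW : WeightTranslationContinuous θ) (hf : StronglyMeasurable f)
    (hfn : wNorm θ p f < ⊤) (lam : ℂ) :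
    Tendsto (fun h : ℝ => wNorm θ p fun x =>
      h⁻¹ • ∫ t in Ioc 0 h, (Complex.exp (-(lam * t)) • heatOp S K t f x - f x)) (𝓝[>] 0) (𝓝 0) := by
  rw [ENNReal.tendsto_nhds_zero]
  intro ε hε
  have h1 := ENNReal.tendsto_nhds_zero.1
    (hK.tendsto_wNorm_exp_smul_heatOp_sub hp hθ hW hf hfn lam) ε hε
  obtain ⟨δ, hδ, hδ'⟩ := mem_nhdsGT_iff_exists_Ioc_subset.1 h1
  filter_upwards [Ioc_mem_nhdsGT hδ] with h hh
  exact hK.wNorm_average_le hp hθ hf lam hh.1 fun t ht => hδ' ⟨ht.1, ht.2.trans hh.2⟩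

set_option maxHeartbeats 400000 in
/-- The range of the resolvent lies in the domain of the generator. -/
theorem tendsto_wNorm_quotient_resolventOp (hK : IsHeatKernel S K K' c b s₀ a)
    (hθ : IsRadialWeight θ η Cθ) (hp : 1 ≤ p) (hW : WeightTranslationContinuous θ)
    (hlam : s₀ * η ^ 2 * p / 4 < lam.re + b) (hf : StronglyMeasurable f) (hfn : wNorm θ p f < ⊤) :
    Tendsto (fun h : ℝ => wNorm θ p fun x => h⁻¹ • (heatOp S K h (resolventOp S K lam f) x -
      resolventOp S K lam f x) - (lam • resolventOp S K lam f x - f x)) (𝓝[>] 0) (𝓝 0) := by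
  have hfn' := hfn
  rw [wNorm_lt_top_iff hθ.pos hp] at hfn'
  obtain ⟨C, hC, hle⟩ := hK.exists_wNorm_resolventOp_le hθ hp hlam
  have hRn : wNorm θ p (resolventOp S K lam f) < ⊤ :=
    (hle f hf).trans_lt (ENNReal.mul_lt_top hC.lt_top hfn)
  have hRm := hK.stronglyMeasurable_resolventOp hf lam
  have e1 : ∀ᶠ h : ℝ in 𝓝[>] 0, wNorm θ p (fun x => h⁻¹ • (heatOp S K h (resolventOp S K lam f) x -
      resolventOp S K lam f x) - (lam • resolventOp S K lam f x - f x)) ≤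
      ‖((h⁻¹ : ℝ) : ℂ) * (Complex.exp (lam * h) - 1) - lam‖ₑ * wNorm θ p (resolventOp S K lam f) +
      (‖Complex.exp (lam * h)‖ₑ * wNorm θ p (fun x =>
        h⁻¹ • ∫ t in Ioc 0 h, (Complex.exp (-(lam * t)) • heatOp S K t f x - f x)) +
      ‖Complex.exp (lam * h) - 1‖ₑ * wNorm θ p f) := by
    filter_upwards [self_mem_nhdsWithin] with h hh
    set D : EuclideanSpace ℝ (Fin d) → EuclideanSpace ℂ (Fin N) := fun x =>
        h⁻¹ • ∫ t in Ioc 0 h, (Complex.exp (-(lam * t)) • heatOp S K t f x - f x) with hD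
    have hDm : StronglyMeasurable D := by
      have h2 : StronglyMeasurable fun q : EuclideanSpace ℝ (Fin d) × ℝ =>
          Complex.exp (-(lam * q.2)) • heatOp S K q.2 f q.1 - f q.1 := by
        have h1 : Measurable fun q : EuclideanSpace ℝ (Fin d) × ℝ => Complex.exp (-(lam * q.2)) := by
          fun_prop
        exact (h1.stronglyMeasurable.smul
          (hK.stronglyMeasurable_heatOp hf measurable_snd measurable_fst)).sub
          (hf.comp_measurable measurable_fst)
      exact (h2.integral_prod_right (ν := volume.restrict (Ioc 0 h))).const_smul h⁻¹
    -- By `heatOp_resolventOp_eq` the error of the difference quotient is (h⁻¹(e^{λh} - 1) - λ)Rf -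
    -- e^{λh}D - (e^{λh} - 1)f, where D is the average of e^{-λt}T(t)f - f over (0, h]. Each of the
    -- three terms tends to 0.
    have hae : (fun x => h⁻¹ • (heatOp S K h (resolventOp S K lam f) x -
        resolventOp S K lam f x) - (lam • resolventOp S K lam f x - f x)) =ᵐ[volume] fun x =>
        (((h⁻¹ : ℝ) : ℂ) * (Complex.exp (lam * h) - 1) - lam) • resolventOp S K lam f x +
        (-1 : ℂ) • (Complex.exp (lam * h) • D x + (Complex.exp (lam * h) - 1) • f x) := by
      filter_upwards [hK.heatOp_resolventOp_eq hθ hp hlam hf hfn hh,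
        hK.ae_laplaceAvg_lt_top hθ hp hlam hf.enorm hfn'] with x hx hx'
      have hi : IntegrableOn (fun t : ℝ => Complex.exp (-(lam * t)) • heatOp S K t f x) (Ioc 0 h) :=
        (hK.integrableOn_exp_smul_heatOp hf hx').mono_set Ioc_subset_Ioi_self
      have h3 : D x = ((h⁻¹ : ℝ) : ℂ) •
          (∫ t in Ioc 0 h, Complex.exp (-(lam * t)) • heatOp S K t f x) - f x := by
        have h4 : ((h⁻¹ : ℝ) : ℂ) * (h : ℂ) = 1 := by
          rw [← Complex.ofReal_mul, inv_mul_cancel₀ (ne_of_gt hh), Complex.ofReal_one]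
        rw [hD]
        simp only
        rw [integral_sub hi (integrable_const _), setIntegral_const, Real.volume_real_Ioc_of_le
          (le_of_lt hh), sub_zero, ← Complex.coe_smul, ← Complex.coe_smul, smul_sub, smul_smul, h4, one_smul]
      rw [hx, h3, ← Complex.coe_smul]
      generalize (∫ t in Ioc 0 h, Complex.exp (-(lam * t)) • heatOp S K t f x) = J
      module
    rw [wNorm_congr hae]
    have hin : StronglyMeasurable fun x =>
        Complex.exp (lam * h) • D x + (Complex.exp (lam * h) - 1) • f x :=
      (hDm.const_smul (Complex.exp (lam * h))).add (hf.const_smul (Complex.exp (lam * h) - 1))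
    refine (wNorm_smul_add_smul_le hθ.continuous hp hRm hin _ _).trans (add_le_add le_rfl ?_)
    rw [enorm_neg, enorm_one, one_mul]
    exact wNorm_smul_add_smul_le hθ.continuous hp hDm hf _ _
  have t1 := ENNReal.Tendsto.mul_const (tendsto_enorm_zero (tendsto_exp_mul_sub_div lam))
    (Or.inr hRn.ne)
  have t2 := ENNReal.Tendsto.mul_const (tendsto_enorm_zero (tendsto_exp_sub_one lam)) (Or.inr hfn.ne)
  have t3 : Tendsto (fun t : ℝ => ‖Complex.exp (lam * t)‖ₑ) (𝓝[>] 0) (𝓝 1) := by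
    have h2 : Continuous fun h : ℝ => Complex.exp (lam * h) := by fun_prop
    have := ENNReal.tendsto_ofReal
      ((h2.tendsto' 0 1 (by simp)).mono_left (nhdsWithin_le_nhds (s := Ioi 0))).norm
    simpa only [ofReal_norm, norm_one, ENNReal.ofReal_one] using this
  have t4 := ENNReal.Tendsto.mul t3 (Or.inr ENNReal.zero_ne_top)
    (hK.tendsto_wNorm_average hp hθ hW hf hfn lam) (Or.inr ENNReal.one_ne_top)
  have t5 := t1.add (t4.add t2)
  rw [zero_mul, mul_zero, zero_mul, add_zero, add_zero] at t5
  exact tendsto_of_tendsto_of_tendsto_of_le_of_le' tendsto_const_nhds t5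
    (Eventually.of_forall fun _ => zero_le) e1

set_option maxHeartbeats 400000 in
/-- The resolvent is a left inverse of `λ I - A`. -/
theorem eq_resolventOp_of_tendsto (hK : IsHeatKernel S K K' c b s₀ a)
    (hθ : IsRadialWeight θ η Cθ) (hp : 1 ≤ p) (hW : WeightTranslationContinuous θ)
    (hlam : s₀ * η ^ 2 * p / 4 < lam.re + b) (hv : StronglyMeasurable v) (hvn : wNorm θ p v < ⊤)
    (hw : StronglyMeasurable w) (hwn : wNorm θ p w < ⊤)
    (h : Tendsto (fun h : ℝ => wNorm θ p fun x => h⁻¹ • (heatOp S K h v x - v x) - w x)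
      (𝓝[>] 0) (𝓝 0)) :
    v =ᵐ[volume] resolventOp S K lam fun x => lam • v x - w x := by
  have hvn' := hvn
  have hwn' := hwn
  rw [wNorm_lt_top_iff hθ.pos hp] at hvn' hwn'
  obtain ⟨C, hC, hle⟩ := hK.exists_wNorm_resolventOp_le hθ hp hlam
  have hRv := hK.stronglyMeasurable_resolventOp hv lam
  have hRw := hK.stronglyMeasurable_resolventOp hw lam
  -- The difference quotient of Rv has two limits. It tends to λRv - v because Rv lies in the
  -- domain, and to Rw because R is bounded and commutes with T(h). Comparing them gives v = R(λv -
  -- w).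
  set q : ℝ → EuclideanSpace ℝ (Fin d) → EuclideanSpace ℂ (Fin N) := fun h x =>
    h⁻¹ • (heatOp S K h (resolventOp S K lam v) x - resolventOp S K lam v x) with hq
  have hqm : ∀ h, StronglyMeasurable (q h) := fun h =>
    ((hK.stronglyMeasurable_heatOp hRv measurable_const measurable_id).sub hRv).const_smul h⁻¹
  have t1 : Tendsto (fun h : ℝ => wNorm θ p fun x => q h x - (lam • resolventOp S K lam v x - v x))
      (𝓝[>] 0) (𝓝 0) := hK.tendsto_wNorm_quotient_resolventOp hθ hp hW hlam hv hvn
  have t2 : Tendsto (fun h : ℝ => wNorm θ p fun x => q h x - resolventOp S K lam w x)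
      (𝓝[>] 0) (𝓝 0) := by
    have h1 := ENNReal.Tendsto.const_mul h (Or.inr hC)
    rw [mul_zero] at h1
    refine tendsto_of_tendsto_of_tendsto_of_le_of_le' tendsto_const_nhds h1
      (Eventually.of_forall fun _ => zero_le) ?_
    filter_upwards [self_mem_nhdsWithin] with h hh
    have hTv : StronglyMeasurable (heatOp S K h v) :=
      hK.stronglyMeasurable_heatOp hv measurable_const measurable_id
    have hTn := hK.wNorm_heatOp_lt_top hθ hp hh hv hvn
    have hTn' := hTn
    rw [wNorm_lt_top_iff hθ.pos hp] at hTn'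
    refine le_trans (le_of_eq (wNorm_congr ?_)) (hle _ ?_)
    · have hdn : wNorm θ p (fun x => ((1 : ℂ) • heatOp S K h v x + (-1 : ℂ) • v x)) < ⊤ := by
        refine (wNorm_smul_add_smul_le hθ.continuous hp hTv hv 1 (-1)).trans_lt ?_
        exact ENNReal.add_lt_top.2 ⟨ENNReal.mul_lt_top enorm_lt_top hTn,
          ENNReal.mul_lt_top enorm_lt_top hvn⟩
      rw [wNorm_lt_top_iff hθ.pos hp] at hdn
      have hdm : StronglyMeasurable fun x => ((1 : ℂ) • heatOp S K h v x + (-1 : ℂ) • v x) :=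
        (hTv.const_smul (1 : ℂ)).add (hv.const_smul (-1 : ℂ))
      have e : (fun x => h⁻¹ • (heatOp S K h v x - v x) - w x) = fun x =>
          ((h⁻¹ : ℝ) : ℂ) • ((1 : ℂ) • heatOp S K h v x + (-1 : ℂ) • v x) + (-1 : ℂ) • w x := by
        ext1 x
        rw [← Complex.coe_smul]
        module
      filter_upwards [hK.ae_laplaceAvg_lt_top hθ hp hlam hv.enorm hvn',
        hK.ae_laplaceAvg_lt_top hθ hp hlam hw.enorm hwn',
        hK.ae_laplaceAvg_lt_top hθ hp hlam hTv.enorm hTn',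
        hK.ae_laplaceAvg_lt_top hθ hp hlam hdm.enorm hdn,
        hK.heatOp_resolventOp hθ hp hlam hv hvn hh,
        hK.resolventOp_heatOp hθ hp hlam hv hvn hh] with x h1 h2 h3 h4 h5 h6
      rw [e, hK.resolventOp_add_smul hdm hw _ _ h4 h2, hK.resolventOp_add_smul hTv hv _ _ h3 h1, h6, ← h5,
        hq]
      simp only
      rw [← Complex.coe_smul]
      module
    · exact ((hTv.sub hv).const_smul h⁻¹).sub hw
  have hz : wNorm θ p (fun x => resolventOp S K lam w x - (lam • resolventOp S K lam v x - v x)) = 0 := by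
    have t3 := t1.add t2
    rw [add_zero] at t3
    refine le_antisymm (ge_of_tendsto' t3 fun h => ?_) zero_le
    refine le_trans (le_of_eq ?_) (wNorm_sub_le hθ.continuous hp
      (v := fun x => q h x - (lam • resolventOp S K lam v x - v x))
      (w := fun x => q h x - resolventOp S K lam w x)
      ((hqm h).sub ((hRv.const_smul lam).sub hv)).aestronglyMeasurable
      ((hqm h).sub hRw).aestronglyMeasurable)
    congr 1
    ext1 x
    abel
  have h0 := ae_eq_zero_of_wNorm hθ.pos hθ.continuous hp
    (hRw.sub ((hRv.const_smul lam).sub hv)).aestronglyMeasurable hz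
  filter_upwards [h0, hK.ae_laplaceAvg_lt_top hθ hp hlam hv.enorm hvn',
    hK.ae_laplaceAvg_lt_top hθ hp hlam hw.enorm hwn'] with x h1 h2 h3
  have e : (fun x => lam • v x - w x) = fun x => lam • v x + (-1 : ℂ) • w x := by
    ext1 x
    module
  rw [e, hK.resolventOp_add_smul hv hw _ _ h2 h3]
  simp only [Pi.sub_apply, Pi.smul_apply, Pi.zero_apply] at h1
  rw [sub_eq_zero] at h1
  rw [h1]
  module

end IsHeatKernel

end Generator

/-! ### Weak derivatives of the resolvent -/

section WeakDerivative
variable {d N : ℕ} {S : Matrix (Fin d) (Fin d) ℝ}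
  {K : ℝ → EuclideanSpace ℝ (Fin d) → EuclideanSpace ℂ (Fin N) →L[ℂ] EuclideanSpace ℂ (Fin N)}
  {K' : ℝ → EuclideanSpace ℝ (Fin d) → EuclideanSpace ℝ (Fin d) →
      EuclideanSpace ℂ (Fin N) →L[ℂ] EuclideanSpace ℂ (Fin N)} {c b s₀ a : ℝ}
  {g : EuclideanSpace ℝ (Fin d) → EuclideanSpace ℂ (Fin N)}
  {θ : EuclideanSpace ℝ (Fin d) → ℝ} {η Cθ p : ℝ} {lam : ℂ} {δ : ℝ}
  {G : EuclideanSpace ℝ (Fin d) → ℝ≥0∞}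

/-- The kernel of `resolventOp` differentiated in the direction `u`, as an integral operator. -/
noncomputable def resolventDeriv (S : Matrix (Fin d) (Fin d) ℝ)
    (K' : ℝ → EuclideanSpace ℝ (Fin d) → EuclideanSpace ℝ (Fin d) →
      EuclideanSpace ℂ (Fin N) →L[ℂ] EuclideanSpace ℂ (Fin N))
    (lam : ℂ) (u : EuclideanSpace ℝ (Fin d)) (g : EuclideanSpace ℝ (Fin d) → EuclideanSpace ℂ (Fin N))
    (x : EuclideanSpace ℝ (Fin d)) : EuclideanSpace ℂ (Fin N) :=
  ∫ q : ℝ × EuclideanSpace ℝ (Fin d), Complex.exp (-(lam * q.1)) •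
    K' q.1 (expRotation S q.1 x - q.2) (expRotation S q.1 u) (g q.2)
    ∂((volume.restrict (Ioi 0)).prod volume)

/-- The majorant of `resolventDeriv`. -/
noncomputable def derivAvg (S : Matrix (Fin d) (Fin d) ℝ) (s₀ δ : ℝ) (u : EuclideanSpace ℝ (Fin d))
    (G : EuclideanSpace ℝ (Fin d) → ℝ≥0∞) (x : EuclideanSpace ℝ (Fin d)) : ℝ≥0∞ :=
  ∫⁻ t in Ioi 0, ENNReal.ofReal (Real.exp (-(δ * t)) * t ^ (-(1 / 2) : ℝ)) *
    ∫⁻ y, gaussDensity 1 y * (ENNReal.ofReal |inner ℝ y (expRotation S t u)| *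
      G (expRotation S t x - √(s₀ * t) • y))

theorem measurable_derivAvg (hG : Measurable G) (u : EuclideanSpace ℝ (Fin d)) :
    Measurable (derivAvg S s₀ δ u G) := by
  have h1 : Measurable fun q : (EuclideanSpace ℝ (Fin d) × ℝ) × EuclideanSpace ℝ (Fin d) =>
      expRotation S q.1.2 u := by fun_prop
  have h : Measurable fun q : (EuclideanSpace ℝ (Fin d) × ℝ) × EuclideanSpace ℝ (Fin d) =>
      gaussDensity 1 q.2 * (ENNReal.ofReal |inner ℝ q.2 (expRotation S q.1.2 u)| *
        G (expRotation S q.1.2 q.1.1 - √(s₀ * q.1.2) • q.2)) := by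
    have h2 : Measurable fun q : (EuclideanSpace ℝ (Fin d) × ℝ) × EuclideanSpace ℝ (Fin d) =>
        inner ℝ q.2 (expRotation S q.1.2 u) := measurable_snd.inner h1
    have h3 : Measurable fun q : (EuclideanSpace ℝ (Fin d) × ℝ) × EuclideanSpace ℝ (Fin d) =>
        |inner ℝ q.2 (expRotation S q.1.2 u)| := h2.abs
    fun_prop
  have h' : Measurable fun q : EuclideanSpace ℝ (Fin d) × ℝ =>
      ENNReal.ofReal (Real.exp (-(δ * q.2)) * q.2 ^ (-(1 / 2) : ℝ)) *
      ∫⁻ y, gaussDensity 1 y * (ENNReal.ofReal |inner ℝ y (expRotation S q.2 u)| *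
        G (expRotation S q.2 q.1 - √(s₀ * q.2) • y)) :=
    Measurable.mul (by fun_prop) h.lintegral_prod_right'
  exact h'.lintegral_prod_right'

/-- On the support of ψ the weight is bounded below, so Jensen with density |ψ| bounds the pairing
by the weighted norm. -/
theorem lintegral_mul_lt_top_of_wInt (hθ : IsRadialWeight θ η Cθ) (hp : 1 ≤ p)
    {ψ : EuclideanSpace ℝ (Fin d) → ℝ} (hψ : Continuous ψ) (hψc : HasCompactSupport ψ)
    (hG : Measurable G) (h : wInt θ p G < ⊤) : ∫⁻ x, ‖ψ x‖ₑ * G x < ⊤ := by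
  have hp0 : 0 < p := by linarith
  have hpos : ∀ x, 0 < θ x ^ p := fun x => Real.rpow_pos_of_pos (hθ.pos x) p
  have hc : Continuous fun x => ψ x * (θ x ^ p)⁻¹ :=
    hψ.mul ((hθ.continuous.rpow_const fun x => Or.inl (hθ.pos x).ne').inv₀ fun x => (hpos x).ne')
  obtain ⟨D, hD⟩ := (hψc.mul_right (f' := fun x => (θ x ^ p)⁻¹)).exists_bound_of_continuous hc
  have hle : ∀ x, ‖ψ x‖ₑ * G x ^ p ≤ ENNReal.ofReal D * (ENNReal.ofReal (θ x) * G x) ^ p := fun x => by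
    rw [ENNReal.mul_rpow_of_nonneg _ _ hp0.le, ENNReal.ofReal_rpow_of_pos (hθ.pos x), ← mul_assoc,
      ← ENNReal.ofReal_mul' (hpos x).le, ← ofReal_norm]
    gcongr
    have : ‖ψ x * (θ x ^ p)⁻¹‖ ≤ D := hD x
    rw [norm_mul, norm_inv, Real.norm_of_nonneg (hpos x).le, ← div_eq_mul_inv,
      div_le_iff₀ (hpos x)] at this
    exact this
  have hψi : ∫⁻ x, ‖ψ x‖ₑ < ⊤ := (hψ.integrable_of_hasCompactSupport hψc).2
  have h1 := lintegral_mul_rpow_le (m := volume) hp (ρ := fun x => ‖ψ x‖ₑ)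
    hψ.measurable.enorm.aemeasurable hG.aemeasurable
  have h2 : ∫⁻ x, ‖ψ x‖ₑ * G x ^ p < ⊤ := by
    refine (lintegral_mono hle).trans_lt ?_
    rw [lintegral_const_mul' _ _ ENNReal.ofReal_ne_top]
    exact ENNReal.mul_lt_top ENNReal.ofReal_lt_top h
  have h3 := h1.trans_lt (ENNReal.mul_lt_top
    (ENNReal.rpow_lt_top_of_nonneg (by linarith) hψi.ne) h2)
  exact (ENNReal.rpow_lt_top_iff_of_pos hp0).1 h3

/-- Fubini against a test function, reduced to `integral_clm_apply_integral` by reading the scalar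
ψ(x) as an operator. -/
theorem integral_ofReal_smul_integral {α V : Type*} [MeasurableSpace α] [NormedAddCommGroup V]
    [NormedSpace ℂ V] [CompleteSpace V] {μ : Measure α} [SFinite μ]
    (hθ : IsRadialWeight θ η Cθ) (hp : 1 ≤ p)
    {ψ : EuclideanSpace ℝ (Fin d) → ℝ} (hψ : Continuous ψ) (hψc : HasCompactSupport ψ)
    {k : EuclideanSpace ℝ (Fin d) → α → V}
    (hk : StronglyMeasurable fun q : EuclideanSpace ℝ (Fin d) × α => k q.1 q.2)
    (hG : Measurable G) (h : wInt θ p G < ⊤) {C : ℝ≥0∞} (hC : C ≠ ⊤)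
    (hle : ∀ x, ∫⁻ q, ‖k x q‖ₑ ∂μ ≤ C * G x) :
    ∫ x, ψ x • (∫ q, k x q ∂μ) = ∫ q, (∫ x, ψ x • k x q) ∂μ := by
  have hL : StronglyMeasurable fun x => (ψ x : ℂ) • ContinuousLinearMap.id ℂ V :=
    (Complex.continuous_ofReal.comp hψ).stronglyMeasurable.smul_const _
  have h1 := integral_clm_apply_integral (ν := volume) (μ := μ) hL hk ?_ ?_
  · simpa only [_root_.smul_apply, ContinuousLinearMap.id_apply, Complex.coe_smul] using h1
  · refine lt_of_le_of_lt (b := C * ∫⁻ x, ‖ψ x‖ₑ * G x) ?_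
      (ENNReal.mul_lt_top hC.lt_top (lintegral_mul_lt_top_of_wInt hθ hp hψ hψc hG h))
    rw [← lintegral_const_mul' _ _ hC]
    refine lintegral_mono fun x => ?_
    have h2 : ‖(ψ x : ℂ) • ContinuousLinearMap.id ℂ V‖ₑ ≤ ‖ψ x‖ₑ := by
      rw [← ofReal_norm, ← ofReal_norm]
      refine ENNReal.ofReal_le_ofReal ?_
      rw [norm_smul, Complex.norm_real]
      exact mul_le_of_le_one_right (norm_nonneg _) ContinuousLinearMap.norm_id_le
    calc _ ≤ ‖ψ x‖ₑ * (C * G x) := mul_le_mul' h2 (hle x)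
      _ = _ := by ring
  · filter_upwards [wInt_ae_lt_top hθ.pos hθ.continuous hp hG h] with x hx
    exact (hle x).trans_lt (ENNReal.mul_lt_top hC.lt_top hx)

namespace IsHeatKernel

/-- Under ψ = √(s₀t) y the factor |⟨ψ, u⟩|/(2ta) becomes (√s₀/(2a)) t^{-1/2}|⟨y, u⟩|: the
singularity at t = 0 is reduced to an integrable one. -/
theorem lintegral_kernelDeriv_le (hK : IsHeatKernel S K K' c b s₀ a) {t : ℝ} (ht : 0 < t)
    (x u : EuclideanSpace ℝ (Fin d)) (G : EuclideanSpace ℝ (Fin d) → ℝ≥0∞) :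
    ∫⁻ ξ, ‖K' t (expRotation S t x - ξ) u‖ₑ * G ξ ≤
      ENNReal.ofReal (c * (√s₀ / (2 * a))) * (ENNReal.ofReal (Real.exp (-b * t) * t ^ (-(1 / 2) : ℝ)) *
        ∫⁻ y, gaussDensity 1 y * (ENNReal.ofReal |inner ℝ y u| *
          G (expRotation S t x - √(s₀ * t) • y))) := by
  have h := hK.scale_pos
  have hc := hK.const_nonneg
  have ha := hK.a_pos
  have e : ∀ y : EuclideanSpace ℝ (Fin d), ENNReal.ofReal (|inner ℝ (√(s₀ * t) • y) u| / (2 * t * a))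
      = ENNReal.ofReal (√s₀ / (2 * a) * t ^ (-(1 / 2) : ℝ)) * ENNReal.ofReal |inner ℝ y u| := fun y => by
    rw [← ENNReal.ofReal_mul (by positivity), inner_smul_left, abs_mul, Real.sqrt_mul h.le,
      Real.rpow_neg ht.le, ← Real.sqrt_eq_rpow]
    simp only [conj_trivial]
    rw [abs_of_nonneg (by positivity)]
    congr 1
    have h1 := Real.mul_self_sqrt ht.le
    have h2 := Real.sqrt_pos.2 ht
    field_simp
    rw [sq, h1, mul_comm]
  calc _ ≤ ∫⁻ ψ, ENNReal.ofReal (c * Real.exp (-b * t)) * (gaussDensity (s₀ * t) ψ *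
        (ENNReal.ofReal (|inner ℝ ψ u| / (2 * t * a)) * G (expRotation S t x - ψ))) := by
        rw [← lintegral_sub_left_eq_self _ (expRotation S t x)]
        refine lintegral_mono fun ψ => ?_
        rw [sub_sub_cancel]
        refine (mul_le_mul_left (hK.bound' t ht ψ u) _).trans (le_of_eq ?_)
        ring
    _ = ENNReal.ofReal (c * Real.exp (-b * t)) * ∫⁻ y, gaussDensity 1 y *
        (ENNReal.ofReal (|inner ℝ (√(s₀ * t) • y) u| / (2 * t * a)) *
          G (expRotation S t x - √(s₀ * t) • y)) := by
        rw [lintegral_const_mul' _ _ ENNReal.ofReal_ne_top, lintegral_gaussDensity_mul (by positivity)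
          fun ψ => ENNReal.ofReal (|inner ℝ ψ u| / (2 * t * a)) * G (expRotation S t x - ψ)]
    _ = ENNReal.ofReal (c * Real.exp (-b * t)) * (ENNReal.ofReal (√s₀ / (2 * a) * t ^ (-(1 / 2) : ℝ)) *
        ∫⁻ y, gaussDensity 1 y * (ENNReal.ofReal |inner ℝ y u| *
          G (expRotation S t x - √(s₀ * t) • y))) := by
        rw [← lintegral_const_mul' (ENNReal.ofReal (√s₀ / (2 * a) * t ^ (-(1 / 2) : ℝ))) _
          ENNReal.ofReal_ne_top]
        congr 2
        ext1 y
        rw [e]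
        ring
    _ = _ := by
        rw [← mul_assoc, ← mul_assoc, ← ENNReal.ofReal_mul (by positivity),
          ← ENNReal.ofReal_mul (by positivity)]
        congr 2
        ring

theorem stronglyMeasurable_resolventKernel (hK : IsHeatKernel S K K' c b s₀ a)
    (hg : StronglyMeasurable g) (lam : ℂ) :
    StronglyMeasurable fun q : EuclideanSpace ℝ (Fin d) × (ℝ × EuclideanSpace ℝ (Fin d)) =>
      Complex.exp (-(lam * q.2.1)) • K q.2.1 (expRotation S q.2.1 q.1 - q.2.2) (g q.2.2) := by
  have h1 : Measurable fun q : EuclideanSpace ℝ (Fin d) × (ℝ × EuclideanSpace ℝ (Fin d)) =>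
      Complex.exp (-(lam * q.2.1)) := by fun_prop
  have h2 := hK.stronglyMeasurable_apply
    (t := fun q : EuclideanSpace ℝ (Fin d) × (ℝ × EuclideanSpace ℝ (Fin d)) => q.2.1)
    (ψ := fun q => expRotation S q.2.1 q.1 - q.2.2) (by fun_prop) (by fun_prop)
    (hg.comp_measurable (measurable_snd.comp measurable_snd))
  exact h1.stronglyMeasurable.smul h2

theorem stronglyMeasurable_resolventDerivKernel (hK : IsHeatKernel S K K' c b s₀ a)
    (hg : StronglyMeasurable g) (lam : ℂ) (u : EuclideanSpace ℝ (Fin d)) :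
    StronglyMeasurable fun q : EuclideanSpace ℝ (Fin d) × (ℝ × EuclideanSpace ℝ (Fin d)) =>
      Complex.exp (-(lam * q.2.1)) • K' q.2.1 (expRotation S q.2.1 q.1 - q.2.2)
        (expRotation S q.2.1 u) (g q.2.2) := by
  have h1 : Measurable fun q : EuclideanSpace ℝ (Fin d) × (ℝ × EuclideanSpace ℝ (Fin d)) =>
      Complex.exp (-(lam * q.2.1)) := by fun_prop
  have h3 : Measurable fun q : EuclideanSpace ℝ (Fin d) × (ℝ × EuclideanSpace ℝ (Fin d)) =>
      (q.2.1, expRotation S q.2.1 q.1 - q.2.2, expRotation S q.2.1 u) := by fun_prop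
  have h2 := stronglyMeasurable_clm_apply (hK.meas'.comp_measurable h3)
    (hg.comp_measurable (measurable_snd.comp measurable_snd))
  exact h1.stronglyMeasurable.smul h2

theorem lintegral_resolventKernel_le (hK : IsHeatKernel S K K' c b s₀ a)
    (hg : StronglyMeasurable g) (lam : ℂ) (x : EuclideanSpace ℝ (Fin d)) :
    ∫⁻ q : ℝ × EuclideanSpace ℝ (Fin d), ‖Complex.exp (-(lam * q.1)) •
      K q.1 (expRotation S q.1 x - q.2) (g q.2)‖ₑ ∂((volume.restrict (Ioi 0)).prod volume) ≤
      ENNReal.ofReal c * laplaceAvg S s₀ (lam.re + b) (fun ξ => ‖g ξ‖ₑ) x := by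
  have hc := hK.const_nonneg
  have hm := ((hK.stronglyMeasurable_resolventKernel hg lam).comp_measurable
    (measurable_prodMk_left (x := x))).enorm
  refine (lintegral_prod _ hm.aemeasurable).trans_le ?_
  rw [laplaceAvg, ← lintegral_const_mul' _ _ ENNReal.ofReal_ne_top]
  refine setLIntegral_mono' measurableSet_Ioi fun t ht => ?_
  have h1 : ‖Complex.exp (-(lam * t))‖ₑ = ENNReal.ofReal (Real.exp (-(lam.re * t))) := by
    rw [← ofReal_norm, Complex.norm_exp]
    simp
  calc _ ≤ ∫⁻ ξ, ENNReal.ofReal (Real.exp (-(lam.re * t))) *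
        (‖K t (expRotation S t x - ξ)‖ₑ * ‖g ξ‖ₑ) := by
        refine lintegral_mono fun ξ => ?_
        simp only [Function.comp_apply]
        rw [enorm_smul, h1]
        gcongr
        exact ContinuousLinearMap.le_opENorm _ _
    _ ≤ ENNReal.ofReal (Real.exp (-(lam.re * t))) * (ENNReal.ofReal (c * Real.exp (-b * t)) *
        gaussAvg S s₀ t (fun ξ => ‖g ξ‖ₑ) x) := by
        rw [lintegral_const_mul' _ _ ENNReal.ofReal_ne_top]
        gcongr
        exact hK.lintegral_kernel_le ht x _
    _ = _ := by
        rw [← mul_assoc, ← mul_assoc, ← ENNReal.ofReal_mul (by positivity), ← ENNReal.ofReal_mul hc]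
        congr 2
        rw [show -((lam.re + b) * t) = -(lam.re * t) + -b * t by ring, Real.exp_add]
        ring

theorem lintegral_resolventDerivKernel_le (hK : IsHeatKernel S K K' c b s₀ a)
    (hg : StronglyMeasurable g) (lam : ℂ) (hδ : δ ≤ lam.re + b) (x u : EuclideanSpace ℝ (Fin d)) :
    ∫⁻ q : ℝ × EuclideanSpace ℝ (Fin d), ‖Complex.exp (-(lam * q.1)) •
      K' q.1 (expRotation S q.1 x - q.2) (expRotation S q.1 u) (g q.2)‖ₑ
        ∂((volume.restrict (Ioi 0)).prod volume) ≤
      ENNReal.ofReal (c * (√s₀ / (2 * a))) * derivAvg S s₀ δ u (fun ξ => ‖g ξ‖ₑ) x := by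
  have hm := ((hK.stronglyMeasurable_resolventDerivKernel hg lam u).comp_measurable
    (measurable_prodMk_left (x := x))).enorm
  refine (lintegral_prod _ hm.aemeasurable).trans_le ?_
  rw [derivAvg, ← lintegral_const_mul' _ _ ENNReal.ofReal_ne_top]
  refine setLIntegral_mono' measurableSet_Ioi fun t ht => ?_
  have ht' : 0 < t := ht
  have h1 : ‖Complex.exp (-(lam * t))‖ₑ = ENNReal.ofReal (Real.exp (-(lam.re * t))) := by
    rw [← ofReal_norm, Complex.norm_exp]
    simp
  calc _ ≤ ∫⁻ ξ, ENNReal.ofReal (Real.exp (-(lam.re * t))) *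
        (‖K' t (expRotation S t x - ξ) (expRotation S t u)‖ₑ * ‖g ξ‖ₑ) := by
        refine lintegral_mono fun ξ => ?_
        simp only [Function.comp_apply]
        rw [enorm_smul, h1]
        gcongr
        exact ContinuousLinearMap.le_opENorm _ _
    _ ≤ ENNReal.ofReal (Real.exp (-(lam.re * t))) * (ENNReal.ofReal (c * (√s₀ / (2 * a))) *
        (ENNReal.ofReal (Real.exp (-b * t) * t ^ (-(1 / 2) : ℝ)) *
        ∫⁻ y, gaussDensity 1 y * (ENNReal.ofReal |inner ℝ y (expRotation S t u)| *
          ‖g (expRotation S t x - √(s₀ * t) • y)‖ₑ))) := by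
        rw [lintegral_const_mul' _ _ ENNReal.ofReal_ne_top]
        gcongr
        exact hK.lintegral_kernelDeriv_le ht x _ _
    _ = ENNReal.ofReal (c * (√s₀ / (2 * a))) * (ENNReal.ofReal (Real.exp (-(lam.re * t)) *
        (Real.exp (-b * t) * t ^ (-(1 / 2) : ℝ))) *
        ∫⁻ y, gaussDensity 1 y * (ENNReal.ofReal |inner ℝ y (expRotation S t u)| *
          ‖g (expRotation S t x - √(s₀ * t) • y)‖ₑ)) := by
        rw [ENNReal.ofReal_mul (Real.exp_pos (-(lam.re * t))).le]
        ring
    _ ≤ _ := by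
        refine mul_le_mul_right (mul_le_mul_left (ENNReal.ofReal_le_ofReal ?_) _) _
        rw [← mul_assoc, ← Real.exp_add]
        refine mul_le_mul_of_nonneg_right (Real.exp_le_exp.2 ?_) (by positivity)
        have := mul_le_mul_of_nonneg_right hδ ht'.le
        linarith

theorem enorm_resolventDeriv_le (hK : IsHeatKernel S K K' c b s₀ a) (hg : StronglyMeasurable g)
    (lam : ℂ) (hδ : δ ≤ lam.re + b) (x u : EuclideanSpace ℝ (Fin d)) :
    ‖resolventDeriv S K' lam u g x‖ₑ ≤
      ENNReal.ofReal (c * (√s₀ / (2 * a))) * derivAvg S s₀ δ u (fun ξ => ‖g ξ‖ₑ) x :=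
  (enorm_integral_le_lintegral_enorm _).trans (hK.lintegral_resolventDerivKernel_le hg lam hδ x u)

theorem stronglyMeasurable_resolventDeriv (hK : IsHeatKernel S K K' c b s₀ a)
    (hg : StronglyMeasurable g) (lam : ℂ) (u : EuclideanSpace ℝ (Fin d)) :
    StronglyMeasurable (resolventDeriv S K' lam u g) :=
  (hK.stronglyMeasurable_resolventDerivKernel hg lam u).integral_prod_right'

theorem resolventOp_eq_integral_prod (hK : IsHeatKernel S K K' c b s₀ a)
    (hg : StronglyMeasurable g) {x : EuclideanSpace ℝ (Fin d)}
    (hx : laplaceAvg S s₀ (lam.re + b) (fun ξ => ‖g ξ‖ₑ) x < ⊤) :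
    resolventOp S K lam g x = ∫ q : ℝ × EuclideanSpace ℝ (Fin d), Complex.exp (-(lam * q.1)) •
      K q.1 (expRotation S q.1 x - q.2) (g q.2) ∂((volume.restrict (Ioi 0)).prod volume) := by
  have hm := (hK.stronglyMeasurable_resolventKernel hg lam).comp_measurable
    (measurable_prodMk_left (x := x))
  have hi : Integrable (fun q : ℝ × EuclideanSpace ℝ (Fin d) => Complex.exp (-(lam * q.1)) •
      K q.1 (expRotation S q.1 x - q.2) (g q.2)) ((volume.restrict (Ioi 0)).prod volume) :=
    ⟨hm.aestronglyMeasurable, (hK.lintegral_resolventKernel_le hg lam x).trans_lt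
      (ENNReal.mul_lt_top ENNReal.ofReal_lt_top hx)⟩
  rw [integral_prod _ hi, resolventOp]
  refine integral_congr_ae (Eventually.of_forall fun t => ?_)
  simp only
  rw [integral_smul, heatOp]

/-- Integration by parts for one fixed (t, ξ), where the kernel is classically differentiable along
lines. Compact support of φ removes all integrability questions. -/
theorem integral_fderiv_smul_kernel (hK : IsHeatKernel S K K' c b s₀ a) (t : ℝ)
    (ξ u : EuclideanSpace ℝ (Fin d)) (z : ℂ) (w : EuclideanSpace ℂ (Fin N))
    {φ : EuclideanSpace ℝ (Fin d) → ℝ} (hφ : ContDiff ℝ ∞ φ) (hφc : HasCompactSupport φ) :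
    ∫ x, fderiv ℝ φ x u • z • K t (expRotation S t x - ξ) w
      = -∫ x, φ x • z • K' t (expRotation S t x - ξ) (expRotation S t u) w := by
  have hrot : Continuous fun x => expRotation S t x - ξ :=
    ((continuous_expRotation (S := S)).comp (continuous_const.prodMk continuous_id)).sub
      continuous_const
  have hk : Continuous fun x => z • K t (expRotation S t x - ξ) w :=
    (((hK.cont t).comp hrot).clm_apply continuous_const).const_smul z
  have hk' : Continuous fun x => z • K' t (expRotation S t x - ξ) (expRotation S t u) w :=
    (((hK.cont' t _).comp hrot).clm_apply continuous_const).const_smul z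
  have hdφ : Continuous fun x => fderiv ℝ φ x u :=
    (hφ.continuous_fderiv (by simp)).clm_apply continuous_const
  have hdφc : HasCompactSupport fun x => fderiv ℝ φ x u := hφc.fderiv_apply (𝕜 := ℝ) u
  have key := integral_bilinear_hasLineDerivAt_right_eq_neg_left_of_integrable
    (μ := (volume : Measure (EuclideanSpace ℝ (Fin d)))) (f := φ) (f' := fun x => fderiv ℝ φ x u)
    (g := fun x => z • K t (expRotation S t x - ξ) w)
    (g' := fun x => z • K' t (expRotation S t x - ξ) (expRotation S t u) w) (v := u)
    (B := ContinuousLinearMap.lsmul ℝ ℝ)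
    ((hdφ.smul hk).integrable_of_hasCompactSupport hdφc.smul_right)
    ((hφ.continuous.smul hk').integrable_of_hasCompactSupport hφc.smul_right)
    ((hφ.continuous.smul hk).integrable_of_hasCompactSupport hφc.smul_right)
    (fun x _ => ((hφ.differentiable (by simp)) x).hasFDerivAt.hasLineDerivAt u)
    (fun x _ => by
      have h1 := hK.lineDeriv t ξ x u
      rw [HasLineDerivAt] at h1 ⊢
      have h2 := (((ContinuousLinearMap.apply ℂ (EuclideanSpace ℂ (Fin N)) w).restrictScalars
        ℝ).hasFDerivAt.comp_hasDerivAt (0 : ℝ) h1).const_smul z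
      exact h2)
  simp only [ContinuousLinearMap.lsmul_apply] at key
  rw [key, neg_neg]

/-- The weak derivative of the resolvent. -/
theorem hasWeakPartialDeriv_resolventOp (hK : IsHeatKernel S K K' c b s₀ a)
    (hθ : IsRadialWeight θ η Cθ) (hp : 1 ≤ p) (hδ : δ ≤ lam.re + b) (hg : StronglyMeasurable g)
    (h1 : wInt θ p (laplaceAvg S s₀ δ fun ξ => ‖g ξ‖ₑ) < ⊤) (i : Fin d)
    (h2 : wInt θ p (derivAvg S s₀ δ (EuclideanSpace.single i 1) fun ξ => ‖g ξ‖ₑ) < ⊤) :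
    HasWeakPartialDeriv i (resolventOp S K lam g)
      (resolventDeriv S K' lam (EuclideanSpace.single i 1) g) := by
  set u : EuclideanSpace ℝ (Fin d) := EuclideanSpace.single i 1 with hu
  have hle : ∀ x, laplaceAvg S s₀ (lam.re + b) (fun ξ => ‖g ξ‖ₑ) x ≤
      laplaceAvg S s₀ δ (fun ξ => ‖g ξ‖ₑ) x := fun x => by
    refine setLIntegral_mono' measurableSet_Ioi fun t ht => ?_
    gcongr
    exact le_of_lt ht
  have hGm := measurable_laplaceAvg (S := S) (s₀ := s₀) hg.enorm δ
  have hGm' := measurable_derivAvg (S := S) (s₀ := s₀) (δ := δ) hg.enorm u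
  have hmul : ∀ {C : ℝ} {G : EuclideanSpace ℝ (Fin d) → ℝ≥0∞}, wInt θ p G < ⊤ →
      wInt θ p (fun x => ENNReal.ofReal C * G x) < ⊤ := fun {C G} h => by
    rw [wInt_const_mul_le ENNReal.ofReal_ne_top hp]
    exact ENNReal.mul_lt_top (ENNReal.rpow_lt_top_of_nonneg (by linarith) ENNReal.ofReal_ne_top) h
  refine ⟨?_, ?_, fun φ hφ hφc => ?_⟩
  · refine locallyIntegrable_of_wNorm hθ.pos hθ.continuous hp
      (hK.stronglyMeasurable_resolventOp hg lam).aestronglyMeasurable ?_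
    rw [wNorm_lt_top_iff hθ.pos hp]
    exact (wInt_mono hp fun x => (hK.enorm_resolventOp_le lam g x).trans
      (mul_le_mul_right (hle x) _)).trans_lt (hmul h1)
  · refine locallyIntegrable_of_wNorm hθ.pos hθ.continuous hp
      (hK.stronglyMeasurable_resolventDeriv hg lam u).aestronglyMeasurable ?_
    rw [wNorm_lt_top_iff hθ.pos hp]
    exact (wInt_mono hp fun x => hK.enorm_resolventDeriv_le hg lam hδ x u).trans_lt (hmul h2)
  · have hdφ : Continuous fun x => fderiv ℝ φ x u :=
      (hφ.continuous_fderiv (by simp)).clm_apply continuous_const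
    -- Both sides are rewritten with the (t, ξ)-integral outside, where the kernelwise identity can
    -- be applied; the two finite majorants justify the exchange.
    have e1 := integral_ofReal_smul_integral hθ hp hdφ (hφc.fderiv_apply (𝕜 := ℝ) u)
      (hK.stronglyMeasurable_resolventKernel hg lam) hGm h1 ENNReal.ofReal_ne_top
      (μ := (volume.restrict (Ioi 0)).prod volume) fun x =>
        (hK.lintegral_resolventKernel_le hg lam x).trans (mul_le_mul_right (hle x) _)
    have e2 := integral_ofReal_smul_integral hθ hp hφ.continuous hφc
      (hK.stronglyMeasurable_resolventDerivKernel hg lam u) hGm' h2 ENNReal.ofReal_ne_top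
      (μ := (volume.restrict (Ioi 0)).prod volume) fun x =>
        hK.lintegral_resolventDerivKernel_le hg lam hδ x u
    have e3 : ∫ x, fderiv ℝ φ x u • resolventOp S K lam g x = ∫ x, fderiv ℝ φ x u •
        ∫ q : ℝ × EuclideanSpace ℝ (Fin d), Complex.exp (-(lam * q.1)) •
          K q.1 (expRotation S q.1 x - q.2) (g q.2) ∂((volume.restrict (Ioi 0)).prod volume) := by
      refine integral_congr_ae ?_
      filter_upwards [wInt_ae_lt_top hθ.pos hθ.continuous hp hGm h1] with x hx
      rw [hK.resolventOp_eq_integral_prod hg ((hle x).trans_lt hx)]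
    rw [e3, e1]
    simp only [resolventDeriv]
    rw [e2, ← integral_neg]
    refine integral_congr_ae (Eventually.of_forall fun q => ?_)
    exact hK.integral_fderiv_smul_kernel q.1 q.2 u _ (g q.2) hφ hφc

end IsHeatKernel

end WeakDerivative

/-! ### Sharp constants in the weighted bounds -/

section Constants
variable {d N : ℕ} {S : Matrix (Fin d) (Fin d) ℝ} {θ : EuclideanSpace ℝ (Fin d) → ℝ} {p η Cθ s₀ : ℝ}

/-- Solving pη'√s₀ = 2√κ for η'; the hypothesis on κ says that this solution is at least η. -/
theorem exists_rate_eq (hp : 0 < p) (hs₀ : 0 < s₀) {κ : ℝ} (hκ0 : 0 < κ)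
    (hκ : s₀ * η ^ 2 * p ^ 2 / 4 ≤ κ) :
    ∃ η', η ≤ η' ∧ ∀ t, p * η' * √(s₀ * t) = 2 * √(κ * t) := by
  refine ⟨2 * √(κ / (s₀ * p ^ 2)), ?_, fun t => ?_⟩
  · have : η / 2 ≤ √(κ / (s₀ * p ^ 2)) := by
      refine Real.le_sqrt_of_sq_le ?_
      rw [le_div_iff₀ (by positivity)]
      exact le_trans (le_of_eq (by ring)) hκ
    linarith
  · have e : κ * t = p ^ 2 * (κ / (s₀ * p ^ 2)) * (s₀ * t) := by field_simp
    have e' : √(p ^ 2 * (κ / (s₀ * p ^ 2)) * (s₀ * t)) = p * √(κ / (s₀ * p ^ 2)) * √(s₀ * t) := by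
      rw [Real.sqrt_mul (by positivity), Real.sqrt_mul (by positivity), Real.sqrt_sq hp.le]
    rw [e, e']
    ring

/-- Since m^{p-1}·m = m^p, the p-th root leaves m to the first power and only q and b with the power
1/p. This is the shape of C₇ and C₈. -/
theorem rpow_inv_le_of_le_mul {W I : ℝ≥0∞} {m q b : ℝ} (hp : 1 ≤ p) (hC : 0 ≤ Cθ) (hm : 0 < m)
    (hq : 0 ≤ q)
    (h : W ≤ ENNReal.ofReal Cθ ^ p * (ENNReal.ofReal m ^ (p - 1) * ENNReal.ofReal (m * (q * b))) * I) :
    W ^ (1 / p) ≤ ENNReal.ofReal (Cθ * (m * (q ^ (1 / p) * b ^ (1 / p)))) * I ^ (1 / p) := by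
  have hp0 : 0 < p := by linarith
  -- Here b is the hypergeometric bracket, whose sign is not assumed; if it is nonpositive, the
  -- hypothesis forces W = 0.
  rcases le_total b 0 with hb | hb
  · have : ENNReal.ofReal (m * (q * b)) = 0 :=
      ENNReal.ofReal_eq_zero.2 (mul_nonpos_of_nonneg_of_nonpos hm.le
        (mul_nonpos_of_nonneg_of_nonpos hq hb))
    rw [this, mul_zero, mul_zero, zero_mul, nonpos_iff_eq_zero] at h
    rw [h, ENNReal.zero_rpow_of_pos (by positivity)]
    exact zero_le
  · refine (ENNReal.rpow_le_rpow h (by positivity)).trans (le_of_eq ?_)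
    have h1 : ENNReal.ofReal m ^ (p - 1) * ENNReal.ofReal (m * (q * b))
        = ENNReal.ofReal (m ^ p * (q * b)) := by
      rw [ENNReal.ofReal_rpow_of_pos hm, ← ENNReal.ofReal_mul (by positivity), ← mul_assoc]
      congr 2
      rw [Real.rpow_sub_one hm.ne']
      field_simp
    rw [h1, ENNReal.ofReal_rpow_of_nonneg hC hp0.le, ← ENNReal.ofReal_mul (by positivity),
      ENNReal.mul_rpow_of_nonneg _ _ (by positivity),
      ENNReal.ofReal_rpow_of_nonneg (by positivity) (by positivity)]
    congr 2
    rw [Real.mul_rpow (by positivity) (by positivity), Real.mul_rpow (by positivity) (by positivity),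
      Real.mul_rpow hq hb, ← Real.rpow_mul hC, ← Real.rpow_mul hm.le, mul_one_div_cancel hp0.ne',
      Real.rpow_one, Real.rpow_one]

theorem lintegral_exp_neg_mul_rpow_neg_half {δ : ℝ} (hδ : 0 < δ) :
    ∫⁻ t in Ioi (0 : ℝ), ENNReal.ofReal (Real.exp (-(δ * t)) * t ^ (-(1 / 2) : ℝ)) =
      ENNReal.ofReal (Real.Gamma (1 / 2) * (√δ)⁻¹) := by
  have h := Real.integral_rpow_mul_exp_neg_mul_Ioi (a := 1 / 2) (r := δ) (by norm_num) hδ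
  have e : ∀ t : ℝ, Real.exp (-(δ * t)) * t ^ (-(1 / 2) : ℝ)
      = t ^ ((1 / 2 : ℝ) - 1) * Real.exp (-(δ * t)) := fun t => by
    rw [mul_comm]; norm_num
  have hpos : 0 < Real.Gamma (1 / 2) := Real.Gamma_pos_of_pos (by norm_num)
  simp only [e]
  rw [← ofReal_integral_eq_lintegral_ofReal, h]
  · congr 1
    rw [← Real.sqrt_eq_rpow, Real.sqrt_div zero_le_one, Real.sqrt_one, one_div, mul_comm]
  · refine Integrable.of_integral_ne_zero ?_
    rw [h]
    positivity
  · filter_upwards [ae_restrict_mem measurableSet_Ioi] with t ht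
    have : (0 : ℝ) < t := ht
    positivity

/-- The sharp weighted bound for the resolvent majorant. -/
theorem wInt_laplaceAvg_rpow_le (hd : 1 ≤ d) (hθ : IsRadialWeight θ η Cθ) (hp : 1 ≤ p)
    (hs₀ : 0 < s₀) (hS : S.transpose = -S) {δ τ : ℝ} (hδ : 0 < δ) (hτ : 0 < τ) (hτ1 : τ < 1)
    (hη : s₀ * η ^ 2 * p ^ 2 / 4 ≤ τ * δ) {G : EuclideanSpace ℝ (Fin d) → ℝ≥0∞}
    (hG : Measurable G) :
    wInt θ p (laplaceAvg S s₀ δ G) ^ (1 / p) ≤ ENNReal.ofReal (Cθ * (δ⁻¹ *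
      ((1 / (1 - τ)) ^ (1 / p) * (hyp2F1 (-((d : ℝ) - 1) / 2) 1 (1 / 2) (-(τ / (1 - τ)))
      + Real.pi ^ (1 / 2 : ℝ) * (Real.Gamma (((d : ℝ) + 1) / 2) / Real.Gamma ((d : ℝ) / 2))
        * (τ / (1 - τ)) ^ (1 / 2 : ℝ)
        * hyp2F1 (-((d : ℝ) - 2) / 2) (3 / 2) (3 / 2) (-(τ / (1 - τ)))) ^ (1 / p)))) *
      wInt θ p G ^ (1 / p) := by
  have hp0 : 0 < p := by linarith
  have h3 : 0 < 1 - τ := by linarith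
  obtain ⟨η', hηη', hsq⟩ := exists_rate_eq hp0 hs₀ (mul_pos hτ hδ) hη
  refine rpow_inv_le_of_le_mul hp hθ.const_pos.le (inv_pos.2 hδ) (by positivity) ?_
  have key := wInt_timeAvg_le (s₀ := s₀) (hθ.mono_rate hηη') hp hS
      (r := fun t => ENNReal.ofReal (Real.exp (-(δ * t))))
      (w := fun _ => 1) (by fun_prop) (by fun_prop)
      (n := fun _ _ => 1) measurable_const hG
  simp only [one_mul, mul_one, lintegral_gaussDensity_one hd, lintegral_exp_neg hδ, hsq,
    ENNReal.one_rpow, laplace_gauss_value hd hδ hτ hτ1] at key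
  exact key

/-- The sharp weighted bound for the majorant of the derivative of the resolvent. -/
theorem wInt_derivAvg_rpow_le (hd : 1 ≤ d) (hθ : IsRadialWeight θ η Cθ) (hp : 1 ≤ p)
    (hs₀ : 0 < s₀) (hS : S.transpose = -S) {δ τ : ℝ} (hδ : 0 < δ) (hτ : 0 < τ) (hτ1 : τ < 1)
    (hη : s₀ * η ^ 2 * p ^ 2 / 4 ≤ τ * δ) {u : EuclideanSpace ℝ (Fin d)} (hu : ‖u‖ ≤ 1)
    {G : EuclideanSpace ℝ (Fin d) → ℝ≥0∞} (hG : Measurable G) :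
    wInt θ p (derivAvg S s₀ δ u G) ^ (1 / p) ≤ ENNReal.ofReal (Cθ * (Real.Gamma (1 / 2) * (√δ)⁻¹ *
      (((1 / (1 - τ)) ^ (1 / 2 : ℝ)) ^ (1 / p) * (Real.Gamma (((d : ℝ) + 1) / 2) / Real.Gamma ((d : ℝ) / 2)
        * hyp2F1 (-(d : ℝ) / 2) (1 / 2) (1 / 2) (-(τ / (1 - τ)))
      + 2 * (Real.Gamma (((d : ℝ) + 2) / 2) / (Real.Gamma (1 / 2) * Real.Gamma ((d : ℝ) / 2)))
        * (τ / (1 - τ)) ^ (1 / 2 : ℝ)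
        * hyp2F1 (-((d : ℝ) - 1) / 2) 1 (3 / 2) (-(τ / (1 - τ)))) ^ (1 / p)))) *
      wInt θ p G ^ (1 / p) := by
  have hp0 : 0 < p := by linarith
  have h3 : 0 < 1 - τ := by linarith
  have hΓ : 0 < Real.Gamma (1 / 2) := Real.Gamma_pos_of_pos (by norm_num)
  obtain ⟨η', hηη', hsq⟩ := exists_rate_eq hp0 hs₀ (mul_pos hτ hδ) hη
  refine rpow_inv_le_of_le_mul hp hθ.const_pos.le (by positivity) (by positivity) ?_
  have key := wInt_timeAvg_le (s₀ := s₀) (hθ.mono_rate hηη') hp hS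
      (r := fun t => ENNReal.ofReal (Real.exp (-(δ * t)) * t ^ (-(1 / 2) : ℝ)))
      (w := fun _ => 1) (by fun_prop) (by fun_prop)
      (n := fun t y => ENNReal.ofReal |inner ℝ y (expRotation S t u)|) (by fun_prop) hG
  simp only [one_mul, hsq, ENNReal.one_rpow] at key
  have hu' : ∀ t, ‖expRotation S t u‖ ≤ 1 := fun t => (norm_expRotation hS t u).trans_le hu
  refine key.trans ?_
  -- The two Jensen factors are treated differently: the mass uses E|⟨y, e^{tS}u⟩| ≤ 1, the
  -- exponential moment uses |⟨y, e^{tS}u⟩| ≤ |y|.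
  refine mul_le_mul_left (mul_le_mul_right (mul_le_mul' ?_ ?_) _) _
  · refine ENNReal.rpow_le_rpow ?_ (by linarith)
    rw [← lintegral_exp_neg_mul_rpow_neg_half hδ]
    refine lintegral_mono fun t => ?_
    exact (mul_le_mul_right (lintegral_gaussDensity_mul_abs_inner_le (hu' t)) _).trans_eq (mul_one _)
  · rw [← laplace_gauss_norm_value hd hδ hτ hτ1]
    refine lintegral_mono fun t => ?_
    gcongr with y
    rw [← ENNReal.ofReal_mul (abs_nonneg _)]
    gcongr
    refine (abs_real_inner_le_norm _ _).trans ?_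
    exact mul_le_of_le_one_right (norm_nonneg _) (hu' t)

end Constants

/-! ### The generator of the Ornstein–Uhlenbeck semigroup -/

section Generator
variable {d N : ℕ} {A B Y : Matrix (Fin N) (Fin N) ℂ} {S : Matrix (Fin d) (Fin d) ℝ}
  {θ : EuclideanSpace ℝ (Fin d) → ℝ} {p η Cθ : ℝ} {lam : ℂ}
  {f g v w v' w' : EuclideanSpace ℝ (Fin d) → EuclideanSpace ℂ (Fin N)}

theorem ouSemigroup_eq_heatOp (hY : SimultaneouslyDiagonalizes Y A B)
    (hA : ∀ μ ∈ spectrum ℂ A, 0 < μ.re) {t : ℝ} (ht : 0 < t) :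
    ouSemigroup Y A B S t v = heatOp S (kernelOp Y A B) t v := by
  ext1 x
  rw [ouSemigroup, if_pos ht]
  simp only [toEuclideanCLM_heatKernel hY hA S x _ ht, heatOp]

theorem OrnsteinUhlenbeck.IsGeneratorAt.congr (h : IsGeneratorAt Y A B S p θ v w)
    (hv : v =ᵐ[volume] v') (hw : w =ᵐ[volume] w') : IsGeneratorAt Y A B S p θ v' w' := by
  refine ⟨MemWLp.congr h.1 hv, MemWLp.congr h.2.1 hw, h.2.2.congr' ?_⟩
  filter_upwards [self_mem_nhdsWithin] with t (ht : 0 < t)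
  have e : ouSemigroup Y A B S t v = ouSemigroup Y A B S t v' := by
    ext1 x
    rw [ouSemigroup, ouSemigroup, if_pos ht, if_pos ht]
    exact integral_congr_ae (hv.mono fun ξ hξ => by simp only [hξ])
  refine wNorm_congr ?_
  filter_upwards [hv, hw] with x hx hx'
  rw [e, hx, hx']

theorem isGeneratorAt_iff_heatOp (hY : SimultaneouslyDiagonalizes Y A B)
    (hA : ∀ μ ∈ spectrum ℂ A, 0 < μ.re) :
    IsGeneratorAt Y A B S p θ v w ↔ MemWLp θ p v ∧ MemWLp θ p w ∧
      Tendsto (fun t : ℝ => wNorm θ p fun x => t⁻¹ • (heatOp S (kernelOp Y A B) t v x - v x) - w x)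
        (𝓝[>] 0) (𝓝 0) := by
  refine and_congr_right fun _ => and_congr_right fun _ => tendsto_congr' ?_
  filter_upwards [self_mem_nhdsWithin] with t ht
  rw [ouSemigroup_eq_heatOp hY hA ht]

theorem isGeneratorAt_resolventOp (hd : 1 ≤ d) (hN : 1 ≤ N) (hY : SimultaneouslyDiagonalizes Y A B)
    (hA : ∀ μ ∈ spectrum ℂ A, 0 < μ.re) (hS : S.transpose = -S) (hθ : IsRadialWeight θ η Cθ)
    (hp : 1 ≤ p) (hW : WeightTranslationContinuous θ)
    (hlam : 4 * (aMax A ^ 2 / lowerAbscissa A) * η ^ 2 * p / 4 < lam.re + lowerAbscissa B)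
    (hf : StronglyMeasurable f) (hfn : wNorm θ p f < ⊤) :
    IsGeneratorAt Y A B S p θ (resolventOp S (kernelOp Y A B) lam f)
      (fun x => lam • resolventOp S (kernelOp Y A B) lam f x - f x) := by
  have hK := isHeatKernel_kernelOp hd hN hY hA hS
  obtain ⟨C, hC, hle⟩ := hK.exists_wNorm_resolventOp_le (lam := lam) hθ hp hlam
  have hR := hK.stronglyMeasurable_resolventOp hf lam
  have hRn : wNorm θ p (resolventOp S (kernelOp Y A B) lam f) < ⊤ :=
    (hle f hf).trans_lt (ENNReal.mul_lt_top hC.lt_top hfn)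
  have hRl : StronglyMeasurable fun x => lam • resolventOp S (kernelOp Y A B) lam f x :=
    hR.const_smul lam
  rw [isGeneratorAt_iff_heatOp hY hA, memWLp_iff hθ.pos hθ.continuous hp,
    memWLp_iff hθ.pos hθ.continuous hp]
  refine ⟨⟨hR.aestronglyMeasurable, hRn⟩, ⟨(hRl.sub hf).aestronglyMeasurable, ?_⟩,
    hK.tendsto_wNorm_quotient_resolventOp hθ hp hW hlam hf hfn⟩
  refine (wNorm_sub_le hθ.continuous hp hRl.aestronglyMeasurable hf.aestronglyMeasurable).trans_lt ?_
  rw [wNorm_const_smul]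
  exact ENNReal.add_lt_top.2 ⟨ENNReal.mul_lt_top enorm_lt_top hRn, hfn⟩

/-- Passage to strongly measurable representatives, for which `eq_resolventOp_of_tendsto` applies.
-/
theorem OrnsteinUhlenbeck.IsGeneratorAt.eq_resolventOp (h : IsGeneratorAt Y A B S p θ v w)
    (hd : 1 ≤ d) (hN : 1 ≤ N) (hY : SimultaneouslyDiagonalizes Y A B)
    (hA : ∀ μ ∈ spectrum ℂ A, 0 < μ.re) (hS : S.transpose = -S) (hθ : IsRadialWeight θ η Cθ)
    (hp : 1 ≤ p) (hW : WeightTranslationContinuous θ)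
    (hlam : 4 * (aMax A ^ 2 / lowerAbscissa A) * η ^ 2 * p / 4 < lam.re + lowerAbscissa B) :
    v =ᵐ[volume] resolventOp S (kernelOp Y A B) lam fun x => lam • v x - w x := by
  have hv := h.1.1.aestronglyMeasurable
  have hw := h.2.1.1.aestronglyMeasurable
  have h' := h.congr hv.ae_eq_mk hw.ae_eq_mk
  rw [isGeneratorAt_iff_heatOp hY hA] at h'
  have hK := isHeatKernel_kernelOp hd hN hY hA hS
  have key := hK.eq_resolventOp_of_tendsto (lam := lam) hθ hp hW hlam hv.stronglyMeasurable_mk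
    h'.1.2 hw.stronglyMeasurable_mk h'.2.1.2 h'.2.2
  rw [resolventOp_congr_ae (g := fun x => lam • v x - w x)] at key
  · exact hv.ae_eq_mk.trans key
  · filter_upwards [hv.ae_eq_mk, hw.ae_eq_mk] with x hx hx'
    rw [← hx, ← hx']

/-- The resolvent equation is solved exactly by the Laplace transform of the semigroup. -/
theorem solvesResolventEq_iff (hd : 1 ≤ d) (hN : 1 ≤ N) (hY : SimultaneouslyDiagonalizes Y A B)
    (hA : ∀ μ ∈ spectrum ℂ A, 0 < μ.re) (hS : S.transpose = -S) (hθ : IsRadialWeight θ η Cθ)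
    (hp : 1 ≤ p) (hW : WeightTranslationContinuous θ)
    (hlam : 4 * (aMax A ^ 2 / lowerAbscissa A) * η ^ 2 * p / 4 < lam.re + lowerAbscissa B)
    (hg : MemWLp θ p g) :
    SolvesResolventEq Y A B S p θ lam g v ↔
      v =ᵐ[volume] resolventOp S (kernelOp Y A B) lam g := by
  constructor
  · rintro ⟨w, hvw, hg'⟩
    rw [← resolventOp_congr_ae hg']
    exact hvw.eq_resolventOp hd hN hY hA hS hθ hp hW hlam
  · intro hv
    have hgm := hg.1.aestronglyMeasurable
    have hR := isGeneratorAt_resolventOp hd hN hY hA hS hθ hp hW hlam hgm.stronglyMeasurable_mk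
      (MemWLp.congr hg hgm.ae_eq_mk).2
    rw [← resolventOp_congr_ae hgm.ae_eq_mk] at hR
    refine ⟨_, hR.congr hv.symm (Filter.EventuallyEq.rfl), ?_⟩
    filter_upwards [hv, hgm.ae_eq_mk] with x hx hx'
    rw [hx, ← hx']
    abel

end Generator

/-! ### Uniqueness of weak derivatives -/

section WeakDerivative
variable {d N : ℕ} {v v' w w' : EuclideanSpace ℝ (Fin d) → EuclideanSpace ℂ (Fin N)} {i : Fin d}

theorem OrnsteinUhlenbeck.HasWeakPartialDeriv.congr (h : HasWeakPartialDeriv i v w)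
    (hv : v =ᵐ[volume] v') : HasWeakPartialDeriv i v' w := by
  refine ⟨h.1.congr hv, h.2.1, fun φ hφ hφc => ?_⟩
  rw [← h.2.2 φ hφ hφc]
  exact integral_congr_ae (hv.mono fun x hx => by simp only [hx])

theorem OrnsteinUhlenbeck.HasWeakPartialDeriv.unique (h : HasWeakPartialDeriv i v w)
    (h' : HasWeakPartialDeriv i v w') : w =ᵐ[volume] w' := by
  refine ae_eq_of_integral_contDiff_smul_eq h.2.1 h'.2.1 fun φ hφ hφc => ?_
  rw [← neg_inj, ← h.2.2 φ hφ hφc, h'.2.2 φ hφ hφc]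

end WeakDerivative

/-! ### Explicit resolvent bounds and the theorem -/

section ResolventBounds
variable {d N : ℕ} {A B Y : Matrix (Fin N) (Fin N) ℂ} {S : Matrix (Fin d) (Fin d) ℝ}
  {θ : EuclideanSpace ℝ (Fin d) → ℝ} {p η Cθ δ τ : ℝ} {lam : ℂ}
  {g : EuclideanSpace ℝ (Fin d) → EuclideanSpace ℂ (Fin N)}

theorem laplaceAvg_anti {s₀ δ δ' : ℝ} (h : δ ≤ δ') (G : EuclideanSpace ℝ (Fin d) → ℝ≥0∞)
    (x : EuclideanSpace ℝ (Fin d)) : laplaceAvg S s₀ δ' G x ≤ laplaceAvg S s₀ δ G x := by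
  refine lintegral_mono_ae ?_
  filter_upwards [ae_restrict_mem measurableSet_Ioi] with t ht
  have : (0 : ℝ) < t := ht
  gcongr

theorem lowerAbscissa_pos_of_re_pos (hN : 1 ≤ N) (hY : SimultaneouslyDiagonalizes Y A B)
    (hA : ∀ μ ∈ spectrum ℂ A, 0 < μ.re) : 0 < lowerAbscissa A :=
  lowerAbscissa_pos hN (spectrum_eq_range hY).1 fun k =>
    hA _ (by rw [(spectrum_eq_range hY).1]; exact ⟨k, rfl⟩)

/-- The resolvent maps `L^p_θ` to `W^{1,p}_θ`, with explicit bounds. -/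
theorem resolventOp_bounds (hd : 1 ≤ d) (hN : 1 ≤ N) (hY : SimultaneouslyDiagonalizes Y A B)
    (hA : ∀ μ ∈ spectrum ℂ A, 0 < μ.re) (hS : S.transpose = -S) (hθ : IsRadialWeight θ η Cθ)
    (hp : 1 ≤ p) (hδ : 0 < δ) (hδle : δ ≤ lam.re + lowerAbscissa B) (hτ : 0 < τ) (hτ1 : τ < 1)
    (hη : η ^ 2 ≤ τ * (lowerAbscissa A * δ / (aMax A ^ 2 * p ^ 2)))
    (hg : StronglyMeasurable g) (hgn : wNorm θ p g < ⊤) :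
    (MemWLp θ p (resolventOp S (kernelOp Y A B) lam g) ∧
      wNorm θ p (resolventOp S (kernelOp Y A B) lam g) ≤
        ENNReal.ofReal (C7 d Y A p Cθ τ / δ) * wNorm θ p g) ∧
    ∀ i, ∃ w, HasWeakPartialDeriv i (resolventOp S (kernelOp Y A B) lam g) w ∧ MemWLp θ p w ∧
      wNorm θ p w ≤ ENNReal.ofReal (C8 d Y A p Cθ τ / δ ^ (1 / 2 : ℝ)) * wNorm θ p g := by
  have hp0 : 0 < p := by linarith
  have h3 : 0 < 1 - τ := by linarith
  have hK := isHeatKernel_kernelOp hd hN hY hA hS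
  have ha0 := lowerAbscissa_pos_of_re_pos hN hY hA
  have hamin := (aMin_bounds hN hY hA).1
  have hs₀ := hK.scale_pos
  have hc := hK.const_nonneg
  have hmax : 0 < aMax A ^ 2 := by
    have : 0 < aMax A ^ 2 / lowerAbscissa A := by linarith
    exact (div_pos_iff_of_pos_right ha0).1 this
  have ha1 : 0 < a1 A := div_pos hmax (mul_pos hamin ha0)
  have hη' : 4 * (aMax A ^ 2 / lowerAbscissa A) * η ^ 2 * p ^ 2 / 4 ≤ τ * δ := by
    have : τ * (lowerAbscissa A * δ / (aMax A ^ 2 * p ^ 2))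
        = τ * δ / (aMax A ^ 2 / lowerAbscissa A * p ^ 2) := by field_simp
    rw [this, le_div_iff₀ (by positivity)] at hη
    linarith
  have hgn' := hgn
  rw [wNorm_lt_top_iff hθ.pos hp] at hgn'
  have hge : Measurable fun x => ‖g x‖ₑ := hg.measurable.enorm
  have key7 := wInt_laplaceAvg_rpow_le hd hθ hp hs₀ hS hδ hτ hτ1 hη' hge
  have key8 := fun i : Fin d => wInt_derivAvg_rpow_le (u := EuclideanSpace.single i (1 : ℝ))
    hd hθ hp hs₀ hS hδ hτ hτ1 hη' (by simp) hge
  have fin : ∀ {W : ℝ≥0∞} {k : ℝ}, W ^ (1 / p) ≤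
      ENNReal.ofReal k * (wInt θ p fun x => ‖g x‖ₑ) ^ (1 / p) → W < ⊤ := fun {W k} h => by
    rw [← ENNReal.rpow_lt_top_iff_of_pos (show 0 < 1 / p by positivity)]
    exact h.trans_lt (ENNReal.mul_lt_top ENNReal.ofReal_lt_top
      (ENNReal.rpow_lt_top_of_nonneg (by positivity) hgn'.ne))
  rw [wNorm_eq hθ.pos hp g]
  constructor
  · have hle : wNorm θ p (resolventOp S (kernelOp Y A B) lam g) ≤
        ENNReal.ofReal (C7 d Y A p Cθ τ / δ) * (wInt θ p fun x => ‖g x‖ₑ) ^ (1 / p) := by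
      refine (wNorm_le_of_ae_le hθ.pos hp ENNReal.ofReal_ne_top (Eventually.of_forall fun x =>
        (hK.enorm_resolventOp_le lam g x).trans
          (mul_le_mul_right (laplaceAvg_anti hδle _ x) _))).trans ?_
      refine (mul_le_mul_right key7 _).trans_eq ?_
      rw [← mul_assoc, ← ENNReal.ofReal_mul hc, C7]
      congr 2
      ring
    refine ⟨(memWLp_iff hθ.pos hθ.continuous hp).2
      ⟨(hK.stronglyMeasurable_resolventOp hg lam).aestronglyMeasurable, hle.trans_lt ?_⟩, hle⟩
    exact ENNReal.mul_lt_top ENNReal.ofReal_lt_top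
      (ENNReal.rpow_lt_top_of_nonneg (by positivity) hgn'.ne)
  · intro i
    have hle : wNorm θ p (resolventDeriv S (kernelOpDeriv Y A B) lam (EuclideanSpace.single i 1) g) ≤
        ENNReal.ofReal (C8 d Y A p Cθ τ / δ ^ (1 / 2 : ℝ)) *
          (wInt θ p fun x => ‖g x‖ₑ) ^ (1 / p) := by
      refine (wNorm_le_of_ae_le hθ.pos hp ENNReal.ofReal_ne_top (Eventually.of_forall fun x =>
        hK.enorm_resolventDeriv_le hg lam hδle x _)).trans ?_
      refine (mul_le_mul_right (key8 i) _).trans_eq ?_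
      -- Because a_max²/a₀ = a₁a_min, the factor √s₀/(2a_min) from the differentiated kernel is
      -- (a₁/a_min)^{1/2}. This explains the exponent (d+1)/2 and the factor a_min^{-1/2} in C₈.
      have hs : √(4 * (aMax A ^ 2 / lowerAbscissa A)) / (2 * aMin A)
          = a1 A ^ (1 / 2 : ℝ) / aMin A ^ (1 / 2 : ℝ) := by
        have : aMax A ^ 2 / lowerAbscissa A = a1 A * aMin A := by rw [a1]; field_simp
        rw [this, ← Real.sqrt_eq_rpow, ← Real.sqrt_eq_rpow, Real.sqrt_mul (by norm_num),
          Real.sqrt_mul ha1.le, show (4 : ℝ) = 2 ^ 2 by norm_num, Real.sqrt_sq (by norm_num)]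
        have h4 := Real.sq_sqrt hamin.le
        have h5 := Real.sqrt_pos.2 hamin
        rw [div_eq_div_iff (by positivity) (by positivity)]
        linear_combination 2 * √(a1 A) * h4
      have h1 : a1 A ^ (((d : ℝ) + 1) / 2) = a1 A ^ ((d : ℝ) / 2) * a1 A ^ (1 / 2 : ℝ) := by
        rw [← Real.rpow_add ha1, add_div]
      have h2 : ((1 / (1 - τ)) ^ (1 / 2 : ℝ)) ^ (1 / p) = (1 / (1 - τ)) ^ (1 / (2 * p)) := by
        rw [← Real.rpow_mul (by positivity)]
        congr 1
        field_simp
      rw [← mul_assoc, ← ENNReal.ofReal_mul (by positivity), C8, hs, h1, h2, ← Real.sqrt_eq_rpow δ]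
      congr 2
      ring
    refine ⟨_, hK.hasWeakPartialDeriv_resolventOp hθ hp hδle hg (fin key7) i (fin (key8 i)),
      (memWLp_iff hθ.pos hθ.continuous hp).2
      ⟨(hK.stronglyMeasurable_resolventDeriv hg lam _).aestronglyMeasurable, hle.trans_lt ?_⟩, hle⟩
    exact ENNReal.mul_lt_top ENNReal.ofReal_lt_top
      (ENNReal.rpow_lt_top_of_nonneg (by positivity) hgn'.ne)

/-- With s₀ = 4a_max²/a₀ the threshold s₀η²p/4 is a_max²η²p/a₀, which is at most ω + b₀. So Re λ > ω
lies in the range where the resolvent is bounded, and δ = Re λ - ω is an admissible smaller decay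
rate. -/
theorem growthBound_bounds (hN : 1 ≤ N) (hY : SimultaneouslyDiagonalizes Y A B)
    (hA : ∀ μ ∈ spectrum ℂ A, 0 < μ.re) (hp : 1 ≤ p) {ε : ℝ} (hε : 0 < ε)
    (hlam : growthBound A B p η ε < lam.re) :
    4 * (aMax A ^ 2 / lowerAbscissa A) * η ^ 2 * p / 4 < lam.re + lowerAbscissa B ∧
      lam.re - growthBound A B p η ε ≤ lam.re + lowerAbscissa B := by
  have ha0 := lowerAbscissa_pos_of_re_pos hN hY hA
  have h : 0 ≤ aMax A ^ 2 * η ^ 2 * p / lowerAbscissa A := by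
    have : 0 < p := by linarith
    positivity
  have e : 4 * (aMax A ^ 2 / lowerAbscissa A) * η ^ 2 * p / 4
      = aMax A ^ 2 * η ^ 2 * p / lowerAbscissa A := by ring
  rw [growthBound] at hlam ⊢
  have h2 := mul_nonneg hε.le h
  constructor <;> linarith

/-- Regularity and bounds for solutions of the resolvent equation. -/
theorem OrnsteinUhlenbeck.SolvesResolventEq.bounds {θ₁ : EuclideanSpace ℝ (Fin d) → ℝ}
    {η₁ Cθ₁ ε : ℝ} (hd : 1 ≤ d) (hN : 1 ≤ N)
    (hY : SimultaneouslyDiagonalizes Y A B) (hA : ∀ μ ∈ spectrum ℂ A, 0 < μ.re)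
    (hS : S.transpose = -S) (hp : 1 ≤ p) (hθ₁ : IsRadialWeight θ₁ η₁ Cθ₁)
    (hW : WeightTranslationContinuous θ₁) (hτ : 0 < τ) (hτ1 : τ < 1) (hε : 0 < ε)
    (hlam : growthBound A B p η₁ ε < lam.re) (hθ : IsRadialWeight θ η Cθ)
    (hη : η ^ 2 ≤ τ * (lowerAbscissa A * (lam.re - growthBound A B p η₁ ε)
          / (aMax A ^ 2 * p ^ 2))) (hg₁ : MemWLp θ₁ p g) (hg : MemWLp θ p g)
    {v : EuclideanSpace ℝ (Fin d) → EuclideanSpace ℂ (Fin N)}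
    (hv : SolvesResolventEq Y A B S p θ₁ lam g v) :
    MemWSobolev θ p v ∧
      wNorm θ p v ≤ ENNReal.ofReal (C7 d Y A p Cθ τ / (lam.re - growthBound A B p η₁ ε))
        * wNorm θ p g ∧
      ∀ i w, HasWeakPartialDeriv i v w →
        wNorm θ p w ≤ ENNReal.ofReal
            (C8 d Y A p Cθ τ / (lam.re - growthBound A B p η₁ ε) ^ (1 / 2 : ℝ))
          * wNorm θ p g := by
  obtain ⟨hl, hδle⟩ := growthBound_bounds hN hY hA hp hε hlam
  -- The weight θ₁ serves only to identify v with the Laplace integral; all bounds that follow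
  -- concern that integral in the other weight.
  rw [solvesResolventEq_iff hd hN hY hA hS hθ₁ hp hW hl hg₁] at hv
  have hgm := hg.1.aestronglyMeasurable
  obtain ⟨⟨hR, hRn⟩, hD⟩ := resolventOp_bounds (lam := lam) hd hN hY hA hS hθ hp (sub_pos.2 hlam) hδle
    hτ hτ1 hη hgm.stronglyMeasurable_mk (MemWLp.congr hg hgm.ae_eq_mk).2
  rw [← resolventOp_congr_ae hgm.ae_eq_mk] at hR hRn hD
  rw [← wNorm_congr hgm.ae_eq_mk] at hRn hD
  refine ⟨⟨MemWLp.congr hR hv.symm, fun i => ?_⟩, (wNorm_congr hv).trans_le hRn, fun i w hw => ?_⟩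
  · obtain ⟨w, hw, hwp, -⟩ := hD i
    exact ⟨w, hw.congr hv.symm, hwp⟩
  · obtain ⟨w', hw', -, hle⟩ := hD i
    exact (wNorm_congr ((hw.congr hv).unique hw')).trans_le hle

end ResolventBounds

theorem theorem5p6 {d N : ℕ} (hd : 1 ≤ d) (hN : 1 ≤ N)
    (A B Y : Matrix (Fin N) (Fin N) ℂ) (S : Matrix (Fin d) (Fin d) ℝ)
    (hY : SimultaneouslyDiagonalizes Y A B)
    (hA : ∀ μ ∈ spectrum ℂ A, 0 < μ.re)
    (hS : S.transpose = -S)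
    (p : ℝ) (hp : 1 ≤ p)
    (θ₁ : EuclideanSpace ℝ (Fin d) → ℝ) (η₁ Cθ₁ : ℝ)
    (hθ₁ : IsRadialWeight θ₁ η₁ Cθ₁) (hW4 : WeightTranslationContinuous θ₁) :
    (∀ (τ ε : ℝ) (lam : ℂ), 0 < τ → τ < 1 → 0 < ε → growthBound A B p η₁ ε < lam.re →
      ∀ (θ₂ : EuclideanSpace ℝ (Fin d) → ℝ) (η₂ Cθ₂ : ℝ), IsRadialWeight θ₂ η₂ Cθ₂ →
        η₂ ^ 2 ≤ τ * (lowerAbscissa A * (lam.re - growthBound A B p η₁ ε)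
          / (aMax A ^ 2 * p ^ 2)) →
        (∃ C > 0, ∀ x, θ₁ x ≤ C * θ₂ x) →
      ∀ g : EuclideanSpace ℝ (Fin d) → EuclideanSpace ℂ (Fin N),
        MemWLp θ₁ p g → MemWLp θ₂ p g →
        (∃ v, SolvesResolventEq Y A B S p θ₁ lam g v) ∧
        (∀ v v', SolvesResolventEq Y A B S p θ₁ lam g v →
          SolvesResolventEq Y A B S p θ₁ lam g v' → v =ᵐ[volume] v') ∧
        ∀ v, SolvesResolventEq Y A B S p θ₁ lam g v →
          MemWSobolev θ₂ p v ∧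
          wNorm θ₂ p v ≤ ENNReal.ofReal (C7 d Y A p Cθ₂ τ / (lam.re - growthBound A B p η₁ ε))
            * wNorm θ₂ p g ∧
          ∀ i w, HasWeakPartialDeriv i v w →
            wNorm θ₂ p w ≤ ENNReal.ofReal
                (C8 d Y A p Cθ₂ τ / (lam.re - growthBound A B p η₁ ε) ^ (1 / 2 : ℝ))
              * wNorm θ₂ p g) ∧
    ∀ v : EuclideanSpace ℝ (Fin d) → EuclideanSpace ℂ (Fin N),
      MemGeneratorDomain Y A B S p θ₁ v → MemWSobolev θ₁ p v := by
  constructor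
  · intro τ ε lam hτ hτ1 hε hlam θ₂ η₂ Cθ₂ hθ₂ hη _ g hg₁ hg₂
    obtain ⟨hl, -⟩ := growthBound_bounds hN hY hA hp hε hlam
    have iff := fun v => solvesResolventEq_iff (v := v) hd hN hY hA hS hθ₁ hp hW4 hl hg₁
    refine ⟨⟨_, (iff _).2 Filter.EventuallyEq.rfl⟩,
      fun v v' hv hv' => ((iff v).1 hv).trans ((iff v').1 hv').symm, fun v hv => ?_⟩
    exact hv.bounds hd hN hY hA hS hp hθ₁ hW4 hτ hτ1 hε hlam hθ₂ hη hg₁ hg₂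
  · rintro v ⟨w, hvw⟩
    have hp0 : 0 < p := by linarith
    have ha0 := lowerAbscissa_pos_of_re_pos hN hY hA
    have hs₀ := (isHeatKernel_kernelOp hd hN hY hA hS).scale_pos
    have hmax : 0 < aMax A ^ 2 := by
      have : 0 < aMax A ^ 2 / lowerAbscissa A := by linarith
      exact (div_pos_iff_of_pos_right ha0).1 this
    -- With ϑ = 1/2, ε = 1 and θ₂ = θ₁ the condition on the rate reads δ ≥ 2η₁²a_max²p²/a₀ for δ =
    -- Re λ - ω; the summand 1 keeps δ positive when η₁ = 0. For this real λ, v solves the resolvent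
    -- equation with right-hand side λv - w.
    set δ := 1 + 2 * (η₁ ^ 2 * (aMax A ^ 2 * p ^ 2 / lowerAbscissa A)) with hδ
    have hδ0 : 0 < δ := by positivity
    set lam : ℂ := ((growthBound A B p η₁ 1 + δ : ℝ) : ℂ) with hlam
    have hre : lam.re = growthBound A B p η₁ 1 + δ := Complex.ofReal_re _
    have hsub : lam.re - growthBound A B p η₁ 1 = δ := by rw [hre]; ring
    have hv := hvw.1
    have hlw : MemWLp θ₁ p fun x => lam • v x - w x := by
      rw [memWLp_iff hθ₁.pos hθ₁.continuous hp]
      have hvm := hv.1.aestronglyMeasurable.const_smul lam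
      refine ⟨hvm.sub hvw.2.1.1.aestronglyMeasurable, ?_⟩
      refine (wNorm_sub_le hθ₁.continuous hp hvm hvw.2.1.1.aestronglyMeasurable).trans_lt ?_
      have := wNorm_const_smul (θ := θ₁) (p := p) lam v
      exact ENNReal.add_lt_top.2
        ⟨this.trans_lt (ENNReal.mul_lt_top enorm_lt_top hv.2), hvw.2.1.2⟩
    have hη : η₁ ^ 2 ≤ 1 / 2 * (lowerAbscissa A * (lam.re - growthBound A B p η₁ 1)
          / (aMax A ^ 2 * p ^ 2)) := by
      rw [hsub, mul_div_assoc', le_div_iff₀ (by positivity), hδ]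
      have : lowerAbscissa A * (η₁ ^ 2 * (aMax A ^ 2 * p ^ 2 / lowerAbscissa A))
          = η₁ ^ 2 * (aMax A ^ 2 * p ^ 2) := by field_simp
      nlinarith
    exact (SolvesResolventEq.bounds hd hN hY hA hS hp hθ₁ hW4 one_half_pos one_half_lt_one one_pos
      (by rw [hre]; linarith) hθ₁ hη hlw hlw ⟨w, hvw, Filter.EventuallyEq.rfl⟩).1
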